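/- **Setting.** Let $(Z,T,Y(0),Y(1))$ have law $P$, where $Z$ takes values in a standard Borel space $\mathcal Z$ (e.g. $\mathbb R^d$), $T\in\{0,1\}$, $\mathbb E|Y(0)|<\infty$, and put $Y=TY(1)+(1-T)Y(0)$. Assume $T\perp\{Y(0),Y(1)\}\mid Z$ and $0<e(z)<1$ for all $z$, where $e(z)=\mathbb P(T=1\mid Z=z)$. Let $p=\mathbb P(T=1)$, $m_0(z)=\mathbb E[Y(0)\mid Z=z]$, $w^*(z)=\frac{e(z)}{1-e(z)}\cdot\frac{1-p}{p}$ and $\theta_0=\mathbb E[Y(0)\mid T=1]$. For each $n$ let $X=X^{(n)}=\phi_n(Z)\in\mathbb R^{p_n}$ be a dictionary of features; $p_n$ may grow with $n$. The features are sub-Gaussian uniformly in the feature and in $n$: for some constants $\sigma^2,B$, each $X_j-\mathbb E X_j$ is $\sigma^2$-sub-Gaussian and $|\mathbb E X_j|\le B$. For $S\subseteq\{1,\dots,p_n\}$ and $f:\mathcal Z\to\mathbb R$ let $$\epsilon(S;f)=\inf_{\eta\in\mathbb R^{|S|}}\big(\mathbb E[(f(Z)-\eta^\top X_S)^2\mid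 T=0]\big)^{1/2},$$ with a minimizer denoted by $\eta(S;f)$. **Procedure.** From an i.i.d. sample of size $n$ one observes $(Z_i,T_i,Y_i)_{i\le n}$. The control indices $\mathcal I_c$ and the treated indices $\mathcal I_t$ are each split into two folds, $\mathcal I_{c,1}\cup\mathcal I_{c,2}$ and $\mathcal I_{t,1}\cup\mathcal I_{t,2}$, whose sizes differ by at most one, by a rule that uses only $(T_i)_{i\le n}$ and randomness independent of the sample. For $k=1,2$, a set $\hat S^{(k)}\subseteq\{1,\dots,p_n\}$ and a tolerance $\delta_n^{(k)}\ge0$ (possibly deterministic and common to both folds) are computed by an arbitrary measurable rule from the split, such independent randomness, and the data of the fold other than $k$; no data of fold $k$ are used. Almost surely, for all large $n$, the linear span of $X_{\hat S^{(k)}}$ contains the constant function $1$ (the intercept is among the balanced features). The weights $(\hat w_i)_{i\in\mathcal I_{c,k}}$ minimize $\sum_{i\in\mathcal I_{c,k}}w_i^2$ subject to $$\Big|\tfrac1{|\mathcal I_{c,k}|}\sum_{i\in\mathcal I_{c,k}}w_iX_{ij}-\tfrac1{|\mathcal I_{t,k}|}\sum_{i\in\mathcal I_{t,k}}X_{ij}\Big|\le\delta_n^{(k)}\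 (j\in\hat S^{(k)}),\qquad \tfrac1{|\mathcal I_{c,k}|}\sum_{i\in\mathcal I_{c,k}}w_i=1$$ (arbitrary weights if there is no feasible point), and the cross-balancing estimator is $\hat\theta_0=\frac1{|\mathcal I_c|}\sum_{i\in\mathcal I_c}\hat w_iY_i$. **Theorem.** Suppose that for $k=1,2$: (i) $\epsilon(\hat S^{(k)};w^*)=o_P(1)$, $\epsilon(\hat S^{(k)};m_0)=o_P(1)$ and $\epsilon(\hat S^{(k)};w^*)\,\epsilon(\hat S^{(k)};m_0)=o_P(n^{-1/2})$; moreover, for constants $M_1,M_2,M_3$, almost surely $\mathbb E[(Y(0)-m_0(Z))^2\mid Z]\le M_1$ and $w^*(Z)\le M_2$, and, for all large $n$, $|w^*(Z)-\eta(\hat S^{(k)};w^*)^\top X_{\hat S^{(k)}}|\le M_2$ (for $Z$ independent of the sample) and $\|\eta(\hat S^{(k)};m_0)\|_1\le M_3$; (ii) $\delta_n^{(k)}=o_P(n^{-1/2})$; (iii) there are positive functions $\xi=\xi_{k,n}$ on the subsets of $\{1,\dots,p_n\}$ such that, with probability tending to one, $\frac1n\sum_{i\in\mathcal I_{c,k}}(X_{i,\hat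 S^{(k)}}^\top v)^2\ge\xi(\hat S^{(k)})\|v\|_1^2$ for all $v\in\mathbb R^{|\hat S^{(k)}|}$; moreover $\log(|\hat S^{(k)}|)/\xi(\hat S^{(k)})=o_P(n)$ and $\epsilon(\hat S^{(k)};m_0)\,[\log(|\hat S^{(k)}|)/\xi(\hat S^{(k)})]^{1/2}=o_P(1)$. Then $\sqrt n(\hat\theta_0-\theta_0)$ converges in distribution to $N(0,\sigma_0^2)$, where $$\sigma_0^2=\operatorname{Var}\Big\{\frac{(1-T)\,w^*(Z)\,[Y(0)-m_0(Z)]}{1-p}+\frac{T\,[m_0(Z)-\theta_0]}{p}\Big\}<\infty,$$ and $\sigma_0^2$ is the semiparametric efficiency bound for $\theta_0$. That is, let $Q$ be the law of $(Z,T,Y)$ and $\theta(Q)=\mathbb E_Q\big[\mathbb E_Q[Y\mid Z,T=0]\,\big|\,T=1\big]$. Then $\theta(Q)=\theta_0$; along every submodel $dQ_t=(1+ts)\,dQ$ with bounded measurable score $s$, $\mathbb E_Q s=0$, the map $t\mapsto\theta(Q_t)$ is differentiable at $0$; and $\sigma_0^2$ is the supremum of the Cramér–Rao bounds $\big(\tfrac{d}{dt}\theta(Q_t)\big|_{t=0}\big)^2/\mathbb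 E_Q[s^2]$ over all such $s$ with $\mathbb E_Q[s^2]>0$. -/

import Mathlib

open MeasureTheory ProbabilityTheory Filter Topology
open scoped ENNReal NNReal

noncomputable section

namespace CrossBalancing

variable {𝓩 𝓤 Ω : Type*} [MeasurableSpace 𝓩] [MeasurableSpace 𝓤] [MeasurableSpace Ω]

/-! ### Units, observed data and population quantities -/

/-- One unit with its potential outcomes: covariates, treatment indicator, `Y(0)`, `Y(1)`. -/
abbrev PotentialUnit (𝓩 : Type*) := 𝓩 × Bool × ℝ × ℝ

/-- What is observed on one unit: covariates, treatment indicator, outcome. -/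
abbrev ObservedUnit (𝓩 : Type*) := 𝓩 × Bool × ℝ

/-- The treatment indicator of a unit. -/
def trt (u : PotentialUnit 𝓩) : Bool := u.2.1

/-- The potential outcome under control. -/
def y0 (u : PotentialUnit 𝓩) : ℝ := u.2.2.1

/-- The potential outcome under treatment. -/
def y1 (u : PotentialUnit 𝓩) : ℝ := u.2.2.2

/-- Numerical value (`0` or `1`) of the treatment indicator. -/
def ind (b : Bool) : ℝ := if b then 1 else 0

/-- SUTVA: the observed outcome is `Y = T Y(1) + (1 - T) Y(0)`. -/
def observe (u : PotentialUnit 𝓩) : ObservedUnit 𝓩 :=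
  (u.1, trt u, ind (trt u) * y1 u + (1 - ind (trt u)) * y0 u)

/-- The σ-algebra generated by the covariates, on units with potential outcomes. -/
abbrev covAlg (𝓩 : Type*) [MeasurableSpace 𝓩] : MeasurableSpace (PotentialUnit 𝓩) :=
  MeasurableSpace.comap Prod.fst inferInstance

/-- `r` is a version of the regression function `z ↦ E[f | Z = z]`. -/
def IsRegression (P : Measure (PotentialUnit 𝓩)) (f : PotentialUnit 𝓩 → ℝ) (r : 𝓩 → ℝ) : Prop :=
  Measurable r ∧ Integrable f P ∧ (fun u => r u.1) =ᵐ[P] P[f | covAlg 𝓩]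

/-- Treatment assignment is independent of the potential outcomes given the covariates. -/
def Unconfounded [StandardBorelSpace 𝓩] (P : Measure (PotentialUnit 𝓩)) [IsFiniteMeasure P] :
    Prop :=
  CondIndepFun (covAlg 𝓩) measurable_fst.comap_le trt (fun u => (y0 u, y1 u)) P

/-- The marginal probability of treatment. -/
def treatProb (P : Measure (PotentialUnit 𝓩)) : ℝ := P.real {u | trt u = true}

/-- The estimand `θ₀ = E[Y(0) | T = 1]`. -/
def estimand (P : Measure (PotentialUnit 𝓩)) : ℝ := ∫ u, y0 u ∂(P[|{u | trt u = true}])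

/-- The weight function `w*(z) = e(z) / (1 - e(z)) * P(T = 0) / P(T = 1)`. -/
def oddsWeight (P : Measure (PotentialUnit 𝓩)) (e : 𝓩 → ℝ) (z : 𝓩) : ℝ :=
  e z / (1 - e z) * ((1 - treatProb P) / treatProb P)

/-- The law of the covariates. -/
def covLaw (P : Measure (PotentialUnit 𝓩)) : Measure 𝓩 := P.map Prod.fst

/-- The law of the covariates given `T = 0`. -/
def controlLaw (P : Measure (PotentialUnit 𝓩)) : Measure 𝓩 :=
  (P[|{u | trt u = false}]).map Prod.fst

/-- The (centred) influence function
`(1 - T) w*(Z) (Y(0) - m₀(Z)) / (1 - p) + T (m₀(Z) - θ₀) / p`. -/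
def influence (P : Measure (PotentialUnit 𝓩)) (e m₀ : 𝓩 → ℝ) (u : PotentialUnit 𝓩) : ℝ :=
  (1 - ind (trt u)) * oddsWeight P e u.1 * (y0 u - m₀ u.1) / (1 - treatProb P)
    + ind (trt u) * (m₀ u.1 - estimand P) / treatProb P

/-- The asymptotic variance `σ₀²`. -/
def asympVar (P : Measure (PotentialUnit 𝓩)) (e m₀ : 𝓩 → ℝ) : ℝ :=
  variance (influence P e m₀) P

/-! ### Linear approximation by selected features -/

/-- `ηᵀ x_S` for `η ∈ ℝ^S`. -/
def linComb {p : ℕ} (x : Fin p → ℝ) (S : Finset (Fin p)) (η : S → ℝ) : ℝ := ∑ j, η j * x j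

/-- The `L₁` norm of a coefficient vector. -/
def l1norm {p : ℕ} {S : Finset (Fin p)} (η : S → ℝ) : ℝ := ∑ j, |η j|

/-- The approximation error `ε(S; f)`: the `L₂` distance, under the law `ν`, of `f` to the linear
span of the features in `S` (infinite if `f` is not square-integrable modulo that span). -/
def approxError (ν : Measure 𝓩) {p : ℕ} (φ : 𝓩 → Fin p → ℝ) (S : Finset (Fin p)) (f : 𝓩 → ℝ) :
    ℝ≥0∞ :=
  ⨅ η : S → ℝ, eLpNorm (fun z => f z - linComb (φ z) S η) 2 ν

/-- `η` attains the infimum in `ε(S; f)`, i.e. `η = η(S; f)`. -/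
def IsBestCoef (ν : Measure 𝓩) {p : ℕ} (φ : 𝓩 → Fin p → ℝ) (S : Finset (Fin p)) (f : 𝓩 → ℝ)
    (η : S → ℝ) : Prop :=
  eLpNorm (fun z => f z - linComb (φ z) S η) 2 ν = approxError ν φ S f

/-! ### Sample splitting, selection and balancing weights

A sample of size `n` is `d : Fin n → ObservedUnit 𝓩`; a split is a labelling `g : Fin n → Fin 2`;
`𝓤` is a space of random seeds. -/

/-- Split of each treatment arm into two folds of equal size (sizes differ by at most one), using
only the treatment indicators and a random seed. -/
structure SplitRule (𝓤 : Type*) [MeasurableSpace 𝓤] (n : ℕ) where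
  fold : 𝓤 → (Fin n → Bool) → Fin n → Fin 2
  measurable_fold : ∀ t, Measurable fun u => fold u t
  balanced : ∀ u t (b : Bool),
    (Finset.univ.filter fun i => t i = b ∧ fold u t i = 0).card ≤
        (Finset.univ.filter fun i => t i = b ∧ fold u t i = 1).card + 1 ∧
      (Finset.univ.filter fun i => t i = b ∧ fold u t i = 1).card ≤
        (Finset.univ.filter fun i => t i = b ∧ fold u t i = 0).card + 1

/-- A black-box rule that produces the selected features and the tolerance used in fold `k`; it may
look only at the split, at a random seed, and at the data of the other fold. -/
structure SelectionRule (𝓩 𝓤 : Type*) [MeasurableSpace 𝓩] [MeasurableSpace 𝓤] (n p : ℕ)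
    (k : Fin 2) where
  select : 𝓤 → (Fin n → Fin 2) → (Fin n → ObservedUnit 𝓩) → Finset (Fin p)
  tol : 𝓤 → (Fin n → Fin 2) → (Fin n → ObservedUnit 𝓩) → ℝ
  tol_nonneg : ∀ u g d, 0 ≤ tol u g d
  measurable_select : ∀ g S,
    MeasurableSet {x : 𝓤 × (Fin n → ObservedUnit 𝓩) | select x.1 g x.2 = S}
  measurable_tol : ∀ g, Measurable fun x : 𝓤 × (Fin n → ObservedUnit 𝓩) => tol x.1 g x.2
  select_otherFold : ∀ u g d d', (∀ i, g i ≠ k → d i = d' i) → select u g d = select u g d'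
  tol_otherFold : ∀ u g d d', (∀ i, g i ≠ k → d i = d' i) → tol u g d = tol u g d'

/-- Everything the analyst chooses at sample size `n`. -/
structure Procedure (𝓩 𝓤 : Type*) [MeasurableSpace 𝓩] [MeasurableSpace 𝓤] (n p : ℕ) where
  split : SplitRule 𝓤 n
  rule : ∀ k : Fin 2, SelectionRule 𝓩 𝓤 n p k

namespace Procedure

variable {n p : ℕ}

/-- The fold labels. -/
def labels (A : Procedure 𝓩 𝓤 n p) (u : 𝓤) (d : Fin n → ObservedUnit 𝓩) : Fin n → Fin 2 :=
  A.split.fold u fun i => (d i).2.1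

/-- The selected set `Ŝ⁽ᵏ⁾`, used in fold `k`. -/
def selected (A : Procedure 𝓩 𝓤 n p) (k : Fin 2) (u : 𝓤) (d : Fin n → ObservedUnit 𝓩) :
    Finset (Fin p) :=
  (A.rule k).select u (A.labels u d) d

/-- The tolerance used in fold `k`. -/
def tolerance (A : Procedure 𝓩 𝓤 n p) (k : Fin 2) (u : 𝓤) (d : Fin n → ObservedUnit 𝓩) : ℝ :=
  (A.rule k).tol u (A.labels u d) d

end Procedure

/-- Index set of the units of fold `k` with treatment indicator `b`. -/
def foldArm {n : ℕ} (g : Fin n → Fin 2) (d : Fin n → ObservedUnit 𝓩) (b : Bool) (k : Fin 2) :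
    Finset (Fin n) :=
  Finset.univ.filter fun i => (d i).2.1 = b ∧ g i = k

/-- Index set of all control units. -/
def controls {n : ℕ} (d : Fin n → ObservedUnit 𝓩) : Finset (Fin n) :=
  Finset.univ.filter fun i => (d i).2.1 = false

/-- Constraints of the balancing program on fold `k`, for features `S` and tolerance `δ`: the
weighted mean in the control fold is within `δ` of the mean in the treated fold for each feature,
and the weights average to one. Only the entries of `w` in the control fold matter. -/
def Feasible {n p : ℕ} (φ : 𝓩 → Fin p → ℝ) (d : Fin n → ObservedUnit 𝓩) (g : Fin n → Fin 2)
    (k : Fin 2) (S : Finset (Fin p)) (δ : ℝ) (w : Fin n → ℝ) : Prop :=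
  (∀ j ∈ S,
    |(1 / ((foldArm g d false k).card : ℝ)) * ∑ i ∈ foldArm g d false k, w i * φ (d i).1 j
      - (1 / ((foldArm g d true k).card : ℝ)) * ∑ i ∈ foldArm g d true k, φ (d i).1 j| ≤ δ) ∧
  (1 / ((foldArm g d false k).card : ℝ)) * ∑ i ∈ foldArm g d false k, w i = 1

/-- `w` solves the balancing program on fold `k`. -/
def IsSolution {n p : ℕ} (φ : 𝓩 → Fin p → ℝ) (d : Fin n → ObservedUnit 𝓩) (g : Fin n → Fin 2)
    (k : Fin 2) (S : Finset (Fin p)) (δ : ℝ) (w : Fin n → ℝ) : Prop :=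
  Feasible φ d g k S δ w ∧
    ∀ w', Feasible φ d g k S δ w' →
      ∑ i ∈ foldArm g d false k, w i ^ 2 ≤ ∑ i ∈ foldArm g d false k, w' i ^ 2

/-- `θ` is a value of the cross-balancing estimator: `|I_c|⁻¹ ∑_{i ∈ I_c} ŵ_i Y_i`, where `ŵ` solves
the balancing program on each fold. On a fold where the program has no feasible point the weights
are arbitrary. -/
def IsCrossBalancing {n p : ℕ} (φ : 𝓩 → Fin p → ℝ) (A : Procedure 𝓩 𝓤 n p) (u : 𝓤)
    (d : Fin n → ObservedUnit 𝓩) (θ : ℝ) : Prop :=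
  ∃ w : Fin n → ℝ,
    (∀ k, (∃ w', Feasible φ d (A.labels u d) k (A.selected k u d) (A.tolerance k u d) w') →
      IsSolution φ d (A.labels u d) k (A.selected k u d) (A.tolerance k u d) w) ∧
    θ = (1 / ((controls d).card : ℝ)) * ∑ i ∈ controls d, w i * (d i).2.2

/-- `n⁻¹ ‖X_{c,S} v‖₂² ≥ ξ ‖v‖₁²` for all `v ∈ ℝ^S`, where the rows of `X_{c,S}` are the selected
features of the control units of fold `k` and `n` is the total sample size. -/
def EigenCondition {n p : ℕ} (φ : 𝓩 → Fin p → ℝ) (d : Fin n → ObservedUnit 𝓩) (g : Fin n → Fin 2)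
    (k : Fin 2) (S : Finset (Fin p)) (ξ : ℝ) : Prop :=
  ∀ v : S → ℝ,
    ξ * l1norm v ^ 2 ≤ (1 / (n : ℝ)) * ∑ i ∈ foldArm g d false k, linComb (φ (d i).1) S v ^ 2

/-- The observed sample of the first `n` units. -/
def sample (D : ℕ → Ω → PotentialUnit 𝓩) (n : ℕ) (ω : Ω) : Fin n → ObservedUnit 𝓩 :=
  fun i => observe (D i ω)

/-- `X_n = o_P(r_n)` for nonnegative (possibly infinite) `X_n`. -/
def IsLittleOP (μ : Measure Ω) (X : ℕ → Ω → ℝ≥0∞) (r : ℕ → ℝ) : Prop :=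
  ∀ c : ℝ, 0 < c → Tendsto (fun n => μ {ω | ENNReal.ofReal (c * r n) < X n ω}) atTop (𝓝 0)

/-! ### Semiparametric efficiency bound -/

/-- A bounded score at the law `Q`: bounded, measurable and of mean zero. -/
def IsBoundedScore {𝓞 : Type*} [MeasurableSpace 𝓞] (Q : Measure 𝓞) (s : 𝓞 → ℝ) : Prop :=
  Measurable s ∧ (∃ C : ℝ, ∀ o, |s o| ≤ C) ∧ ∫ o, s o ∂Q = 0

/-- The one-dimensional regular submodel `dQ_t = (1 + t s) dQ` through `Q` with score `s`
(a probability measure for small `|t|`). -/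
def submodel {𝓞 : Type*} [MeasurableSpace 𝓞] (Q : Measure 𝓞) (s : 𝓞 → ℝ) (t : ℝ) : Measure 𝓞 :=
  Q.withDensity fun o => ENNReal.ofReal (1 + t * s o)

/-- `V` is the semiparametric efficiency bound at `Q` for the parameter `θ` in the nonparametric
model: `θ` is differentiable along all submodels with a bounded score (these scores are dense in the
mean-zero functions of `L₂(Q)`), and `V` is the supremum of the Cramér–Rao bounds of these
submodels. -/
def IsEfficiencyBound {𝓞 : Type*} [MeasurableSpace 𝓞] (Q : Measure 𝓞) (θ : Measure 𝓞 → ℝ)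
    (V : ℝ) : Prop :=
  (∀ s, IsBoundedScore Q s → DifferentiableAt ℝ (fun t => θ (submodel Q s t)) 0) ∧
  IsLUB {b : ℝ | ∃ s, IsBoundedScore Q s ∧ 0 < ∫ o, s o ^ 2 ∂Q ∧
    b = deriv (fun t => θ (submodel Q s t)) 0 ^ 2 / ∫ o, s o ^ 2 ∂Q} V

/-- The parameter as a functional of the law `Q` of the observed data `(Z, T, Y)`:
`E_Q[ E_Q[Y | Z, T = 0] | T = 1 ]`. -/
def observedParam (Q : Measure (ObservedUnit 𝓩)) : ℝ :=
  ∫ o, ((Q[|{o : ObservedUnit 𝓩 | o.2.1 = false}])[fun o : ObservedUnit 𝓩 => o.2.2 |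
      MeasurableSpace.comap (Prod.fst : ObservedUnit 𝓩 → 𝓩) inferInstance]) o
    ∂(Q[|{o : ObservedUnit 𝓩 | o.2.1 = true}])

end CrossBalancing

end

open CrossBalancing

noncomputable section

set_option linter.unusedSectionVars false

namespace CrossBalancing

/-! ### The law of a unit on each treatment arm. -/

section Population

variable {𝓩 : Type*} [MeasurableSpace 𝓩]

/-! Fix one fold. Let r = m₀ − ηᵀX be the residual of the best approximation of m₀ by the selected
features, w̃ the best linear approximation of w*, and ŵ the balancing weights. From the fold
estimate subtract θ₀ and the linear term, which is the control average of w*(Y − m₀) plus the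
treated average of m₀ − θ₀. What remains splits algebraically into four pieces
(`Admissible.abs_fold_error_le`): the imbalance of ηᵀX, at most ‖η‖₁ δ; the w*-weighted control
average of r minus its treated average; the noise, a control average of (ŵ − w*)(Y − m₀); and a
control average of (ŵ − w*) r.

The second piece is centred, because unconfoundedness makes w* the density of the treated law of (Z,
Y(0)) relative to the control law (`IsPopulation.restrict_map`,
`IsPopulation.integral_oddsWeight_mul`). Its standard deviation is of order ε(m₀)/√n.

The last two pieces depend on how far ŵ is from w*. The distance from w* to w̃ is ε(w*) in mean
square, so it remains to compare ŵ with w̃. As the intercept is in the span of the balanced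
features, weights of minimal norm are linear in these features (`MinimallyBalances.exists_linComb`),
so ŵ − w̃ = vᵀX. The weights ŵ balance each feature up to δ. The weights w̃ balance it exactly in
the population, by their normal equations (`Admissible.integral_wt_mul`), hence in the sample up to
a multiple of √(log|S|/n), by a sub-Gaussian maximal inequality. Pairing with v costs ‖v‖₁, which
the eigenvalue condition controls by the quadratic form itself, and Σ(ŵ − w̃)² is at most a constant
times log|S|/ξ (`MinimallyBalances.sum_sq_sub_le`, `FoldRegular.sum_sq_sub_wt_le`). By
Cauchy–Schwarz, √n times the fourth piece is of order ε(m₀)√(log|S|/ξ) + √n ε(w*) ε(m₀), which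
vanishes by hypothesis.

For the noise, ŵ on fold k depends on that fold only through covariates, the split and the treatment
indicators, since features and tolerance come from the other fold. The residuals Y(0) − m₀ are
therefore orthogonal given the weights, and the second moment of the noise sum is at most M₁ times
Σ(ŵ − w*)², which is o(n) (`IsPopulation.integral_sq_sum_resid_le`,
`IsPopulation.measure_noise_le`).

All probability bounds are proved for fixed seed and fixed treatment indicators. The units are then
independent with the arm laws, the split is deterministic, and events about fold k are independent
of the selection (`measure_fold_event_le`). The two folds have sizes differing by at most one, so
their linear terms combine into the average of the influence function up to o_P(n^{-1/2})
(`abs_combine_folds_le`, `IsPopulation.vanishing_remainder`). The central limit theorem and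
Slutsky's lemma finish the normality claim.

For efficiency, Bayes' formula gives the regression of Y on Z among controls under the tilted law 1
+ ts as (m₀ + ta)/(1 + tb), with a and b the control regressions of sY and s. Differentiating its
treated mean shows that the pathwise derivative is E[sψ], with ψ the influence function
(`IsPopulation.hasDerivAt_observedParam`). Cauchy–Schwarz bounds each Cramér–Rao quotient by E ψ²,
and centred truncations of ψ approach that value (`isEfficiencyBound_of_hasDerivAt`). -/

@[fun_prop]
lemma measurable_trt : Measurable (trt : PotentialUnit 𝓩 → Bool) := by
  unfold trt; fun_prop

@[fun_prop]
lemma measurable_y0 : Measurable (y0 : PotentialUnit 𝓩 → ℝ) := by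
  unfold y0; fun_prop

@[fun_prop]
lemma measurable_y1 : Measurable (y1 : PotentialUnit 𝓩 → ℝ) := by
  unfold y1; fun_prop

@[fun_prop]
lemma measurable_ind : Measurable ind := measurable_from_top

@[fun_prop]
lemma measurable_observe : Measurable (observe : PotentialUnit 𝓩 → ObservedUnit 𝓩) := by
  unfold observe; fun_prop

lemma measurableSet_trt (b : Bool) : MeasurableSet {u : PotentialUnit 𝓩 | trt u = b} :=
  measurable_trt (measurableSet_singleton b)

/-- The probability of arm `b` when the probability of treatment is `x`. -/
def armProb (b : Bool) (x : ℝ) : ℝ := if b then x else 1 - x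

@[fun_prop]
lemma measurable_armProb (b : Bool) : Measurable (armProb b) := by
  unfold armProb; cases b <;> simp <;> fun_prop

lemma armProb_pos {x : ℝ} (h : 0 < x ∧ x < 1) (b : Bool) : 0 < armProb b x := by
  unfold armProb; cases b <;> simp <;> linarith [h.1, h.2]

lemma armProb_le_one {x : ℝ} (h : 0 < x ∧ x < 1) (b : Bool) : armProb b x ≤ 1 := by
  unfold armProb; cases b <;> simp <;> linarith [h.1, h.2]

/-- The law of a unit given that its treatment indicator is `b`. -/
def armLaw (P : Measure (PotentialUnit 𝓩)) (b : Bool) : Measure (PotentialUnit 𝓩) :=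
  P[|{u | trt u = b}]

lemma armLaw_absolutelyContinuous (P : Measure (PotentialUnit 𝓩)) (b : Bool) : armLaw P b ≪ P :=
  cond_absolutelyContinuous

lemma map_armLaw_false (P : Measure (PotentialUnit 𝓩)) :
    (armLaw P false).map Prod.fst = controlLaw P := rfl

/-- The pull-out property in integrated form. It is how functions of the covariates meet conditional
expectations everywhere below; boundedness of `g` keeps the product integrable. -/
lemma setIntegral_covAlg_condExp_mul (P : Measure (PotentialUnit 𝓩)) [IsProbabilityMeasure P]
    {g : 𝓩 → ℝ} (hg : Measurable g) {C : ℝ} (hC : ∀ z, |g z| ≤ C) {f : PotentialUnit 𝓩 → ℝ}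
    (hf : Integrable f P) {A : Set 𝓩} (hA : MeasurableSet A) :
    ∫ u in Prod.fst ⁻¹' A, g u.1 * (P[f | covAlg 𝓩]) u ∂P = ∫ u in Prod.fst ⁻¹' A, g u.1 * f u ∂P := by
  have hm : covAlg 𝓩 ≤ (inferInstance : MeasurableSpace (PotentialUnit 𝓩)) :=
    measurable_fst.comap_le
  have hg' : StronglyMeasurable[covAlg 𝓩] (fun u : PotentialUnit 𝓩 => g u.1) :=
    (hg.comp (comap_measurable Prod.fst)).stronglyMeasurable
  have hint : Integrable (fun u : PotentialUnit 𝓩 => g u.1 * f u) P :=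
    hf.bdd_mul (c := C) (hg.comp measurable_fst).aestronglyMeasurable
      (ae_of_all _ fun u => by simpa using hC u.1)
  have h := condExp_mul_of_stronglyMeasurable_left (μ := P) hg' hint hf
  have h2 := setIntegral_condExp (μ := P) hm hint (s := Prod.fst ⁻¹' A) ⟨A, hA, rfl⟩
  rw [← h2]
  refine integral_congr_ae (ae_restrict_of_ae ?_)
  filter_upwards [h] with u hu
  exact hu.symm

end Population

/-- The population assumptions: unconfoundedness, overlap, and versions of the propensity and
prognostic scores. -/
structure IsPopulation {𝓩 : Type*} [MeasurableSpace 𝓩] [StandardBorelSpace 𝓩]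
    (P : Measure (PotentialUnit 𝓩)) [IsProbabilityMeasure P] (e m₀ : 𝓩 → ℝ) : Prop where
  unconf : Unconfounded P
  reg_e : IsRegression P (fun u => ind (trt u)) e
  overlap : ∀ z, 0 < e z ∧ e z < 1
  reg_m : IsRegression P y0 m₀

namespace IsPopulation

variable {𝓩 : Type*} [MeasurableSpace 𝓩] [StandardBorelSpace 𝓩]
  {P : Measure (PotentialUnit 𝓩)} [IsProbabilityMeasure P] {e m₀ : 𝓩 → ℝ}

@[fun_prop]
lemma measurable_e (h : IsPopulation P e m₀) : Measurable e := h.reg_e.1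

lemma measurable_m (h : IsPopulation P e m₀) : Measurable m₀ := h.reg_m.1

lemma integrable_y0 (h : IsPopulation P e m₀) : Integrable y0 P := h.reg_m.2.1

lemma condExp_arm (h : IsPopulation P e m₀) (b : Bool) :
    P⟦trt ⁻¹' {b} | covAlg 𝓩⟧ =ᵐ[P] fun u => armProb b (e u.1) := by
  have hm : covAlg 𝓩 ≤ (inferInstance : MeasurableSpace (PotentialUnit 𝓩)) :=
    measurable_fst.comap_le
  have he := h.reg_e.2.2
  cases b
  · have : (trt ⁻¹' {false}).indicator (fun _ : PotentialUnit 𝓩 => (1 : ℝ)) =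
        (fun _ => (1 : ℝ)) - fun u => ind (trt u) := by
      ext u; by_cases hu : trt u <;> simp [hu, ind]
    rw [this]
    refine (condExp_sub (integrable_const 1) h.reg_e.2.1 _).trans ?_
    rw [condExp_const hm]
    filter_upwards [he] with u hu
    simp [armProb, ← hu]
  · have : (trt ⁻¹' {true}).indicator (fun _ : PotentialUnit 𝓩 => (1 : ℝ)) =
        fun u => ind (trt u) := by
      ext u; by_cases hu : trt u <;> simp [hu, ind]
    rw [this]
    filter_upwards [he] with u hu
    simp [armProb, ← hu]

/-- Given the covariates, the treatment arm carries no information about `Y(0)`: the joint law of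
`(Z, Y(0))` on arm `b` has the propensity of the arm as its density. -/
lemma restrict_map (h : IsPopulation P e m₀) (b : Bool) :
    (P.restrict {u | trt u = b}).map (fun u => (u.1, y0 u)) =
      (P.map (fun u => (u.1, y0 u))).withDensity (fun x => ENNReal.ofReal (armProb b (e x.1))) := by
  have hm : covAlg 𝓩 ≤ (inferInstance : MeasurableSpace (PotentialUnit 𝓩)) :=
    measurable_fst.comap_le
  have hmeas : Measurable (fun u : PotentialUnit 𝓩 => (u.1, y0 u)) := by fun_prop
  have he := h.measurable_e
  -- Rectangles A × B determine the law. On a rectangle the claim is conditional independence of T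
  -- and Y(0) integrated over {Z ∈ A}, with the propensity pulled inside the conditional expectation
  -- (`key` below).
  refine Measure.ext_prod fun {A B} hA hB => ?_
  have hprob : ∀ z, 0 ≤ armProb b (e z) ∧ armProb b (e z) ≤ 1 := fun z =>
    ⟨(armProb_pos (h.overlap z) b).le, armProb_le_one (h.overlap z) b⟩
  rw [Measure.map_apply hmeas (hA.prod hB),
    Measure.restrict_apply (hmeas (hA.prod hB)), withDensity_apply _ (hA.prod hB),
    setLIntegral_map (hA.prod hB) (by fun_prop) hmeas]
  have hpre : (fun u : PotentialUnit 𝓩 => (u.1, y0 u)) ⁻¹' A ×ˢ B =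
    Prod.fst ⁻¹' A ∩ y0 ⁻¹' B := rfl
  have hB' : MeasurableSet (y0 ⁻¹' B : Set (PotentialUnit 𝓩)) := measurable_y0 hB
  have hT' : MeasurableSet (trt ⁻¹' {b} : Set (PotentialUnit 𝓩)) := measurableSet_trt b
  have hA' : MeasurableSet (Prod.fst ⁻¹' A : Set (PotentialUnit 𝓩)) := measurable_fst hA
  have hci := (condIndepFun_iff_condExp_inter_preimage_eq_mul measurable_trt
    (by fun_prop : Measurable (fun u : PotentialUnit 𝓩 => (y0 u, y1 u)))).1 h.unconf
    {b} (B ×ˢ Set.univ) (measurableSet_singleton b) (hB.prod .univ)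
  have hpre2 : (fun u : PotentialUnit 𝓩 => (y0 u, y1 u)) ⁻¹' B ×ˢ Set.univ = y0 ⁻¹' B := by
    ext; simp
  rw [hpre2] at hci
  have key : P.real ((trt ⁻¹' {b} ∩ y0 ⁻¹' B) ∩ Prod.fst ⁻¹' A) =
      ∫ u in Prod.fst ⁻¹' A ∩ y0 ⁻¹' B, armProb b (e u.1) ∂P := by
    calc P.real ((trt ⁻¹' {b} ∩ y0 ⁻¹' B) ∩ Prod.fst ⁻¹' A)
        = ∫ u in Prod.fst ⁻¹' A, (trt ⁻¹' {b} ∩ y0 ⁻¹' B).indicator (fun _ => (1 : ℝ)) u ∂P := by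
          rw [integral_indicator (hT'.inter hB'), Measure.restrict_restrict (hT'.inter hB')]
          simp
      _ = ∫ u in Prod.fst ⁻¹' A, (P⟦trt ⁻¹' {b} ∩ y0 ⁻¹' B | covAlg 𝓩⟧) u ∂P :=
          (setIntegral_condExp hm ((integrable_const 1).indicator (hT'.inter hB'))
            ⟨A, hA, rfl⟩).symm
      _ = ∫ u in Prod.fst ⁻¹' A, armProb b (e u.1) * (P⟦y0 ⁻¹' B | covAlg 𝓩⟧) u ∂P := by
          refine integral_congr_ae (ae_restrict_of_ae ?_)
          filter_upwards [hci, h.condExp_arm b] with u h1 h2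
          rw [h1, h2]
      _ = ∫ u in Prod.fst ⁻¹' A,
            armProb b (e u.1) * (y0 ⁻¹' B).indicator (fun _ => (1 : ℝ)) u ∂P :=
          setIntegral_covAlg_condExp_mul P (g := fun z => armProb b (e z)) (by fun_prop) (C := 1)
            (fun z => abs_le.2 ⟨by linarith [(hprob z).1], (hprob z).2⟩)
            ((integrable_const 1).indicator hB') hA
      _ = ∫ u in Prod.fst ⁻¹' A ∩ y0 ⁻¹' B, armProb b (e u.1) ∂P := by
          rw [Set.inter_comm, ← Measure.restrict_restrict hB', ← integral_indicator hB']
          congr 1; ext u; by_cases hu : u ∈ y0 ⁻¹' B <;> simp [hu]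
  rw [hpre, ← ofReal_integral_eq_lintegral_ofReal]
  · rw [← key, ofReal_measureReal]
    congr 1; ext u; simp; tauto
  · refine Integrable.of_bound (Measurable.aestronglyMeasurable (by fun_prop)) 1
      (ae_of_all _ fun u => ?_)
    rw [Real.norm_eq_abs]
    exact abs_le.2 ⟨by linarith [(hprob u.1).1], (hprob u.1).2⟩
  · exact ae_of_all _ fun u => (hprob u.1).1

lemma measure_trt (_h : IsPopulation P e m₀) (b : Bool) :
    P {u | trt u = b} = ENNReal.ofReal (armProb b (treatProb P)) := by
  have ht : P {u | trt u = true} = ENNReal.ofReal (treatProb P) := by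
    simp [treatProb, ofReal_measureReal]
  cases b
  · have : {u : PotentialUnit 𝓩 | trt u = false} = {u | trt u = true}ᶜ := by ext; simp
    rw [this, prob_compl_eq_one_sub (measurableSet_trt true), ht]
    simp [armProb, ENNReal.ofReal_sub, treatProb]
  · simpa [armProb] using ht

lemma setLIntegral_trt (h : IsPopulation P e m₀) (b : Bool) {F : 𝓩 × ℝ → ℝ≥0∞}
    (hF : Measurable F) : ∫⁻ u in {u | trt u = b}, F (u.1, y0 u) ∂P =
      ∫⁻ u, ENNReal.ofReal (armProb b (e u.1)) * F (u.1, y0 u) ∂P := by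
  have hmeas : Measurable (fun u : PotentialUnit 𝓩 => (u.1, y0 u)) := by fun_prop
  have he := h.measurable_e
  rw [← lintegral_map hF hmeas, h.restrict_map b,
    lintegral_withDensity_eq_lintegral_mul _ (by fun_prop) hF, lintegral_map (by fun_prop) hmeas]
  rfl

/-- Overlap holds at every point: if an arm were null, the integral of its strictly positive
propensity would vanish, which is impossible under a probability measure. -/
lemma measure_trt_ne_zero (h : IsPopulation P e m₀) (b : Bool) : P {u | trt u = b} ≠ 0 := by
  intro h0
  have h1 := h.setLIntegral_trt b (F := fun _ => 1) measurable_const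
  have he := h.measurable_e
  rw [Measure.restrict_eq_zero.2 h0] at h1
  simp only [lintegral_zero_measure, mul_one] at h1
  have h2 := (lintegral_eq_zero_iff (by fun_prop)).1 h1.symm
  have h3 : ∀ᵐ u ∂P, False := by
    filter_upwards [h2] with u hu
    have := armProb_pos (h.overlap u.1) b
    simp only [Pi.zero_apply, ENNReal.ofReal_eq_zero] at hu
    linarith
  exact (NeZero.ne P) (by simpa using h3)

lemma isProbabilityMeasure_armLaw (h : IsPopulation P e m₀) (b : Bool) :
    IsProbabilityMeasure (armLaw P b) :=
  cond_isProbabilityMeasure (h.measure_trt_ne_zero b)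

lemma treatProb_mem (h : IsPopulation P e m₀) : 0 < treatProb P ∧ treatProb P < 1 := by
  have h1 := h.measure_trt_ne_zero true
  have h2 := h.measure_trt_ne_zero false
  rw [h.measure_trt] at h1 h2
  simp [armProb] at h1 h2
  exact ⟨h1, h2⟩

lemma armLaw_eq (h : IsPopulation P e m₀) (b : Bool) : armLaw P b =
    ENNReal.ofReal (armProb b (treatProb P))⁻¹ • P.restrict {u | trt u = b} := by
  rw [armLaw, ProbabilityTheory.cond, h.measure_trt,
    ENNReal.ofReal_inv_of_pos (armProb_pos h.treatProb_mem b)]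

/-- The integrand may involve Z and Y(0) but neither T nor Y(1). This is the class on which an arm
law is the population law reweighted by a propensity. -/
lemma integral_armLaw (h : IsPopulation P e m₀) (b : Bool) {F : 𝓩 × ℝ → ℝ} (hF : Measurable F) :
    ∫ u, F (u.1, y0 u) ∂(armLaw P b) =
      (armProb b (treatProb P))⁻¹ * ∫ u, armProb b (e u.1) * F (u.1, y0 u) ∂P := by
  have hmeas : Measurable (fun u : PotentialUnit 𝓩 => (u.1, y0 u)) := by fun_prop
  have he := h.measurable_e
  have hpos := armProb_pos h.treatProb_mem b
  rw [h.armLaw_eq, integral_smul_measure, ENNReal.toReal_ofReal (by positivity), smul_eq_mul,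
    ← integral_map hmeas.aemeasurable hF.aestronglyMeasurable, h.restrict_map b,
    integral_withDensity_eq_integral_toReal_smul (by fun_prop) (by simp),
    integral_map hmeas.aemeasurable (by fun_prop)]
  congr 2; ext u
  simp [ENNReal.toReal_ofReal (armProb_pos (h.overlap u.1) b).le]

lemma lintegral_armLaw (h : IsPopulation P e m₀) (b : Bool) {F : 𝓩 × ℝ → ℝ≥0∞}
    (hF : Measurable F) :
    ∫⁻ u, F (u.1, y0 u) ∂(armLaw P b) = ENNReal.ofReal (armProb b (treatProb P))⁻¹ *
      ∫⁻ u, ENNReal.ofReal (armProb b (e u.1)) * F (u.1, y0 u) ∂P := by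
  rw [h.armLaw_eq, lintegral_smul_measure, h.setLIntegral_trt b hF, smul_eq_mul]

lemma armLaw_le (h : IsPopulation P e m₀) (b : Bool) :
    armLaw P b ≤ ENNReal.ofReal (armProb b (treatProb P))⁻¹ • P := by
  rw [h.armLaw_eq]
  gcongr
  exact Measure.restrict_le_self

lemma integrable_armLaw (h : IsPopulation P e m₀) (b : Bool) {f : PotentialUnit 𝓩 → ℝ}
    (hf : Integrable f P) : Integrable f (armLaw P b) :=
  (hf.smul_measure (by simp)).mono_measure (h.armLaw_le b)

lemma memLp_armLaw (h : IsPopulation P e m₀) (b : Bool) {f : PotentialUnit 𝓩 → ℝ}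
    (hf : MemLp f 2 P) : MemLp f 2 (armLaw P b) :=
  hf.of_measure_le_smul (by simp) (h.armLaw_le b)

lemma measurable_oddsWeight (h : IsPopulation P e m₀) : Measurable (oddsWeight P e) := by
  have he := h.measurable_e
  unfold oddsWeight; fun_prop

lemma oddsWeight_pos (h : IsPopulation P e m₀) (z : 𝓩) : 0 < oddsWeight P e z := by
  have h1 := h.overlap z
  have h2 := h.treatProb_mem
  unfold oddsWeight
  have : 0 < 1 - e z := by linarith
  have : 0 < 1 - treatProb P := by linarith
  have := h1.1; have := h2.1
  positivity

/-- Bayes' rule at a point: w* is the ratio of the treated density to the control density. The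
normalisation (1 − p)/p in w* is there for this identity. -/
lemma armProb_mul_oddsWeight (h : IsPopulation P e m₀) (z : 𝓩) :
    (armProb false (treatProb P))⁻¹ * (armProb false (e z) * oddsWeight P e z) =
      (armProb true (treatProb P))⁻¹ * armProb true (e z) := by
  have h1 := h.overlap z
  have h2 := h.treatProb_mem
  have : 1 - e z ≠ 0 := by linarith
  have : 1 - treatProb P ≠ 0 := by linarith
  have := h2.1.ne'
  simp only [armProb, oddsWeight, Bool.false_eq_true, if_false, if_true]
  field_simp

/-- The odds weights carry the control arm to the treated arm. -/
lemma integral_oddsWeight_mul (h : IsPopulation P e m₀) {F : 𝓩 × ℝ → ℝ} (hF : Measurable F) :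
    ∫ u, oddsWeight P e u.1 * F (u.1, y0 u) ∂(armLaw P false) =
      ∫ u, F (u.1, y0 u) ∂(armLaw P true) := by
  have := h.measurable_oddsWeight
  rw [h.integral_armLaw true hF,
    h.integral_armLaw false (F := fun x => oddsWeight P e x.1 * F x) (by fun_prop),
    ← integral_const_mul, ← integral_const_mul]
  congr 1; ext u
  rw [← mul_assoc (armProb true _)⁻¹, ← h.armProb_mul_oddsWeight]; ring

lemma lintegral_oddsWeight_mul (h : IsPopulation P e m₀) {F : 𝓩 × ℝ → ℝ≥0∞} (hF : Measurable F) :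
    ∫⁻ u, ENNReal.ofReal (oddsWeight P e u.1) * F (u.1, y0 u) ∂(armLaw P false) =
      ∫⁻ u, F (u.1, y0 u) ∂(armLaw P true) := by
  have := h.measurable_oddsWeight
  have he := h.measurable_e
  rw [h.lintegral_armLaw true hF,
    h.lintegral_armLaw false (F := fun x => ENNReal.ofReal (oddsWeight P e x.1) * F x)
      (by fun_prop),
    ← lintegral_const_mul _ (by fun_prop), ← lintegral_const_mul _ (by fun_prop)]
  congr 1; ext u
  have h0 := fun b => (armProb_pos h.treatProb_mem b)
  have h1 := fun b => (armProb_pos (h.overlap u.1) b)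
  rw [← mul_assoc, ← mul_assoc, ← mul_assoc, ← ENNReal.ofReal_mul (by have := h0 false; positivity),
    ← ENNReal.ofReal_mul (by have := h0 false; have := h1 false; positivity),
    ← ENNReal.ofReal_mul (by have := h0 true; positivity), ← h.armProb_mul_oddsWeight, mul_assoc]

/-- The outcome residual is orthogonal to the functions of the covariates, on each arm. -/
lemma integral_armLaw_mul_resid (h : IsPopulation P e m₀) (b : Bool) {g : 𝓩 → ℝ}
    (hg : Measurable g) {C : ℝ} (hC : ∀ z, |g z| ≤ C) :
    ∫ u, g u.1 * (y0 u - m₀ u.1) ∂(armLaw P b) = 0 := by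
  have hm := h.measurable_m
  have he := h.measurable_e
  rw [h.integral_armLaw b (F := fun x => g x.1 * (x.2 - m₀ x.1)) (by fun_prop)]
  have hmint : Integrable (fun u : PotentialUnit 𝓩 => m₀ u.1) P :=
    integrable_condExp.congr h.reg_m.2.2.symm
  have hres : Integrable (fun u : PotentialUnit 𝓩 => y0 u - m₀ u.1) P :=
    h.integrable_y0.sub hmint
  have hb : ∀ z, |armProb b (e z) * g z| ≤ C := fun z => by
    rw [abs_mul, abs_of_pos (armProb_pos (h.overlap z) b)]
    calc _ ≤ 1 * |g z| := by
          gcongr; exact armProb_le_one (h.overlap z) b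
      _ ≤ C := by simpa using hC z
  have key := setIntegral_covAlg_condExp_mul P (g := fun z => armProb b (e z) * g z)
    (by fun_prop) hb hres (A := Set.univ) .univ
  simp only [Set.preimage_univ, Measure.restrict_univ] at key
  have hz : P[fun u : PotentialUnit 𝓩 => y0 u - m₀ u.1 | covAlg 𝓩] =ᵐ[P] 0 := by
    have h1 : P[fun u : PotentialUnit 𝓩 => m₀ u.1 | covAlg 𝓩] = fun u => m₀ u.1 :=
      condExp_of_stronglyMeasurable measurable_fst.comap_le
        (hm.comp (comap_measurable Prod.fst)).stronglyMeasurable hmint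
    refine (condExp_sub h.integrable_y0 hmint _).trans ?_
    rw [h1]
    filter_upwards [h.reg_m.2.2] with u hu
    simp [← hu]
  have : ∫ u, armProb b (e u.1) * (g u.1 * (y0 u - m₀ u.1)) ∂P = 0 := by
    simp_rw [← mul_assoc]
    rw [← key, integral_eq_zero_of_ae]
    filter_upwards [hz] with u hu
    simp [hu]
  simp [this]

/-- Restricting to an arm multiplies by a function of Z, which passes through the conditional
expectation, so the bound on the conditional variance survives on each arm with the same constant.
-/
lemma integral_armLaw_mul_sq_resid_le (h : IsPopulation P e m₀) (b : Bool) {M₁ : ℝ}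
    (hresid : Integrable (fun u => (y0 u - m₀ u.1) ^ 2) P)
    (hM₁ : ∀ᵐ u ∂P, (P[fun u => (y0 u - m₀ u.1) ^ 2 | covAlg 𝓩]) u ≤ M₁) {g : 𝓩 → ℝ}
    (hg : Measurable g) {C : ℝ} (hC : ∀ z, |g z| ≤ C) (hg0 : ∀ z, 0 ≤ g z) :
    ∫ u, g u.1 * (y0 u - m₀ u.1) ^ 2 ∂(armLaw P b) ≤ M₁ * ∫ u, g u.1 ∂(armLaw P b) := by
  have hm := h.measurable_m
  have he := h.measurable_e
  rw [h.integral_armLaw b (F := fun x => g x.1 * (x.2 - m₀ x.1) ^ 2) (by fun_prop),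
    h.integral_armLaw b (F := fun x => g x.1) (by fun_prop), mul_left_comm]
  have hb : ∀ z, |armProb b (e z) * g z| ≤ C := fun z => by
    rw [abs_mul, abs_of_pos (armProb_pos (h.overlap z) b)]
    calc _ ≤ 1 * |g z| := by
          gcongr; exact armProb_le_one (h.overlap z) b
      _ ≤ C := by simpa using hC z
  have key := setIntegral_covAlg_condExp_mul P (g := fun z => armProb b (e z) * g z)
    (by fun_prop) hb hresid (A := Set.univ) .univ
  simp only [Set.preimage_univ, Measure.restrict_univ] at key
  have hpos := armProb_pos h.treatProb_mem b
  gcongr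
  simp_rw [← mul_assoc]
  rw [← key, ← integral_const_mul]
  have hi : Integrable (fun u : PotentialUnit 𝓩 => armProb b (e u.1) * g u.1) P :=
    Integrable.of_bound (by fun_prop) C (ae_of_all _ fun u => by simpa using hb u.1)
  refine integral_mono_ae (integrable_condExp.bdd_mul (c := C) (by fun_prop)
    (ae_of_all _ fun u => by simpa using hb u.1)) (hi.const_mul M₁) ?_
  filter_upwards [hM₁] with u hu
  have h1 := (armProb_pos (h.overlap u.1) b).le
  have h2 := hg0 u.1
  rw [mul_comm M₁]
  gcongr

lemma integrable_m (h : IsPopulation P e m₀) : Integrable (fun u : PotentialUnit 𝓩 => m₀ u.1) P :=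
  integrable_condExp.congr h.reg_m.2.2.symm

lemma estimand_eq (h : IsPopulation P e m₀) : estimand P = ∫ u, m₀ u.1 ∂(armLaw P true) := by
  have h1 := h.integral_armLaw_mul_resid true (g := fun _ => 1) measurable_const (C := 1) (by simp)
  simp only [one_mul] at h1
  rw [integral_sub (h.integrable_armLaw _ h.integrable_y0) (h.integrable_armLaw _ h.integrable_m)]
    at h1
  exact sub_eq_zero.1 h1

end IsPopulation

/-! ### Moments of the influence function. -/

lemma ind_mem (b : Bool) : 0 ≤ ind b ∧ ind b ≤ 1 := by cases b <;> simp [ind]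

/-- The influence function as a function of the observed data. -/
def observedInfluence {𝓩 : Type*} [MeasurableSpace 𝓩] (P : Measure (PotentialUnit 𝓩)) (e m₀ : 𝓩 → ℝ)
    (o : ObservedUnit 𝓩) : ℝ :=
  (1 - ind o.2.1) * oddsWeight P e o.1 * (o.2.2 - m₀ o.1) / (1 - treatProb P)
    + ind o.2.1 * (m₀ o.1 - estimand P) / treatProb P

lemma observedInfluence_observe {𝓩 : Type*} [MeasurableSpace 𝓩] (P : Measure (PotentialUnit 𝓩))
    (e m₀ : 𝓩 → ℝ) (u : PotentialUnit 𝓩) :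
    observedInfluence P e m₀ (observe u) = influence P e m₀ u := by
  unfold observedInfluence influence observe
  cases h : trt u <;> simp [ind]

lemma ae_armLaw_trt {𝓩 : Type*} [MeasurableSpace 𝓩] (P : Measure (PotentialUnit 𝓩)) (b : Bool) :
    ∀ᵐ u ∂(armLaw P b), trt u = b := ae_cond_mem (measurableSet_trt b)

lemma integral_sub_add {α : Type*} [MeasurableSpace α] {μ : Measure α} {f g k : α → ℝ}
    (hf : Integrable f μ) (hg : Integrable g μ) (hk : Integrable k μ) :
    ∫ x, (f x - g x + k x) ∂μ = ∫ x, f x ∂μ - ∫ x, g x ∂μ + ∫ x, k x ∂μ := by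
  rw [← integral_sub hf hg]
  exact integral_add (hf.sub hg) hk

namespace IsPopulation

variable {𝓩 : Type*} [MeasurableSpace 𝓩] [StandardBorelSpace 𝓩]
  {P : Measure (PotentialUnit 𝓩)} [IsProbabilityMeasure P] {e m₀ : 𝓩 → ℝ}

lemma measurable_observedInfluence (h : IsPopulation P e m₀) :
    Measurable (observedInfluence P e m₀) := by
  have := h.measurable_oddsWeight
  have := h.measurable_m
  unfold observedInfluence; fun_prop

lemma measurable_influence (h : IsPopulation P e m₀) : Measurable (influence P e m₀) := by
  have := h.measurable_oddsWeight
  have := h.measurable_m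
  unfold influence; fun_prop

/-- Every integral splits over the two arms. -/
lemma integral_eq_arms (h : IsPopulation P e m₀) {f : PotentialUnit 𝓩 → ℝ} (hf : Integrable f P) :
    ∫ u, f u ∂P = (1 - treatProb P) * ∫ u, f u ∂(armLaw P false) +
      treatProb P * ∫ u, f u ∂(armLaw P true) := by
  have hp := h.treatProb_mem
  have hc : {u : PotentialUnit 𝓩 | trt u = true}ᶜ = {u | trt u = false} := by ext; simp
  rw [h.armLaw_eq, h.armLaw_eq, integral_smul_measure, integral_smul_measure,
    ENNReal.toReal_ofReal (inv_nonneg.2 (armProb_pos hp _).le),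
    ENNReal.toReal_ofReal (inv_nonneg.2 (armProb_pos hp _).le),
    ← integral_add_compl (measurableSet_trt true) hf, hc]
  have h1 : 1 - treatProb P ≠ 0 := by linarith
  have h2 := hp.1.ne'
  simp only [armProb, smul_eq_mul, Bool.false_eq_true, if_false, if_true]
  field_simp
  ring

lemma measure_eq_arms (h : IsPopulation P e m₀) :
    P = ENNReal.ofReal (armProb true (treatProb P)) • armLaw P true +
      ENNReal.ofReal (armProb false (treatProb P)) • armLaw P false := by
  have hp := h.treatProb_mem
  have hc : {u : PotentialUnit 𝓩 | trt u = true}ᶜ = {u | trt u = false} := by ext; simp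
  have hb : ∀ b, ENNReal.ofReal (armProb b (treatProb P)) • armLaw P b =
      P.restrict {u | trt u = b} := fun b => by
    have := armProb_pos hp b
    rw [h.armLaw_eq, smul_smul, ← ENNReal.ofReal_mul this.le, mul_inv_cancel₀ this.ne']
    simp
  rw [hb, hb, ← hc, Measure.restrict_add_restrict_compl (measurableSet_trt true)]

lemma memLp_two_of_arms (h : IsPopulation P e m₀) {f : PotentialUnit 𝓩 → ℝ} (hm : Measurable f)
    (hf : ∀ b, MemLp f 2 (armLaw P b)) : MemLp f 2 P := by
  simp_rw [memLp_two_iff_integrable_sq hm.aestronglyMeasurable] at hf ⊢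
  rw [h.measure_eq_arms]
  exact ((hf true).smul_measure (by simp)).add_measure ((hf false).smul_measure (by simp))

/-- On the treated arm, `L²` integrability of functions of the covariates follows from the control
arm when the odds weights are bounded. -/
lemma lintegral_treated_le (h : IsPopulation P e m₀) {M₂ : ℝ}
    (hM₂ : ∀ᵐ z ∂(covLaw P), oddsWeight P e z ≤ M₂) {F : 𝓩 × ℝ → ℝ≥0∞} (hF : Measurable F) :
    ∫⁻ u, F (u.1, y0 u) ∂(armLaw P true) ≤
      ENNReal.ofReal M₂ * ∫⁻ u, F (u.1, y0 u) ∂(armLaw P false) := by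
  rw [← h.lintegral_oddsWeight_mul hF, ← lintegral_const_mul _ (by fun_prop)]
  refine lintegral_mono_ae ?_
  have : ∀ᵐ u ∂P, oddsWeight P e u.1 ≤ M₂ := ae_of_ae_map measurable_fst.aemeasurable hM₂
  filter_upwards [(armLaw_absolutelyContinuous P false).ae_le this] with u hu
  gcongr

lemma integrable_treated (h : IsPopulation P e m₀) {M₂ : ℝ}
    (hM₂ : ∀ᵐ z ∂(covLaw P), oddsWeight P e z ≤ M₂) {f : 𝓩 → ℝ} (hf : Measurable f)
    (hint : Integrable (fun u => f u.1) (armLaw P false)) :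
    Integrable (fun u => f u.1) (armLaw P true) := by
  refine ⟨(hf.comp measurable_fst).aestronglyMeasurable, ?_⟩
  refine lt_of_le_of_lt (h.lintegral_treated_le hM₂ (F := fun x => ‖f x.1‖ₑ) (by fun_prop)) ?_
  exact ENNReal.mul_lt_top (by simp) hint.2

lemma memLp_treated (h : IsPopulation P e m₀) {M₂ : ℝ}
    (hM₂ : ∀ᵐ z ∂(covLaw P), oddsWeight P e z ≤ M₂) {f : 𝓩 → ℝ} (hf : Measurable f)
    (hint : MemLp f 2 (controlLaw P)) : MemLp (fun u : PotentialUnit 𝓩 => f u.1) 2 P := by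
  have h0 : MemLp (fun u : PotentialUnit 𝓩 => f u.1) 2 (armLaw P false) :=
    hint.comp_of_map measurable_fst.aemeasurable
  have hm : Measurable (fun u : PotentialUnit 𝓩 => f u.1) := by fun_prop
  refine h.memLp_two_of_arms hm fun b => ?_
  cases b
  · exact h0
  · rw [memLp_two_iff_integrable_sq hm.aestronglyMeasurable] at h0 ⊢
    exact h.integrable_treated hM₂ (f := fun z => f z ^ 2) (by fun_prop) h0

lemma memLp_influence (h : IsPopulation P e m₀) {M₂ : ℝ}
    (hM₂ : ∀ᵐ z ∂(covLaw P), oddsWeight P e z ≤ M₂)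
    (hresid : Integrable (fun u => (y0 u - m₀ u.1) ^ 2) P)
    (hm : MemLp m₀ 2 (controlLaw P)) : MemLp (influence P e m₀) 2 P := by
  have hm' := h.memLp_treated hM₂ h.measurable_m hm
  have hmm := h.measurable_m
  have hw := h.measurable_oddsWeight
  have hres : MemLp (fun u => y0 u - m₀ u.1) 2 P :=
    (memLp_two_iff_integrable_sq (Measurable.aestronglyMeasurable (by fun_prop))).2 hresid
  have hM₂' : ∀ᵐ u ∂P, oddsWeight P e u.1 ≤ M₂ := ae_of_ae_map measurable_fst.aemeasurable hM₂
  have h1 : MemLp (fun u : PotentialUnit 𝓩 =>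
      (1 - ind (trt u)) * oddsWeight P e u.1 * (y0 u - m₀ u.1)) 2 P := by
    refine hres.of_le_mul (c := M₂) (Measurable.aestronglyMeasurable (by fun_prop)) ?_
    filter_upwards [hM₂'] with u hu
    rw [norm_mul]
    gcongr
    have := ind_mem (trt u)
    have := h.oddsWeight_pos u.1
    rw [Real.norm_eq_abs, abs_of_nonneg (mul_nonneg (by linarith) this.le)]
    nlinarith
  have h2 : MemLp (fun u : PotentialUnit 𝓩 => ind (trt u) * (m₀ u.1 - estimand P)) 2 P := by
    refine (hm'.sub (memLp_const (estimand P))).of_le_mul (c := 1)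
      (Measurable.aestronglyMeasurable (by fun_prop)) (ae_of_all _ fun u => ?_)
    have := ind_mem (trt u)
    rw [norm_mul]
    gcongr
    · rw [Real.norm_eq_abs, abs_of_nonneg this.1]; exact this.2
    · simp
  exact (h1.mul_const (1 - treatProb P)⁻¹).add (h2.mul_const (treatProb P)⁻¹)

/-- The orthogonality lemma asks for a multiplier bounded everywhere, whereas w* is bounded only
almost everywhere; the truncation min(w*, M₂) agrees with it almost surely. -/
lemma integral_mul_resid_of_integrable (h : IsPopulation P e m₀) {M₂ : ℝ}
    (hM₂ : ∀ᵐ z ∂(covLaw P), oddsWeight P e z ≤ M₂) :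
    ∫ u, oddsWeight P e u.1 * (y0 u - m₀ u.1) ∂(armLaw P false) = 0 := by
  have hw := h.measurable_oddsWeight
  have hM₂' : ∀ᵐ u ∂P, oddsWeight P e u.1 ≤ M₂ := ae_of_ae_map measurable_fst.aemeasurable hM₂
  have h1 := h.integral_armLaw_mul_resid false (g := fun z => min (oddsWeight P e z) M₂)
    (by fun_prop) (C := |M₂|) (fun z => by
      have := h.oddsWeight_pos z
      rcases le_total 0 M₂ with h0 | h0
      · rw [abs_of_nonneg (le_min this.le h0)]
        exact (min_le_right _ _).trans (le_abs_self _)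
      · rw [min_eq_right (h0.trans this.le)])
  rw [← h1]
  refine integral_congr_ae ?_
  filter_upwards [(armLaw_absolutelyContinuous P false).ae_le hM₂'] with u hu
  rw [min_eq_left hu]

lemma integral_influence (h : IsPopulation P e m₀) {M₂ : ℝ}
    (hM₂ : ∀ᵐ z ∂(covLaw P), oddsWeight P e z ≤ M₂)
    (hint : Integrable (influence P e m₀) P) : ∫ u, influence P e m₀ u ∂P = 0 := by
  have := h.isProbabilityMeasure_armLaw true
  rw [h.integral_eq_arms hint]
  have h0 : ∫ u, influence P e m₀ u ∂(armLaw P false) = 0 := by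
    have : ∀ᵐ u ∂(armLaw P false), influence P e m₀ u =
        (1 - treatProb P)⁻¹ * (oddsWeight P e u.1 * (y0 u - m₀ u.1)) := by
      filter_upwards [ae_armLaw_trt P false] with u hu
      simp [influence, hu, ind]; ring
    rw [integral_congr_ae this, integral_const_mul, h.integral_mul_resid_of_integrable hM₂, mul_zero]
  have h1 : ∫ u, influence P e m₀ u ∂(armLaw P true) = 0 := by
    have : ∀ᵐ u ∂(armLaw P true), influence P e m₀ u =
        (treatProb P)⁻¹ * (m₀ u.1 - estimand P) := by
      filter_upwards [ae_armLaw_trt P true] with u hu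
      simp [influence, hu, ind]; ring
    rw [integral_congr_ae this, integral_const_mul,
      integral_sub (h.integrable_armLaw _ h.integrable_m) (integrable_const _), ← h.estimand_eq]
    simp
  rw [h0, h1]; simp

end IsPopulation

/-! ### From pathwise derivatives to the efficiency bound. -/

/-- The variational form of the efficiency bound: if the pathwise derivative along every bounded
score is represented by a square-integrable centred `ψ`, the bound is `E ψ²`. -/
lemma isEfficiencyBound_of_hasDerivAt {𝓞 : Type*} [MeasurableSpace 𝓞] {Q : Measure 𝓞}
    [IsProbabilityMeasure Q] {θ : Measure 𝓞 → ℝ} {ψ : 𝓞 → ℝ} (hψm : Measurable ψ)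
    (hψ : MemLp ψ 2 Q) (hψ0 : ∫ o, ψ o ∂Q = 0)
    (hderiv : ∀ s, IsBoundedScore Q s →
      HasDerivAt (fun t => θ (submodel Q s t)) (∫ o, s o * ψ o ∂Q) 0)
    (hnondeg : ∃ s, IsBoundedScore Q s ∧ 0 < ∫ o, s o ^ 2 ∂Q) :
    IsEfficiencyBound Q θ (∫ o, ψ o ^ 2 ∂Q) := by
  have hint2 : Integrable (fun o => ψ o ^ 2) Q := hψ.integrable_sq
  have hint1 : Integrable ψ Q := hψ.integrable (by norm_num)
  refine ⟨fun s hs => (hderiv s hs).differentiableAt, ?_, ?_⟩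
  · rintro b ⟨s, hs, hpos, rfl⟩
    rw [(hderiv s hs).deriv, div_le_iff₀ hpos]
    obtain ⟨hsm, ⟨C, hC⟩, -⟩ := hs
    set A := ∫ o, s o ^ 2 ∂Q
    set c := ∫ o, s o * ψ o ∂Q
    have hs2 : Integrable (fun o => s o ^ 2) Q :=
      Integrable.of_bound (by fun_prop) (C ^ 2) (ae_of_all _ fun o => by
        rw [norm_pow]; gcongr; exact hC o)
    have hsψ : Integrable (fun o => s o * ψ o) Q :=
      hint1.bdd_mul (c := C) (by fun_prop) (ae_of_all _ hC)
    -- Cauchy–Schwarz with explicit multipliers: this integral expands to A(A E ψ² − c²), so c² ≤ A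
    -- E ψ².
    have h0 : 0 ≤ ∫ o, (A * ψ o - c * s o) ^ 2 ∂Q := integral_nonneg fun o => sq_nonneg _
    have h1 : ∫ o, (A * ψ o - c * s o) ^ 2 ∂Q =
        A ^ 2 * ∫ o, ψ o ^ 2 ∂Q - 2 * A * c * c + c ^ 2 * A := by
      have : ∀ o, (A * ψ o - c * s o) ^ 2 =
          A ^ 2 * ψ o ^ 2 - 2 * A * c * (s o * ψ o) + c ^ 2 * s o ^ 2 := fun o => by ring
      simp_rw [this]
      rw [integral_sub_add (hint2.const_mul _) (hsψ.const_mul _) (hs2.const_mul _),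
        integral_const_mul, integral_const_mul, integral_const_mul]
    have h2 : 0 ≤ A * (A * ∫ o, ψ o ^ 2 ∂Q - c ^ 2) := by nlinarith
    nlinarith [nonneg_of_mul_nonneg_right h2 hpos]
  · intro M hM
    set V := ∫ o, ψ o ^ 2 ∂Q with hV
    -- When E ψ² = 0 truncations of ψ give no usable score. Any nondegenerate score gives a
    -- nonnegative bound, which is all that is needed.
    rcases (integral_nonneg fun o => sq_nonneg (ψ o) : 0 ≤ V).eq_or_lt with hV0 | hVpos
    · obtain ⟨s, hs, hpos⟩ := hnondeg
      refine le_trans ?_ (hM ⟨s, hs, hpos, rfl⟩)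
      rw [hV, ← hV0]; positivity
    by_contra! hlt
    let tr : ℕ → 𝓞 → ℝ := fun K => {o | |ψ o| ≤ K}.indicator ψ
    have hset : ∀ K : ℕ, MeasurableSet {o | |ψ o| ≤ (K : ℝ)} := fun K =>
      measurableSet_le (by fun_prop) measurable_const
    have htrm : ∀ K, Measurable (tr K) := fun K => hψm.indicator (hset K)
    have htrb : ∀ K o, |tr K o| ≤ K := fun K o => by
      by_cases ho : |ψ o| ≤ K
      · simp [tr, ho]
      · simp [tr, ho]
    have hlim : Tendsto (fun K : ℕ => ∫ o, tr K o * ψ o ∂Q) atTop (𝓝 V) := by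
      refine tendsto_integral_of_dominated_convergence (fun o => ψ o ^ 2)
        (fun K => ((htrm K).mul hψm).aestronglyMeasurable) hint2 (fun K => ae_of_all _ fun o => ?_)
        (ae_of_all _ fun o => ?_)
      · by_cases ho : |ψ o| ≤ K
        · simp [tr, ho, pow_two]
        · simp [tr, ho]; positivity
      · refine tendsto_const_nhds.congr' ?_
        filter_upwards [eventually_ge_atTop ⌈|ψ o|⌉₊] with K hK
        have : |ψ o| ≤ K := (Nat.le_ceil _).trans (by exact_mod_cast hK)
        simp [tr, this, pow_two]
    -- The truncation ψ 1{|ψ| ≤ K} satisfies E[trunc · ψ] = E[trunc²] = v, and v increases to E ψ².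
    -- The maximum with 0 ensures that v is also positive.
    obtain ⟨K, hK⟩ := ((tendsto_order.1 hlim).1 (max M 0) (max_lt hlt hVpos)).exists
    set v := ∫ o, tr K o * ψ o ∂Q with hv
    set a := ∫ o, tr K o ∂Q
    have htri : Integrable (tr K) Q :=
      Integrable.of_bound (htrm K).aestronglyMeasurable K (ae_of_all _ (htrb K))
    have hvsq : ∀ o, tr K o ^ 2 = tr K o * ψ o := fun o => by
      by_cases ho : |ψ o| ≤ K
      · simp [tr, ho, pow_two]
      · simp [tr, ho]
    have htri2 : Integrable (fun o => tr K o * ψ o) Q :=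
      hint1.bdd_mul (c := K) (htrm K).aestronglyMeasurable (ae_of_all _ (htrb K))
    let s : 𝓞 → ℝ := fun o => tr K o - a
    have hs : IsBoundedScore Q s := by
      refine ⟨(htrm K).sub_const _, ⟨K + |a|, fun o => ?_⟩, ?_⟩
      · exact (abs_sub _ _).trans (by gcongr; exact htrb K o)
      · change ∫ o, (tr K o - a) ∂Q = 0
        rw [integral_sub htri (integrable_const _)]; simp [a]
    have hsψ : ∫ o, s o * ψ o ∂Q = v := by
      have : ∀ o, s o * ψ o = tr K o * ψ o - a * ψ o := fun o => by simp only [s]; ring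
      simp_rw [this]
      rw [integral_sub htri2 (hint1.const_mul _), integral_const_mul, hψ0]; simp [hv]
    have hss : ∫ o, s o ^ 2 ∂Q = v - a ^ 2 := by
      have : ∀ o, s o ^ 2 = tr K o * ψ o - 2 * a * tr K o + a ^ 2 := fun o => by
        simp only [s]; rw [← hvsq]; ring
      simp_rw [this]
      rw [integral_sub_add htri2 (htri.const_mul _) (integrable_const _), integral_const_mul]
      simp only [integral_const, probReal_univ, smul_eq_mul, one_mul]
      change v - 2 * a * a + a ^ 2 = _
      ring
    have hv0 : 0 < v := lt_of_le_of_lt (le_max_right _ _) hK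
    have hpos : 0 < ∫ o, s o ^ 2 ∂Q := by
      refine (integral_nonneg fun o => sq_nonneg (s o)).lt_of_ne fun h0 => hv0.ne ?_
      have hi : Integrable (fun o => s o ^ 2) Q := by
        have : ∀ o, s o ^ 2 = tr K o * ψ o - 2 * a * tr K o + a ^ 2 := fun o => by
          simp only [s]; rw [← hvsq]; ring
        simp_rw [this]
        exact (htri2.sub (htri.const_mul _)).add (integrable_const _)
      have := (integral_eq_zero_iff_of_nonneg (fun o => sq_nonneg (s o)) hi).1 h0.symm
      rw [← hsψ, integral_eq_zero_of_ae]
      filter_upwards [this] with o ho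
      have : s o = 0 := by simpa using ho
      simp [this]
    -- Centring the truncation leaves the derivative v unchanged, because ψ has mean zero, and
    -- lowers the information to v − a². Hence the Cramér–Rao bound v²/(v − a²) is at least v > M, a
    -- contradiction.
    have := hM ⟨s, hs, hpos, rfl⟩
    rw [(hderiv s hs).deriv, hsψ, div_le_iff₀ hpos, hss] at this
    have hMv : M < v := lt_of_le_of_lt (le_max_left _ _) hK
    have h3 : 0 < v - a ^ 2 := hss ▸ hpos
    nlinarith [sq_nonneg a]

/-! ### Conditioning and differentiation under a tilted measure. -/

section Tilting

variable {α : Type*} {mα : MeasurableSpace α}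

/-- Conditioning commutes with tilting by a density. -/
lemma cond_withDensity {Q : Measure α} [IsProbabilityMeasure Q] {T : Set α} (hT : MeasurableSet T)
    (hQT : Q T ≠ 0) {d : α → ℝ} (hd : Measurable d) {K : ℝ} (hd0 : ∀ x, 0 < d x)
    (hdK : ∀ x, d x ≤ K) :
    (Q.withDensity fun x => ENNReal.ofReal (d x))[|T] =
      ENNReal.ofReal (∫ x, d x ∂(Q[|T]))⁻¹ • (Q[|T]).withDensity fun x => ENNReal.ofReal (d x) := by
  have := cond_isProbabilityMeasure hQT
  have hint : Integrable d (Q[|T]) := Integrable.of_bound (by fun_prop) K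
    (ae_of_all _ fun x => by rw [Real.norm_eq_abs, abs_of_pos (hd0 x)]; exact hdK x)
  have hc : 0 < ∫ x, d x ∂(Q[|T]) := by
    rw [integral_pos_iff_support_of_nonneg (fun x => (hd0 x).le) hint]
    have : Function.support d = Set.univ := by ext x; simp [(hd0 x).ne']
    rw [this]; simp
  have hres : Q.restrict T = Q T • Q[|T] := by
    rw [ProbabilityTheory.cond, smul_smul, ENNReal.mul_inv_cancel hQT (measure_ne_top _ _), one_smul]
  have h1 : (Q.withDensity fun x => ENNReal.ofReal (d x)).restrict T =
      Q T • (Q[|T]).withDensity fun x => ENNReal.ofReal (d x) := by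
    rw [restrict_withDensity hT, hres, withDensity_smul_measure]
  have h2 : (Q.withDensity fun x => ENNReal.ofReal (d x)) T =
      Q T * ENNReal.ofReal (∫ x, d x ∂(Q[|T])) := by
    rw [← Measure.restrict_apply_univ, h1, Measure.smul_apply, withDensity_apply _ .univ,
      Measure.restrict_univ, ← ofReal_integral_eq_lintegral_ofReal hint
        (ae_of_all _ fun x => (hd0 x).le), smul_eq_mul]
  rw [ProbabilityTheory.cond, h1, h2, smul_smul, ENNReal.ofReal_inv_of_pos hc,
    ENNReal.mul_inv (Or.inl hQT) (Or.inl (measure_ne_top _ _)), mul_right_comm,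
    ENNReal.inv_mul_cancel hQT (measure_ne_top _ _), one_mul]

lemma integral_smul_withDensity {ν : Measure α} {d : α → ℝ} (hd : Measurable d)
    (hd0 : ∀ x, 0 < d x) {c : ℝ} (hc : 0 ≤ c) (f : α → ℝ) :
    ∫ x, f x ∂(ENNReal.ofReal c • ν.withDensity fun x => ENNReal.ofReal (d x)) =
      c * ∫ x, d x * f x ∂ν := by
  rw [integral_smul_measure, integral_withDensity_eq_integral_toReal_smul (by fun_prop) (by simp),
    ENNReal.toReal_ofReal hc]
  congr 2; ext x
  rw [ENNReal.toReal_ofReal (hd0 x).le]; rfl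

/-- Bayes' formula for conditional expectations under a tilted measure. -/
lemma condExp_smul_withDensity {α : Type*} {m mα : MeasurableSpace α} (hm : m ≤ mα) {ν : Measure α}
    [IsProbabilityMeasure ν] {d : α → ℝ} (hd : Measurable d) {δ K c : ℝ} (hδ : 0 < δ)
    (hdδ : ∀ x, δ ≤ d x) (hdK : ∀ x, d x ≤ K) (hc : 0 ≤ c) {f : α → ℝ} (hf : Integrable f ν) :
    (ENNReal.ofReal c • ν.withDensity fun x => ENNReal.ofReal (d x))[f | m]
      =ᵐ[ENNReal.ofReal c • ν.withDensity fun x => ENNReal.ofReal (d x)]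
        fun x => (ν[fun x => d x * f x | m]) x / (ν[d | m]) x := by
  set ν' := ENNReal.ofReal c • ν.withDensity fun x => ENNReal.ofReal (d x) with hν'
  have hd0 : ∀ x, 0 < d x := fun x => hδ.trans_le (hdδ x)
  have hdb : ∀ x, ‖d x‖ ≤ K := fun x => by
    rw [Real.norm_eq_abs, abs_of_pos (hd0 x)]; exact hdK x
  have hdint : Integrable d ν := Integrable.of_bound (by fun_prop) K (ae_of_all _ hdb)
  have hac : ν' ≪ ν := (Measure.smul_absolutelyContinuous).trans (withDensity_absolutelyContinuous _ _)
  have hle : ν' ≤ (ENNReal.ofReal c * ENNReal.ofReal K) • ν := by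
    rw [hν', ← smul_smul]
    gcongr
    rw [← withDensity_const]
    exact withDensity_mono (ae_of_all _ fun x => ENNReal.ofReal_le_ofReal (hdK x))
  have hfin : IsFiniteMeasure ν' := by
    refine ⟨lt_of_le_of_lt (hle _) ?_⟩
    simp [ENNReal.mul_lt_top]
  have hint' : ∀ {g : α → ℝ}, Integrable g ν → Integrable g ν' := fun hg =>
    (hg.smul_measure (ENNReal.mul_ne_top ENNReal.ofReal_ne_top ENNReal.ofReal_ne_top)).mono_measure
      hle
  have hdf : Integrable (fun x => d x * f x) ν := hf.bdd_mul (c := K) (by fun_prop) (ae_of_all _ hdb)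
  set u := ν[fun x => d x * f x | m] with hu
  set v := ν[d | m] with hv
  -- The conditional mean of the density inherits the lower bound δ, so the quotient u/v is
  -- integrable.
  have hvδ : ∀ᵐ x ∂ν, δ ≤ v x := by
    have := condExp_mono (m := m) (integrable_const δ) hdint (ae_of_all ν hdδ)
    rwa [condExp_const hm] at this
  have hum : StronglyMeasurable[m] u := stronglyMeasurable_condExp
  have hvm : StronglyMeasurable[m] v := stronglyMeasurable_condExp
  have hquotm : StronglyMeasurable[m] (fun x => u x / v x) :=
    (hum.measurable.div hvm.measurable).stronglyMeasurable
  have hquot : Integrable (fun x => u x / v x) ν := by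
    refine Integrable.mono' (g := fun x => δ⁻¹ * |u x|) (integrable_condExp.abs.const_mul _)
      (hquotm.mono hm).aestronglyMeasurable ?_
    filter_upwards [hvδ] with x hx
    have hvx : 0 < v x := hδ.trans_le hx
    rw [norm_div, Real.norm_eq_abs, Real.norm_eq_abs, abs_of_pos hvx, div_eq_inv_mul]
    gcongr
  refine (ae_eq_condExp_of_forall_setIntegral_eq hm (hint' hf)
    (fun _ _ _ => (hint' hquot).integrableOn) (fun A hA _ => ?_)
    hquotm.aestronglyMeasurable).symm
  have hA' := hm _ hA
  have hset : ∀ g : α → ℝ, ∫ x in A, g x ∂ν' = c * ∫ x in A, d x * g x ∂ν := fun g => by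
    rw [hν', Measure.restrict_smul, restrict_withDensity hA', integral_smul_withDensity hd hd0 hc]
  rw [hset, hset]
  congr 1
  have hqd : Integrable (fun x => u x / v x * d x) ν := by
    simpa only [mul_comm] using hquot.bdd_mul (c := K) (f := d) (by fun_prop) (ae_of_all _ hdb)
  -- Since u/v is measurable for the smaller σ-algebra, integrating it against d over A is
  -- integrating it against v, which cancels the denominator.
  have hpull := condExp_mul_of_stronglyMeasurable_left (μ := ν) hquotm hqd hdint
  calc ∫ x in A, d x * (u x / v x) ∂ν = ∫ x in A, u x / v x * d x ∂ν := by
        simp_rw [mul_comm]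
    _ = ∫ x in A, (ν[fun x => u x / v x * d x | m]) x ∂ν := (setIntegral_condExp hm hqd hA).symm
    _ = ∫ x in A, u x ∂ν := by
        refine integral_congr_ae (ae_restrict_of_ae ?_)
        filter_upwards [hpull, hvδ] with x h1 h2
        refine Eq.trans h1 ?_
        have : v x ≠ 0 := (hδ.trans_le h2).ne'
        simp only [Pi.mul_apply, ← hv]
        field_simp
    _ = ∫ x in A, d x * f x ∂ν := setIntegral_condExp hm hdf hA

/-- Derivative at the origin of the numerator of the parameter along a tilted path. -/
lemma hasDerivAt_integral_tilted_ratio {ν : Measure α} {s b m a : α → ℝ}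
    (hs : Measurable s) (hb : Measurable b) (hm : Measurable m) (ha : Measurable a) {C : ℝ}
    (hC1 : 1 ≤ C) (hsC : ∀ x, |s x| ≤ C) (hbC : ∀ᵐ x ∂ν, |b x| ≤ C) (hmi : Integrable m ν)
    (hai : Integrable a ν) :
    Integrable (fun x => s x * m x + a x - m x * b x) ν ∧
    HasDerivAt (fun t => ∫ x, (1 + t * s x) * ((m x + t * a x) / (1 + t * b x)) ∂ν)
      (∫ x, (s x * m x + a x - m x * b x) ∂ν) 0 := by
  -- For |t| < 1/(2C) both ts and tb are at most 1/2 in absolute value, so the density and the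
  -- denominator stay in [1/2, 3/2].
  have hball : Metric.ball (0 : ℝ) (1 / (2 * C)) ∈ 𝓝 (0 : ℝ) := Metric.ball_mem_nhds _ (by positivity)
  have hbd : ∀ {t y : ℝ}, t ∈ Metric.ball (0 : ℝ) (1 / (2 * C)) → |y| ≤ C → |t * y| ≤ 1 / 2 := by
    intro t y ht hy
    rw [Metric.mem_ball, dist_zero_right, Real.norm_eq_abs] at ht
    rw [abs_mul]
    calc |t| * |y| ≤ 1 / (2 * C) * C := by gcongr
      _ = 1 / 2 := by field_simp
  -- The dominating constant 20C is 2C from differentiating the density plus 18C = (3/2)·12C from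
  -- differentiating the quotient.
  have hmain := hasDerivAt_integral_of_dominated_loc_of_deriv_le (μ := ν) (x₀ := (0 : ℝ))
    (F := fun t x => (1 + t * s x) * ((m x + t * a x) / (1 + t * b x)))
    (F' := fun t x => s x * ((m x + t * a x) / (1 + t * b x)) + (1 + t * s x) *
      ((a x * (1 + t * b x) - (m x + t * a x) * b x) / (1 + t * b x) ^ 2))
    (bound := fun x => 20 * C * (|m x| + |a x|)) hball
    (Eventually.of_forall fun t => Measurable.aestronglyMeasurable (by fun_prop))
    (by simpa using hmi) (Measurable.aestronglyMeasurable (by fun_prop)) ?_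
    ((hmi.abs.add hai.abs).const_mul _) ?_
  · simpa [add_sub_assoc, mul_comm] using hmain
  · filter_upwards [hbC] with x hx t ht
    have h1 := abs_le.1 (hbd ht (hsC x))
    have h2 := abs_le.1 (hbd ht hx)
    have ht1 : |t| ≤ 1 := by
      have := hbd ht (y := C) (by rw [abs_of_pos (by linarith)])
      rw [abs_mul, abs_of_pos (by linarith : 0 < C)] at this
      nlinarith [abs_nonneg t]
    have hden : 1 / 2 ≤ 1 + t * b x := by linarith
    have hden0 : 0 < 1 + t * b x := by linarith
    have hden2 : 1 / 4 ≤ (1 + t * b x) ^ 2 := by nlinarith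
    have hnum : |m x + t * a x| ≤ |m x| + |a x| := by
      refine (abs_add_le _ _).trans ?_
      rw [abs_mul]
      gcongr
      nlinarith [abs_nonneg (a x)]
    have hma : 0 ≤ |m x| + |a x| := by positivity
    have hax : |a x| ≤ |m x| + |a x| := le_add_of_nonneg_left (abs_nonneg _)
    rw [Real.norm_eq_abs]
    have e1 : |s x * ((m x + t * a x) / (1 + t * b x))| ≤ C * (2 * (|m x| + |a x|)) := by
      rw [abs_mul, abs_div, abs_of_pos hden0]
      gcongr
      · exact hsC x
      · rw [div_le_iff₀ hden0]; nlinarith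
    have e2 : |(1 + t * s x) * ((a x * (1 + t * b x) - (m x + t * a x) * b x) / (1 + t * b x) ^ 2)|
        ≤ 3 / 2 * (12 * C * (|m x| + |a x|)) := by
      rw [abs_mul, abs_div, abs_of_pos (by positivity : 0 < (1 + t * b x) ^ 2)]
      gcongr
      · exact abs_le.2 ⟨by linarith, by linarith⟩
      · rw [div_le_iff₀ (by positivity)]
        calc |a x * (1 + t * b x) - (m x + t * a x) * b x|
            ≤ |a x| * |1 + t * b x| + |m x + t * a x| * |b x| := by
              rw [← abs_mul, ← abs_mul]; exact abs_sub _ _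
          _ ≤ (|m x| + |a x|) * (3 / 2) + (|m x| + |a x|) * C := by
              gcongr
              exact abs_le.2 ⟨by linarith, by linarith⟩
          _ ≤ 3 * C * (|m x| + |a x|) := by nlinarith
          _ ≤ 12 * C * (|m x| + |a x|) * (1 + t * b x) ^ 2 := by
              have : 0 ≤ C * (|m x| + |a x|) := by positivity
              nlinarith
    calc _ ≤ C * (2 * (|m x| + |a x|)) + 3 / 2 * (12 * C * (|m x| + |a x|)) :=
          (abs_add_le _ _).trans (add_le_add e1 e2)
      _ = 20 * C * (|m x| + |a x|) := by ring
  · filter_upwards [hbC] with x hx t ht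
    have h2 := abs_le.1 (hbd ht hx)
    have hden0 : 1 + t * b x ≠ 0 := by linarith
    have d1 : HasDerivAt (fun t : ℝ => 1 + t * s x) (s x) t := by
      simpa using ((hasDerivAt_id t).mul_const (s x)).const_add 1
    have d2 : HasDerivAt (fun t : ℝ => m x + t * a x) (a x) t := by
      simpa using ((hasDerivAt_id t).mul_const (a x)).const_add (m x)
    have d3 : HasDerivAt (fun t : ℝ => 1 + t * b x) (b x) t := by
      simpa using ((hasDerivAt_id t).mul_const (b x)).const_add 1
    exact d1.mul (d2.div d3 hden0)

end Tilting

/-! ### Identification of the parameter and its pathwise derivative. -/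

section ObservedArms

variable {𝓩 : Type*} [MeasurableSpace 𝓩] {P : Measure (PotentialUnit 𝓩)}

/-- The σ-algebra generated by the covariates, on observed units. -/
abbrev obsCovAlg (𝓩 : Type*) [MeasurableSpace 𝓩] :
    MeasurableSpace (ObservedUnit 𝓩) :=
  MeasurableSpace.comap Prod.fst inferInstance

/-- The law of an observed unit given that its treatment indicator is `b`. -/
def obsArmLaw (P : Measure (PotentialUnit 𝓩)) (b : Bool) : Measure (ObservedUnit 𝓩) :=
  (armLaw P b).map observe

lemma measurableSet_obsArm (b : Bool) :
    MeasurableSet {o : ObservedUnit 𝓩 | o.2.1 = b} :=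
  (measurable_fst.comp measurable_snd) (measurableSet_singleton b)

lemma integral_obsArmLaw {f : ObservedUnit 𝓩 → ℝ} (hf : Measurable f) (b : Bool) :
    ∫ o, f o ∂(obsArmLaw P b) = ∫ u, f (observe u) ∂(armLaw P b) :=
  integral_map measurable_observe.aemeasurable hf.aestronglyMeasurable

lemma integrable_obsArmLaw {f : ObservedUnit 𝓩 → ℝ} (hf : Measurable f) (b : Bool) :
    Integrable f (obsArmLaw P b) ↔ Integrable (fun u => f (observe u)) (armLaw P b) :=
  integrable_map_measure hf.aestronglyMeasurable measurable_observe.aemeasurable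

lemma ae_armLaw_false_outcome :
    (fun u : PotentialUnit 𝓩 => (observe u).2.2) =ᵐ[armLaw P false] y0 := by
  filter_upwards [ae_armLaw_trt P false] with u hu
  simp [observe, hu, ind]

end ObservedArms

namespace IsPopulation

variable {𝓩 : Type*} [MeasurableSpace 𝓩] [StandardBorelSpace 𝓩]
  {P : Measure (PotentialUnit 𝓩)} [IsProbabilityMeasure P] {e m₀ : 𝓩 → ℝ}

lemma cond_map_observe (_h : IsPopulation P e m₀) (b : Bool) :
    (P.map observe)[|{o : ObservedUnit 𝓩 | o.2.1 = b}] = obsArmLaw P b := by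
  rw [obsArmLaw, armLaw, ProbabilityTheory.cond, ProbabilityTheory.cond, Measure.map_smul,
    Measure.restrict_map measurable_observe (measurableSet_obsArm b),
    Measure.map_apply measurable_observe (measurableSet_obsArm b)]
  rfl

lemma map_observe_arm_ne_zero (h : IsPopulation P e m₀) (b : Bool) :
    (P.map observe) {o : ObservedUnit 𝓩 | o.2.1 = b} ≠ 0 := by
  rw [Measure.map_apply measurable_observe (measurableSet_obsArm b)]
  exact h.measure_trt_ne_zero b

lemma isProbabilityMeasure_obsArmLaw (h : IsPopulation P e m₀) (b : Bool) :
    IsProbabilityMeasure (obsArmLaw P b) :=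
  have := h.isProbabilityMeasure_armLaw b
  Measure.isProbabilityMeasure_map measurable_observe.aemeasurable

lemma integrable_outcome (h : IsPopulation P e m₀) :
    Integrable (fun o : ObservedUnit 𝓩 => o.2.2) (obsArmLaw P false) := by
  rw [integrable_obsArmLaw (by fun_prop)]
  exact (h.integrable_armLaw false h.integrable_y0).congr ae_armLaw_false_outcome.symm

lemma integrable_m_obs (h : IsPopulation P e m₀) (b : Bool) :
    Integrable (fun o : ObservedUnit 𝓩 => m₀ o.1) (obsArmLaw P b) := by
  have := h.measurable_m
  rw [integrable_obsArmLaw (by fun_prop)]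
  exact h.integrable_armLaw b h.integrable_m

/-- Among controls the observed outcome is Y(0), and its residual from m₀ is orthogonal to
indicators of covariate sets. By unconfoundedness the population regression is thus also the
regression on the control arm. -/
lemma condExp_outcome (h : IsPopulation P e m₀) :
    (obsArmLaw P false)[fun o : ObservedUnit 𝓩 => o.2.2 | obsCovAlg 𝓩] =ᵐ[obsArmLaw P false]
      fun o => m₀ o.1 := by
  have := h.isProbabilityMeasure_obsArmLaw false
  have hm := h.measurable_m
  refine (ae_eq_condExp_of_forall_setIntegral_eq measurable_fst.comap_le h.integrable_outcome
    (fun _ _ _ => (h.integrable_m_obs false).integrableOn) (fun A hA _ => ?_)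
    (hm.comp (comap_measurable Prod.fst)).stronglyMeasurable.aestronglyMeasurable).symm
  obtain ⟨A, hA, rfl⟩ := hA
  have hA' : MeasurableSet (Prod.fst ⁻¹' A : Set (ObservedUnit 𝓩)) := measurable_fst hA
  rw [← sub_eq_zero, ← integral_sub (h.integrable_m_obs false).integrableOn
    h.integrable_outcome.integrableOn, ← integral_indicator hA',
    integral_obsArmLaw (Measurable.indicator (by fun_prop) hA')]
  have h1 := h.integral_armLaw_mul_resid false (g := A.indicator fun _ => -1)
    (measurable_const.indicator hA) (C := 1) (fun z => by by_cases hz : z ∈ A <;> simp [hz])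
  rw [← h1]
  refine integral_congr_ae ?_
  filter_upwards [ae_armLaw_false_outcome (P := P)] with u hu
  have : (observe u).1 = u.1 := rfl
  by_cases hz : u.1 ∈ A <;> simp [Set.indicator, hz, hu, this]

/-- Null sets of the covariates on the control arm are null on the treated arm. -/
lemma ae_treated_of_ae_control (h : IsPopulation P e m₀) {q : ObservedUnit 𝓩 → Prop}
    (hq : MeasurableSet[obsCovAlg 𝓩] {o | q o}) (h0 : ∀ᵐ o ∂(obsArmLaw P false), q o) :
    ∀ᵐ o ∂(obsArmLaw P true), q o := by
  obtain ⟨A, hA, hAq⟩ := hq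
  have hq' : MeasurableSet {o | q o} := hAq ▸ measurable_fst hA
  rw [obsArmLaw, ae_map_iff measurable_observe.aemeasurable hq'] at h0 ⊢
  have hiff : ∀ u : PotentialUnit 𝓩, q (observe u) ↔ u.1 ∈ A := fun u => by
    have : observe u ∈ Prod.fst ⁻¹' A ↔ observe u ∈ {o | q o} := by rw [hAq]
    exact this.symm
  simp_rw [hiff] at h0 ⊢
  have h1 := h.lintegral_oddsWeight_mul (F := fun x => Aᶜ.indicator (fun _ => 1) x.1)
    ((measurable_const.indicator hA.compl).comp measurable_fst)
  have h2 : ∫⁻ u, ENNReal.ofReal (oddsWeight P e u.1) * Aᶜ.indicator (fun _ => 1) u.1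
      ∂(armLaw P false) = 0 := by
    refine (lintegral_congr_ae ?_).trans lintegral_zero
    filter_upwards [h0] with u hu
    simp [hu]
  rw [h2] at h1
  rw [ae_iff]
  have h3 : MeasurableSet {u : PotentialUnit 𝓩 | u.1 ∉ A} := measurable_fst hA.compl
  rw [← lintegral_indicator_one h3, h1]
  rfl

lemma integral_treated_of_covariate (h : IsPopulation P e m₀) {f : ObservedUnit 𝓩 → ℝ}
    (hf : Measurable[obsCovAlg 𝓩] f) :
    ∫ o, f o ∂(obsArmLaw P true) = ∫ o, oddsWeight P e o.1 * f o ∂(obsArmLaw P false) := by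
  have hw := h.measurable_oddsWeight
  obtain ⟨g, hg, rfl⟩ := hf.exists_eq_measurable_comp
  have := h.integral_oddsWeight_mul (F := fun x => g x.1) (by fun_prop)
  rw [integral_obsArmLaw (by fun_prop), integral_obsArmLaw
    (f := fun o => oddsWeight P e o.1 * (g ∘ Prod.fst) o) (by
      have : Measurable (g ∘ (Prod.fst : ObservedUnit 𝓩 → 𝓩)) := by fun_prop
      fun_prop)]
  exact this.symm

lemma integrable_treated_of_covariate (h : IsPopulation P e m₀) {M₂ : ℝ}
    (hM₂ : ∀ᵐ z ∂(covLaw P), oddsWeight P e z ≤ M₂) {f : ObservedUnit 𝓩 → ℝ}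
    (hf : Measurable[obsCovAlg 𝓩] f) (hint : Integrable f (obsArmLaw P false)) :
    Integrable f (obsArmLaw P true) := by
  obtain ⟨g, hg, rfl⟩ := hf.exists_eq_measurable_comp
  rw [integrable_obsArmLaw (by fun_prop)] at hint ⊢
  exact h.integrable_treated hM₂ hg hint

/-- The parameter is identified from the law of the observed data. -/
lemma observedParam_eq (h : IsPopulation P e m₀) : observedParam (P.map observe) = estimand P := by
  have hm := h.measurable_m
  rw [observedParam, h.cond_map_observe, h.cond_map_observe, h.estimand_eq]
  -- The control regression is determined only up to control-null sets but is averaged over the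
  -- treated. It depends on Z alone, and null sets of covariates transfer from controls to treated.
  have h1 : ∀ᵐ o ∂(obsArmLaw P true),
      ((obsArmLaw P false)[fun o : ObservedUnit 𝓩 => o.2.2 | obsCovAlg 𝓩]) o = m₀ o.1 := by
    refine h.ae_treated_of_ae_control ?_ h.condExp_outcome
    exact measurableSet_eq_fun (m := obsCovAlg 𝓩)
      stronglyMeasurable_condExp.measurable (hm.comp (comap_measurable Prod.fst))
  rw [integral_congr_ae h1, integral_obsArmLaw (f := fun o => m₀ o.1) (by fun_prop)]
  rfl

/-- The map `t ↦ θ(Q_t)` is differentiable at the origin, with the influence function as its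
gradient. -/
lemma hasDerivAt_observedParam (h : IsPopulation P e m₀) {M₂ : ℝ}
    (hM₂ : ∀ᵐ z ∂(covLaw P), oddsWeight P e z ≤ M₂) (hinf : Integrable (influence P e m₀) P)
    {s : ObservedUnit 𝓩 → ℝ} (hs : IsBoundedScore (P.map observe) s) :
    HasDerivAt (fun t => observedParam (submodel (P.map observe) s t))
      (∫ o, s o * observedInfluence P e m₀ o ∂(P.map observe)) 0 := by
  have hprob := h.isProbabilityMeasure_obsArmLaw
  have hQ : IsProbabilityMeasure (P.map observe) :=
    Measure.isProbabilityMeasure_map measurable_observe.aemeasurable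
  have hm₀ := h.measurable_m
  have hw := h.measurable_oddsWeight
  have hle : obsCovAlg 𝓩 ≤ (inferInstance : MeasurableSpace (ObservedUnit 𝓩)) :=
    measurable_fst.comap_le
  obtain ⟨hsm, ⟨C', hC'⟩, -⟩ := hs
  obtain ⟨C, hC1, hC⟩ : ∃ C : ℝ, 1 ≤ C ∧ ∀ o, |s o| ≤ C :=
    ⟨max C' 1, le_max_right _ _, fun o => (hC' o).trans (le_max_left _ _)⟩
  have hsint : ∀ b, Integrable s (obsArmLaw P b) := fun b =>
    Integrable.of_bound hsm.aestronglyMeasurable C (ae_of_all _ hC)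
  have hsY : Integrable (fun o => s o * o.2.2) (obsArmLaw P false) :=
    h.integrable_outcome.bdd_mul (c := C) hsm.aestronglyMeasurable (ae_of_all _ hC)
  -- With a = E[sY | Z, T = 0] and b = E[s | Z, T = 0], the regression of Y along the path is (m +
  -- ta)/(1 + tb), and the treated law is tilted by 1 + ts and renormalised.
  set a := (obsArmLaw P false)[fun o => s o * o.2.2 | obsCovAlg 𝓩] with ha
  set b := (obsArmLaw P false)[s | obsCovAlg 𝓩] with hb
  let m : ObservedUnit 𝓩 → ℝ := fun o => m₀ o.1
  have ham : Measurable[obsCovAlg 𝓩] a := stronglyMeasurable_condExp.measurable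
  have hbm : Measurable[obsCovAlg 𝓩] b := stronglyMeasurable_condExp.measurable
  have hmm : Measurable[obsCovAlg 𝓩] m := hm₀.comp (comap_measurable Prod.fst)
  have ham' : Measurable a := ham.mono hle le_rfl
  have hbm' : Measurable b := hbm.mono hle le_rfl
  have hmm' : Measurable m := hmm.mono hle le_rfl
  have hai : Integrable a (obsArmLaw P false) := integrable_condExp
  have hai1 : Integrable a (obsArmLaw P true) := h.integrable_treated_of_covariate hM₂ ham hai
  have hb0 : ∀ᵐ o ∂(obsArmLaw P false), |b o| ≤ C :=
    ae_bdd_abs_condExp_of_ae_bdd_abs (ae_of_all _ hC)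
  have hb1 : ∀ᵐ o ∂(obsArmLaw P true), |b o| ≤ C := by
    refine h.ae_treated_of_ae_control ?_ hb0
    exact hbm (measurableSet_le continuous_abs.measurable measurable_const : MeasurableSet {y | |y| ≤ C})
  obtain ⟨hFint, hF⟩ := hasDerivAt_integral_tilted_ratio (ν := obsArmLaw P true) hsm hbm' hmm' ham'
    hC1 hC hb1 (h.integrable_m_obs true) hai1
  have hG : HasDerivAt (fun t => ∫ o, (1 + t * s o) ∂(obsArmLaw P true))
      (∫ o, s o ∂(obsArmLaw P true)) 0 := by
    have : (fun t => ∫ o, (1 + t * s o) ∂(obsArmLaw P true)) =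
        fun t => 1 + t * ∫ o, s o ∂(obsArmLaw P true) := by
      ext t
      rw [integral_add (integrable_const _) ((hsint true).const_mul t), integral_const_mul]
      simp
    rw [this]
    simpa using ((hasDerivAt_id (0 : ℝ)).mul_const
      (∫ o, s o ∂(obsArmLaw P true))).const_add 1
  have hG0 : ∫ o, (1 + (0 : ℝ) * s o) ∂(obsArmLaw P true) = 1 := by simp
  have hF0 : ∫ o, (1 + 0 * s o) * ((m o + 0 * a o) / (1 + 0 * b o)) ∂(obsArmLaw P true) =
      estimand P := by
    rw [h.estimand_eq]
    refine Eq.trans ?_ (integral_obsArmLaw (f := fun o => m₀ o.1) (by fun_prop) true)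
    simp [m]
  have hquot := hF.div hG (by rw [hG0]; exact one_ne_zero)
  rw [hG0, hF0] at hquot
  -- The right side is the quotient rule at t = 0. What remains is to recognise it as E[sψ], by
  -- splitting ψ over the two arms.
  have hval : ∫ o, s o * observedInfluence P e m₀ o ∂(P.map observe) =
      ((∫ o, (s o * m o + a o - m o * b o) ∂(obsArmLaw P true)) * 1 -
        estimand P * ∫ o, s o ∂(obsArmLaw P true)) / 1 ^ 2 := by
    have hψm := h.measurable_observedInfluence
    have hp := h.treatProb_mem
    have hp1 : 1 - treatProb P ≠ 0 := by linarith
    have hp2 := hp.1.ne'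
    have hsψ : Integrable (fun u => s (observe u) * influence P e m₀ u) P :=
      hinf.bdd_mul (c := C) (hsm.comp measurable_observe).aestronglyMeasurable
        (ae_of_all _ fun u => hC _)
    rw [integral_map measurable_observe.aemeasurable
      (Measurable.aestronglyMeasurable (by fun_prop))]
    simp_rw [observedInfluence_observe]
    rw [h.integral_eq_arms hsψ]
    have e0 : (1 - treatProb P) * ∫ u, s (observe u) * influence P e m₀ u ∂(armLaw P false) =
        ∫ o, oddsWeight P e o.1 * (s o * o.2.2 - m o * s o) ∂(obsArmLaw P false) := by
      rw [← integral_const_mul, integral_obsArmLaw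
        (f := fun o => oddsWeight P e o.1 * (s o * o.2.2 - m o * s o)) (by fun_prop)]
      refine integral_congr_ae ?_
      filter_upwards [ae_armLaw_trt P false, ae_armLaw_false_outcome (P := P)] with u hu hy
      have : (observe u).1 = u.1 := rfl
      simp only [influence, hu, ind, hy, m, this, Bool.false_eq_true, if_false]
      field_simp
      ring
    have e1 : treatProb P * ∫ u, s (observe u) * influence P e m₀ u ∂(armLaw P true) =
        ∫ o, s o * m o ∂(obsArmLaw P true) - estimand P * ∫ o, s o ∂(obsArmLaw P true) := by
      have hsm1 : Integrable (fun o => s o * m o) (obsArmLaw P true) :=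
        (h.integrable_m_obs true).bdd_mul (c := C) hsm.aestronglyMeasurable (ae_of_all _ hC)
      rw [← integral_const_mul, ← integral_const_mul,
        ← integral_sub hsm1 ((hsint true).const_mul _), integral_obsArmLaw
        (f := fun o => s o * m o - estimand P * s o) (by fun_prop)]
      refine integral_congr_ae ?_
      filter_upwards [ae_armLaw_trt P true] with u hu
      have : (observe u).1 = u.1 := rfl
      simp only [influence, hu, ind, m, this, if_true]
      field_simp
      ring
    have hms : Integrable (fun o => m o * s o) (obsArmLaw P false) := by
      simpa only [mul_comm] using
        (h.integrable_m_obs false).bdd_mul (c := C) hsm.aestronglyMeasurable (ae_of_all _ hC)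
    have hmb : Integrable (fun o => m o * b o) (obsArmLaw P false) := by
      simpa only [mul_comm] using
        (h.integrable_m_obs false).bdd_mul (c := C) hbm'.aestronglyMeasurable hb0
    have hmb1 : Integrable (fun o => m o * b o) (obsArmLaw P true) := by
      simpa only [mul_comm] using
        (h.integrable_m_obs true).bdd_mul (c := C) hbm'.aestronglyMeasurable hb1
    have hwb : ∀ᵐ o ∂(obsArmLaw P false), ‖oddsWeight P e o.1‖ ≤ M₂ := by
      rw [obsArmLaw, ae_map_iff measurable_observe.aemeasurable
        (measurableSet_le (by fun_prop) measurable_const)]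
      have : ∀ᵐ u ∂P, oddsWeight P e u.1 ≤ M₂ := ae_of_ae_map measurable_fst.aemeasurable hM₂
      filter_upwards [(armLaw_absolutelyContinuous P false).ae_le this] with u hu
      rw [Real.norm_eq_abs, abs_of_pos (h.oddsWeight_pos _)]
      exact hu
    -- The only nontrivial match: the treated mean of a − mb becomes a w*-weighted control mean, and
    -- a − mb is the control regression of sY − ms. This is where w* enters the gradient.
    have e2 : ∫ o, oddsWeight P e o.1 * (s o * o.2.2 - m o * s o) ∂(obsArmLaw P false) =
        ∫ o, (a o - m o * b o) ∂(obsArmLaw P true) := by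
      rw [h.integral_treated_of_covariate (f := fun o => a o - m o * b o) (ham.sub (hmm.mul hbm))]
      have hce : (obsArmLaw P false)[fun o => s o * o.2.2 - m o * s o | obsCovAlg 𝓩]
          =ᵐ[obsArmLaw P false] fun o => a o - m o * b o := by
        refine (condExp_sub hsY hms _).trans ?_
        filter_upwards [condExp_mul_of_stronglyMeasurable_left (μ := obsArmLaw P false)
          hmm.stronglyMeasurable hms (hsint false)] with o ho
        have h2 : ((obsArmLaw P false)[fun o => m o * s o | obsCovAlg 𝓩]) o = m o * b o := ho
        rw [Pi.sub_apply, h2]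
      have hdiff := hsY.sub hms
      have hwd : Integrable (fun o => oddsWeight P e o.1 * (s o * o.2.2 - m o * s o))
          (obsArmLaw P false) :=
        hdiff.bdd_mul (c := M₂) (Measurable.aestronglyMeasurable (by fun_prop)) hwb
      rw [← integral_condExp hle (f := fun o => oddsWeight P e o.1 * (s o * o.2.2 - m o * s o))]
      refine integral_congr_ae ?_
      filter_upwards [hce, condExp_mul_of_stronglyMeasurable_left (μ := obsArmLaw P false)
        (f := fun o : ObservedUnit 𝓩 => oddsWeight P e o.1)
        (hw.comp (comap_measurable Prod.fst)).stronglyMeasurable hwd hdiff] with o h1 h2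
      refine Eq.trans h2 ?_
      rw [Pi.mul_apply]
      congr 1
    have hsm1 : Integrable (fun o => s o * m o) (obsArmLaw P true) :=
      (h.integrable_m_obs true).bdd_mul (c := C) hsm.aestronglyMeasurable (ae_of_all _ hC)
    have e3 : ∫ o, (s o * m o + a o - m o * b o) ∂(obsArmLaw P true) =
        ∫ o, s o * m o ∂(obsArmLaw P true) + ∫ o, (a o - m o * b o) ∂(obsArmLaw P true) := by
      refine Eq.trans ?_ (integral_add hsm1 (hai1.sub hmb1))
      exact integral_congr_ae (ae_of_all _ fun o => add_sub_assoc _ _ _)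
    rw [e0, e1, e2, e3]; ring
  rw [hval]
  refine hquot.congr_of_eventuallyEq ?_
  have hball : Metric.ball (0 : ℝ) (1 / (2 * C)) ∈ 𝓝 (0 : ℝ) :=
    Metric.ball_mem_nhds _ (by positivity)
  filter_upwards [hball] with t ht
  have hts : ∀ o, |t * s o| ≤ 1 / 2 := fun o => by
    rw [Metric.mem_ball, dist_zero_right, Real.norm_eq_abs] at ht
    rw [abs_mul]
    calc |t| * |s o| ≤ 1 / (2 * C) * C := by gcongr; exact hC o
      _ = 1 / 2 := by field_simp
  have hd : Measurable fun o => 1 + t * s o := by fun_prop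
  have hdl : ∀ o, 1 / 2 ≤ 1 + t * s o := fun o => by linarith [(abs_le.1 (hts o)).1]
  have hdu : ∀ o, 1 + t * s o ≤ 3 / 2 := fun o => by linarith [(abs_le.1 (hts o)).2]
  have hd0 : ∀ o, 0 < 1 + t * s o := fun o => by linarith [hdl o]
  have hcond : ∀ c, (submodel (P.map observe) s t)[|{o : ObservedUnit 𝓩 | o.2.1 = c}] =
      ENNReal.ofReal (∫ o, (1 + t * s o) ∂(obsArmLaw P c))⁻¹ •
        (obsArmLaw P c).withDensity fun o => ENNReal.ofReal (1 + t * s o) := fun c => by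
    rw [← h.cond_map_observe c]
    exact cond_withDensity (measurableSet_obsArm c) (h.map_observe_arm_ne_zero c) hd hd0 hdu
  have hcpos : ∀ c, 0 < ∫ o, (1 + t * s o) ∂(obsArmLaw P c) := fun c => by
    have := integral_mono (μ := obsArmLaw P c) (integrable_const (1 / 2 : ℝ))
      ((integrable_const (1 : ℝ)).add ((hsint c).const_mul t)) hdl
    simp only [integral_const, probReal_univ, one_smul] at this
    have h2 : (0 : ℝ) < 1 / 2 := by norm_num
    exact h2.trans_le this
  rw [observedParam, hcond, hcond,
    integral_smul_withDensity hd hd0 (inv_nonneg.2 (hcpos true).le)]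
  simp only [Pi.div_apply]
  rw [div_eq_inv_mul]
  congr 1
  refine integral_congr_ae ?_
  have hbayes := condExp_smul_withDensity hle hd (by norm_num : (0 : ℝ) < 1 / 2) hdl hdu
    (inv_nonneg.2 (hcpos false).le) h.integrable_outcome
  set ν' := ENNReal.ofReal (∫ o, (1 + t * s o) ∂(obsArmLaw P false))⁻¹ •
    (obsArmLaw P false).withDensity fun o => ENNReal.ofReal (1 + t * s o) with hν'
  -- Bayes' formula holds almost everywhere for the tilted law. As the density is positive, it holds
  -- almost everywhere for the control law, and from there `hmain` carries it to the treated law.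
  have hac : obsArmLaw P false ≪ ν' := by
    refine (withDensity_absolutelyContinuous' (Measurable.aemeasurable (by fun_prop))
      (ae_of_all _ fun o => by simpa using hd0 o)).trans
        (Measure.absolutelyContinuous_smul ?_)
    simpa using hcpos false
  have hdY : (obsArmLaw P false)[fun o => (1 + t * s o) * o.2.2 | obsCovAlg 𝓩]
      =ᵐ[obsArmLaw P false] fun o => m o + t * a o := by
    have : (fun o : ObservedUnit 𝓩 => (1 + t * s o) * o.2.2) =
        (fun o => o.2.2) + t • fun o => s o * o.2.2 := by
      ext o; simp only [Pi.add_apply, Pi.smul_apply, smul_eq_mul]; ring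
    rw [this]
    refine (condExp_add h.integrable_outcome (hsY.smul t) _).trans ?_
    filter_upwards [h.condExp_outcome, condExp_smul (μ := obsArmLaw P false) t
      (fun o => s o * o.2.2) (obsCovAlg 𝓩)] with o h1 h2
    rw [Pi.add_apply, h1, h2]; rfl
  have hdd : (obsArmLaw P false)[fun o => 1 + t * s o | obsCovAlg 𝓩]
      =ᵐ[obsArmLaw P false] fun o => 1 + t * b o := by
    have : (fun o : ObservedUnit 𝓩 => 1 + t * s o) = (fun _ => (1 : ℝ)) + t • s := by
      ext o; simp
    rw [this]
    refine (condExp_add (integrable_const 1) ((hsint false).smul t) _).trans ?_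
    rw [condExp_const hle]
    filter_upwards [condExp_smul (μ := obsArmLaw P false) t s (obsCovAlg 𝓩)] with o h2
    rw [Pi.add_apply, h2]; rfl
  have hmain : ∀ᵐ o ∂(obsArmLaw P true), (ν'[fun o : ObservedUnit 𝓩 => o.2.2 | obsCovAlg 𝓩]) o =
      (m o + t * a o) / (1 + t * b o) := by
    refine h.ae_treated_of_ae_control ?_ ?_
    · exact measurableSet_eq_fun (m := obsCovAlg 𝓩) stronglyMeasurable_condExp.measurable
        ((hmm.add (ham.const_mul t)).div ((hbm.const_mul t).const_add 1))
    · filter_upwards [hac.ae_le hbayes, hdY, hdd] with o h1 h2 h3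
      rw [h1, h2, h3]
  filter_upwards [hmain] with o ho
  rw [ho]

/-- The asymptotic variance is the semiparametric efficiency bound. -/
lemma isEfficiencyBound (h : IsPopulation P e m₀) {M₂ : ℝ}
    (hM₂ : ∀ᵐ z ∂(covLaw P), oddsWeight P e z ≤ M₂) (hinf : MemLp (influence P e m₀) 2 P) :
    IsEfficiencyBound (P.map observe) observedParam (asympVar P e m₀) := by
  have hQ : IsProbabilityMeasure (P.map observe) :=
    Measure.isProbabilityMeasure_map measurable_observe.aemeasurable
  have hψm := h.measurable_observedInfluence
  have hi := hinf.integrable (by norm_num : (1 : ℝ≥0∞) ≤ 2)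
  have hcomp : observedInfluence P e m₀ ∘ observe = influence P e m₀ :=
    funext fun u => observedInfluence_observe P e m₀ u
  have hL2 : MemLp (observedInfluence P e m₀) 2 (P.map observe) := by
    rw [memLp_map_measure_iff hψm.aestronglyMeasurable measurable_observe.aemeasurable, hcomp]
    exact hinf
  have h0 : ∫ o, observedInfluence P e m₀ o ∂(P.map observe) = 0 := by
    rw [integral_map measurable_observe.aemeasurable hψm.aestronglyMeasurable]
    simp_rw [observedInfluence_observe]
    exact h.integral_influence hM₂ hi
  have hV : asympVar P e m₀ = ∫ o, observedInfluence P e m₀ o ^ 2 ∂(P.map observe) := by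
    rw [integral_map measurable_observe.aemeasurable
      (Measurable.aestronglyMeasurable (by fun_prop)), asympVar,
      variance_of_integral_eq_zero hi.aemeasurable (h.integral_influence hM₂ hi)]
    simp_rw [observedInfluence_observe]
  rw [hV]
  refine isEfficiencyBound_of_hasDerivAt hψm hL2 h0
    (fun s hs => h.hasDerivAt_observedParam hM₂ hi hs) ?_
  have hp := h.treatProb_mem
  have hTint : Integrable (fun o : ObservedUnit 𝓩 => ind o.2.1) (P.map observe) :=
    Integrable.of_bound (Measurable.aestronglyMeasurable (by fun_prop)) 1
      (ae_of_all _ fun o => by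
        rw [Real.norm_eq_abs, abs_of_nonneg (ind_mem _).1]; exact (ind_mem _).2)
  have hT : ∫ o : ObservedUnit 𝓩, ind o.2.1 ∂(P.map observe) = treatProb P := by
    rw [integral_map measurable_observe.aemeasurable
      (Measurable.aestronglyMeasurable (by fun_prop)), treatProb,
      ← integral_indicator_one (measurableSet_trt true)]
    congr 1; ext u
    cases hu : trt u <;> simp [observe, ind, hu]
  -- The score T − p is bounded and centred, with variance p(1 − p) > 0.
  refine ⟨fun o => ind o.2.1 - treatProb P, ⟨by fun_prop, ⟨1, fun o => ?_⟩, ?_⟩, ?_⟩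
  · have := ind_mem o.2.1
    exact abs_le.2 ⟨by linarith, by linarith⟩
  · rw [integral_sub hTint (integrable_const _), hT]; simp
  · have hsq : ∀ o : ObservedUnit 𝓩, (ind o.2.1 - treatProb P) ^ 2 =
        ind o.2.1 - 2 * treatProb P * ind o.2.1 + treatProb P ^ 2 := fun o => by
      cases o.2.1
      · simp [ind]
      · simp [ind]; ring
    simp_rw [hsq]
    rw [integral_sub_add hTint (hTint.const_mul _) (integrable_const _), integral_const_mul, hT]
    simp only [integral_const, probReal_univ, smul_eq_mul, one_mul]
    nlinarith

end IsPopulation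

/-! ### Resampling coordinates of a product law. -/

section Merge

variable {ι : Type*} [DecidableEq ι] {X : Type*} [MeasurableSpace X]

lemma measurable_piecewise_pair (J : Finset ι) :
    Measurable fun x : (ι → X) × (ι → X) => J.piecewise x.1 x.2 := by
  refine measurable_pi_lambda _ fun i => ?_
  by_cases hi : i ∈ J <;> simp only [Finset.piecewise, hi, if_true, if_false] <;> fun_prop

variable [Fintype ι]

/-- Resampling a set of coordinates preserves a product law. -/
lemma measurePreserving_piecewise (μ : ι → Measure X) [∀ i, IsProbabilityMeasure (μ i)]
    (J : Finset ι) :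
    MeasurePreserving (fun x : (ι → X) × (ι → X) => J.piecewise x.1 x.2)
      ((Measure.pi μ).prod (Measure.pi μ)) (Measure.pi μ) := by
  refine ⟨measurable_piecewise_pair J, (Measure.pi_eq fun s hs => ?_).symm⟩
  rw [Measure.map_apply (measurable_piecewise_pair J) (MeasurableSet.univ_pi hs)]
  have : (fun x : (ι → X) × (ι → X) => J.piecewise x.1 x.2) ⁻¹' Set.univ.pi s =
      (Set.univ.pi fun i => if i ∈ J then s i else Set.univ) ×ˢ
        (Set.univ.pi fun i => if i ∈ J then Set.univ else s i) := by
    ext x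
    simp only [Set.mem_preimage, Set.mem_pi, Set.mem_univ, true_implies, Set.mem_prod]
    rw [← forall_and]
    refine forall_congr' fun i => ?_
    by_cases hi : i ∈ J <;> simp [Finset.piecewise, hi]
  rw [this, Measure.prod_prod, Measure.pi_pi, Measure.pi_pi, ← Finset.prod_mul_distrib]
  refine Finset.prod_congr rfl fun i _ => ?_
  by_cases hi : i ∈ J <;> simp [hi]

/-- Events determined by complementary sets of coordinates are independent under a product law. -/
lemma measure_pi_inter_of_dependsOn (μ : ι → Measure X) [∀ i, IsProbabilityMeasure (μ i)]
    (J : Finset ι) {F G : Set (ι → X)} (hF : MeasurableSet F) (hG : MeasurableSet G)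
    (hFJ : ∀ d d', (∀ i ∈ J, d i = d' i) → d ∈ F → d' ∈ F)
    (hGJ : ∀ d d', (∀ i ∉ J, d i = d' i) → d ∈ G → d' ∈ G) :
    Measure.pi μ (F ∩ G) = Measure.pi μ F * Measure.pi μ G := by
  -- Realise the sample by merging two independent copies along J. Then F sees only the first copy
  -- and G only the second, so the intersection is a product set.
  rw [← (measurePreserving_piecewise μ J).measure_preimage (hF.inter hG).nullMeasurableSet,
    ← Measure.prod_prod]
  congr 1
  ext ⟨d, d'⟩
  have h1 : ∀ i ∈ J, J.piecewise d d' i = d i := fun i hi => by simp [hi]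
  have h2 : ∀ i ∉ J, J.piecewise d d' i = d' i := fun i hi => by simp [hi]
  simp only [Set.mem_preimage, Set.mem_inter_iff, Set.mem_prod]
  exact ⟨fun ⟨a, b⟩ => ⟨hFJ _ _ h1 a, hGJ _ _ h2 b⟩,
    fun ⟨a, b⟩ => ⟨hFJ _ _ (fun i hi => (h1 i hi).symm) a, hGJ _ _ (fun i hi => (h2 i hi).symm) b⟩⟩

/-- Integrating out one coordinate of a product law. -/
lemma integral_pi_eq_integral_update (μ : ι → Measure X) [∀ i, IsProbabilityMeasure (μ i)] (i : ι)
    {F : (ι → X) → ℝ} (hF : Measurable F) (hint : Integrable F (Measure.pi μ)) :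
    ∫ d, F d ∂(Measure.pi μ) = ∫ d, ∫ x, F (Function.update d i x) ∂(μ i) ∂(Measure.pi μ) := by
  have hmp := measurePreserving_piecewise μ (Finset.univ.erase i)
  have hupd : ∀ d d' : ι → X,
      (Finset.univ.erase i).piecewise d d' = Function.update d i (d' i) := fun d d' => by
    ext j
    by_cases hj : j = i
    · subst hj; simp
    · simp [Finset.piecewise, hj]
  have hint' : Integrable (fun x : (ι → X) × (ι → X) => F (Function.update x.1 i (x.2 i)))
      ((Measure.pi μ).prod (Measure.pi μ)) := by
    simpa only [Function.comp_def, hupd] using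
      (hmp.integrable_comp hF.aestronglyMeasurable).2 hint
  calc ∫ d, F d ∂(Measure.pi μ)
      = ∫ x, F (Function.update x.1 i (x.2 i)) ∂((Measure.pi μ).prod (Measure.pi μ)) := by
        have := integral_map (μ := (Measure.pi μ).prod (Measure.pi μ)) hmp.measurable.aemeasurable
          hF.aestronglyMeasurable
        rw [hmp.map_eq] at this
        simpa only [hupd] using this
    _ = ∫ d, ∫ d', F (Function.update d i (d' i)) ∂(Measure.pi μ) ∂(Measure.pi μ) :=
        integral_prod _ hint'
    _ = ∫ d, ∫ x, F (Function.update d i x) ∂(μ i) ∂(Measure.pi μ) := by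
        refine integral_congr_ae (ae_of_all _ fun d => ?_)
        have hm : Measurable fun x => F (Function.update d i x) :=
          hF.comp (measurable_update d)
        have := integral_map (μ := Measure.pi μ) (measurable_pi_apply i).aemeasurable
          hm.aestronglyMeasurable
        rw [show Measure.map (fun f : ι → X => f i) (Measure.pi μ) = μ i from
          (measurePreserving_eval μ i).map_eq] at this
        exact this.symm

end Merge

/-! ### Fixing the seed and the treatment indicators. -/

section Conditioning

variable {𝓩 𝓤 Ω : Type*} [MeasurableSpace 𝓩] [MeasurableSpace 𝓤] [MeasurableSpace Ω]

/-- The law of `n` independent units with prescribed treatment indicators. -/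
def armPi {n : ℕ} (P : Measure (PotentialUnit 𝓩)) (t : Fin n → Bool) :
    Measure (Fin n → PotentialUnit 𝓩) := Measure.pi fun i => armLaw P (t i)

/-- The treatment indicators of a sample. -/
def trts {n : ℕ} (d : Fin n → PotentialUnit 𝓩) : Fin n → Bool := fun i => trt (d i)

@[fun_prop]
lemma measurable_trts {n : ℕ} : Measurable (trts : (Fin n → PotentialUnit 𝓩) → _) := by
  unfold trts; fun_prop

lemma measurableSet_trts {n : ℕ} (t : Fin n → Bool) :
    MeasurableSet {d : Fin n → PotentialUnit 𝓩 | trts d = t} :=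
  measurable_trts (measurableSet_singleton t)

/-- A bound valid conditionally on the treatment indicators is valid for the product law. -/
lemma measure_pi_le_of_armPi_le [StandardBorelSpace 𝓩] {P : Measure (PotentialUnit 𝓩)}
    [IsProbabilityMeasure P] {e m₀ : 𝓩 → ℝ} (h : IsPopulation P e m₀) {n : ℕ}
    {F : Set (Fin n → PotentialUnit 𝓩)} (hF : MeasurableSet F) {κ : ℝ≥0∞}
    (hκ : ∀ t, armPi P t ({d | trts d = t} ∩ F) ≤ κ) :
    Measure.pi (fun _ : Fin n => P) F ≤ κ := by
  have hprob := h.isProbabilityMeasure_armLaw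
  -- The weight c t is the probability of the treatment pattern t. The sample law restricted to that
  -- pattern is c t times `armPi P t`, so the i.i.d. law is a finite mixture of products of arm
  -- laws, and a bound uniform in t passes to it.
  let c : (Fin n → Bool) → ℝ≥0∞ := fun t => ∏ i, P {u | trt u = t i}
  have hres : ∀ t, (Measure.pi fun _ : Fin n => P).restrict {d | trts d = t} = c t • armPi P t := by
    intro t
    have hset : {d : Fin n → PotentialUnit 𝓩 | trts d = t} =
        Set.univ.pi fun i => {u | trt u = t i} := by
      ext d; simp [trts, funext_iff]
    rw [hset, Measure.restrict_pi_pi]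
    refine Measure.pi_eq fun s _ => ?_
    rw [Measure.smul_apply, armPi, Measure.pi_pi, smul_eq_mul, ← Finset.prod_mul_distrib]
    refine Finset.prod_congr rfl fun i _ => ?_
    have : P.restrict {u | trt u = t i} = P {u | trt u = t i} • armLaw P (t i) := by
      rw [armLaw, ProbabilityTheory.cond, smul_smul,
        ENNReal.mul_inv_cancel (h.measure_trt_ne_zero _) (measure_ne_top _ _), one_smul]
    rw [this, Measure.smul_apply, smul_eq_mul]
  have hsplit : ∀ G : Set (Fin n → PotentialUnit 𝓩), MeasurableSet G →
      Measure.pi (fun _ : Fin n => P) G = ∑ t, c t * armPi P t ({d | trts d = t} ∩ G) := by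
    intro G hG
    have hu : G = ⋃ t : Fin n → Bool, {d | trts d = t} ∩ G := by ext d; simp
    conv_lhs => rw [hu]
    rw [measure_iUnion (fun t t' htt => ?_) (fun t => (measurableSet_trts t).inter hG),
      tsum_fintype]
    · refine Finset.sum_congr rfl fun t _ => ?_
      rw [← smul_eq_mul, ← Measure.smul_apply, ← hres,
        Measure.restrict_apply ((measurableSet_trts t).inter hG)]
      congr 1; ext d; simp; tauto
    · rw [Function.onFun, Set.disjoint_left]
      rintro d ⟨h1, -⟩ ⟨h2, -⟩
      exact htt (h1.symm.trans h2)
  have hone : ∑ t, c t = 1 := by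
    have hpt : ∀ t, armPi P t {d | trts d = t} = 1 := fun t => by
      have : IsProbabilityMeasure (armPi P t) := by unfold armPi; infer_instance
      have hset : {d : Fin n → PotentialUnit 𝓩 | trts d = t} =
          Set.univ.pi fun i => {u | trt u = t i} := by
        ext d; simp [trts, funext_iff]
      rw [hset, armPi, Measure.pi_pi]
      refine Finset.prod_eq_one fun i _ => ?_
      exact (prob_compl_eq_zero_iff (measurableSet_trt _)).1 (ae_armLaw_trt P (t i))
    have := hsplit Set.univ .univ
    simpa [hpt] using this.symm
  calc Measure.pi (fun _ : Fin n => P) F = ∑ t, c t * armPi P t ({d | trts d = t} ∩ F) :=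
        hsplit F hF
    _ ≤ ∑ t, c t * κ := by gcongr with t; exact hκ t
    _ = κ := by rw [← Finset.sum_mul, hone, one_mul]

/-- The sampling assumptions at sample size `n`, transferred to the product space: a bound valid
conditionally on the seed and the treatment indicators is valid. -/
lemma measure_sample_le [StandardBorelSpace 𝓩] {μ : Measure Ω} [IsProbabilityMeasure μ]
    {P : Measure (PotentialUnit 𝓩)} [IsProbabilityMeasure P] {e m₀ : 𝓩 → ℝ}
    (h : IsPopulation P e m₀) {D : ℕ → Ω → PotentialUnit 𝓩} (hDmeas : ∀ i, Measurable (D i))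
    (hDindep : iIndepFun D μ) (hDlaw : ∀ i, μ.map (D i) = P) {n : ℕ} {U : Ω → 𝓤}
    (hU : Measurable U) (hUindep : IndepFun U (fun ω (i : Fin n) => D i ω) μ)
    {E : Set (𝓤 × (Fin n → PotentialUnit 𝓩))} (hE : MeasurableSet E) {κ : ℝ≥0∞}
    (hκ : ∀ u t, armPi P t ({d | trts d = t} ∩ {d | (u, d) ∈ E}) ≤ κ) :
    μ {ω | (U ω, fun i : Fin n => D i ω) ∈ E} ≤ κ := by
  have hDn : Measurable fun ω (i : Fin n) => D i ω := by fun_prop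
  have hlawD : μ.map (fun ω (i : Fin n) => D i ω) = Measure.pi fun _ : Fin n => P := by
    have h1 : iIndepFun (fun i : Fin n => D i) μ := hDindep.precomp Fin.val_injective
    rw [(iIndepFun_iff_map_fun_eq_pi_map (fun i : Fin n => (hDmeas i).aemeasurable)).1 h1]
    simp_rw [hDlaw]
  have hlaw := (indepFun_iff_map_prod_eq_prod_map_map hU.aemeasurable hDn.aemeasurable).1 hUindep
  rw [hlawD] at hlaw
  have : IsProbabilityMeasure (μ.map U) := Measure.isProbabilityMeasure_map hU.aemeasurable
  calc μ {ω | (U ω, fun i : Fin n => D i ω) ∈ E}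
      = μ.map (fun ω => (U ω, fun i : Fin n => D i ω)) E :=
        (Measure.map_apply (hU.prodMk hDn) hE).symm
    _ = ∫⁻ u, Measure.pi (fun _ : Fin n => P) (Prod.mk u ⁻¹' E) ∂(μ.map U) := by
        rw [hlaw, Measure.prod_apply hE]
    _ ≤ ∫⁻ _, κ ∂(μ.map U) := by
        refine lintegral_mono fun u => ?_
        exact measure_pi_le_of_armPi_le h (measurable_prodMk_left hE) (hκ u)
    _ = κ := by simp

/-- The observed sample of a sample of units. -/
def obsSample {n : ℕ} (d : Fin n → PotentialUnit 𝓩) : Fin n → ObservedUnit 𝓩 :=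
  fun i => observe (d i)

@[fun_prop]
lemma measurable_obsSample {n : ℕ} : Measurable (obsSample : (Fin n → PotentialUnit 𝓩) → _) := by
  unfold obsSample; fun_prop

/-- A bound on an event about fold `k`, valid for every fixed value of the selected set, is valid
for the set selected on the other fold. -/
lemma measure_fold_event_le [StandardBorelSpace 𝓩] {μ : Measure Ω} [IsProbabilityMeasure μ]
    {P : Measure (PotentialUnit 𝓩)} [IsProbabilityMeasure P] {e m₀ : 𝓩 → ℝ}
    (h : IsPopulation P e m₀) {D : ℕ → Ω → PotentialUnit 𝓩} (hDmeas : ∀ i, Measurable (D i))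
    (hDindep : iIndepFun D μ) (hDlaw : ∀ i, μ.map (D i) = P) {n p : ℕ} {U : Ω → 𝓤}
    (hU : Measurable U) (hUindep : IndepFun U (fun ω (i : Fin n) => D i ω) μ)
    (A : Procedure 𝓩 𝓤 n p) (k : Fin 2)
    (bad : (Fin n → Bool) → (Fin n → Fin 2) → Finset (Fin p) → Set (Fin n → PotentialUnit 𝓩))
    (hbad : ∀ t g S, MeasurableSet (bad t g S))
    (hdep : ∀ t g S d d', (∀ i, g i = k → d i = d' i) → d ∈ bad t g S → d' ∈ bad t g S)
    {κ : ℝ≥0∞} (hκ : ∀ t g S, armPi P t (bad t g S) ≤ κ) :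
    μ {ω | (fun i : Fin n => D i ω) ∈ bad (trts fun i : Fin n => D i ω)
      (A.labels (U ω) (sample D n ω)) (A.selected k (U ω) (sample D n ω))} ≤ κ := by
  have hprob := h.isProbabilityMeasure_armLaw
  let E : Set (𝓤 × (Fin n → PotentialUnit 𝓩)) :=
    {x | x.2 ∈ bad (trts x.2) (A.split.fold x.1 (trts x.2))
      ((A.rule k).select x.1 (A.split.fold x.1 (trts x.2)) (obsSample x.2))}
  have hsel : ∀ g S, MeasurableSet
      {x : 𝓤 × (Fin n → PotentialUnit 𝓩) | (A.rule k).select x.1 g (obsSample x.2) = S} :=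
    fun g S => (measurable_fst.prodMk (measurable_obsSample.comp measurable_snd))
      ((A.rule k).measurable_select g S)
  have hEeq : E = ⋃ t : Fin n → Bool, ⋃ g : Fin n → Fin 2, ⋃ S : Finset (Fin p),
      {x | trts x.2 = t} ∩ {x | A.split.fold x.1 t = g} ∩
        {x | (A.rule k).select x.1 g (obsSample x.2) = S} ∩ {x | x.2 ∈ bad t g S} := by
    ext x; simp [E]
  have hE : MeasurableSet E := by
    rw [hEeq]
    refine MeasurableSet.iUnion fun t => MeasurableSet.iUnion fun g => MeasurableSet.iUnion fun S =>
      (((measurable_snd (measurableSet_trts t)).inter ?_).inter (hsel g S)).inter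
        (measurable_snd (hbad t g S))
    exact (((A.split.measurable_fold t).comp measurable_fst) (measurableSet_singleton g))
  refine measure_sample_le h hDmeas hDindep hDlaw hU hUindep hE fun u t => ?_
  -- Once the seed and the treatments are fixed, the fold labels are deterministic; the selected set
  -- is the only remaining randomness in the index of the bad event.
  set g := A.split.fold u t with hg
  have : IsProbabilityMeasure (armPi P t) := by unfold armPi; infer_instance
  let sel : Finset (Fin p) → Set (Fin n → PotentialUnit 𝓩) := fun S =>
    {d | (A.rule k).select u g (obsSample d) = S}
  have hselm : ∀ S, MeasurableSet (sel S) := fun S => measurable_prodMk_left (hsel g S)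
  have hsub : {d | trts d = t} ∩ {d | (u, d) ∈ E} ⊆ ⋃ S, sel S ∩ bad t g S := by
    rintro d ⟨rfl, hd⟩
    exact Set.mem_iUnion.2 ⟨_, rfl, hd⟩
  calc armPi P t ({d | trts d = t} ∩ {d | (u, d) ∈ E})
      ≤ armPi P t (⋃ S, sel S ∩ bad t g S) := measure_mono hsub
    _ ≤ ∑ S, armPi P t (sel S ∩ bad t g S) := measure_iUnion_fintype_le _ _
    _ = ∑ S, armPi P t (sel S) * armPi P t (bad t g S) := by
        refine Finset.sum_congr rfl fun S _ => ?_
        -- Cross-fitting enters here: the selection depends on units outside fold k and the bad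
        -- event on units inside it, so the two are independent.
        refine measure_pi_inter_of_dependsOn _ (Finset.univ.filter fun i => g i ≠ k) (hselm S)
          (hbad t g S) (fun d d' hdd hd => ?_) (fun d d' hdd => hdep t g S d d' ?_)
        · refine Eq.trans ((A.rule k).select_otherFold u g _ _ fun i hi => ?_) hd
          rw [obsSample, obsSample, hdd i (by simpa using hi)]
        · intro i hi
          exact hdd i (by simpa using hi)
    _ ≤ ∑ S, armPi P t (sel S) * κ := by gcongr with S; exact hκ t g S
    _ = κ := by
        rw [← Finset.sum_mul]
        have : ∑ S, armPi P t (sel S) = 1 := by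
          have hdisj : Pairwise (Function.onFun Disjoint sel) := fun S S' hSS => by
            rw [Function.onFun, Set.disjoint_left]
            rintro d h1 h2
            exact hSS (h1.symm.trans h2)
          have huniv : ⋃ S, sel S = Set.univ := by ext d; simp [sel]
          rw [← measure_univ (μ := armPi P t), ← huniv, measure_iUnion hdisj hselm, tsum_fintype]
        rw [this, one_mul]

end Conditioning

/-! ### First and second moments of sums with fixed treatment indicators. -/

/-- Markov's inequality relative to the mean, valid also when the mean vanishes. -/
lemma measure_mul_integral_lt_le {α : Type*} [MeasurableSpace α] {ν : Measure α}
    [IsProbabilityMeasure ν] {f : α → ℝ} (hf : Integrable f ν) (hf0 : 0 ≤ᵐ[ν] f) {m A : ℝ}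
    (hm : ∫ x, f x ∂ν ≤ m) (hA : 0 < A) : ν {x | A * m < f x} ≤ ENNReal.ofReal (1 / A) := by
  have hi := integral_nonneg_of_ae hf0
  rcases (hi.trans hm).eq_or_lt with h0 | hpos
  · have hz : ∫ x, f x ∂ν = 0 := le_antisymm (h0 ▸ hm) hi
    have := (integral_eq_zero_iff_of_nonneg_ae hf0 hf).1 hz
    have hnull : ν {x | A * m < f x} = 0 := by
      rw [← h0, mul_zero]
      refine measure_mono_null (fun x (hx : 0 < f x) => ?_) (ae_iff.1 this)
      exact hx.ne'
    rw [hnull]; positivity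
  · have h1 := mul_meas_ge_le_integral_of_nonneg hf0 hf (A * m)
    have h2 : ν.real {x | A * m ≤ f x} ≤ 1 / A := by
      rw [le_div_iff₀ hA]
      nlinarith
    refine (measure_mono fun x (hx : A * m < f x) => hx.le :
      ν {x | A * m < f x} ≤ ν {x | A * m ≤ f x}).trans ?_
    rw [← ofReal_measureReal]
    exact ENNReal.ofReal_le_ofReal h2

namespace IsPopulation

variable {𝓩 : Type*} [MeasurableSpace 𝓩] [StandardBorelSpace 𝓩]
  {P : Measure (PotentialUnit 𝓩)} [IsProbabilityMeasure P] {e m₀ : 𝓩 → ℝ} {n : ℕ}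

lemma isProbabilityMeasure_armPi (h : IsPopulation P e m₀) (t : Fin n → Bool) :
    IsProbabilityMeasure (armPi P t) := by
  have := h.isProbabilityMeasure_armLaw
  unfold armPi; infer_instance

lemma measurePreserving_eval_armPi (h : IsPopulation P e m₀) (t : Fin n → Bool) (i : Fin n) :
    MeasurePreserving (fun d : Fin n → PotentialUnit 𝓩 => d i) (armPi P t) (armLaw P (t i)) :=
  have := h.isProbabilityMeasure_armLaw
  measurePreserving_eval _ i

lemma ae_armPi (h : IsPopulation P e m₀) (t : Fin n → Bool) {q : 𝓩 → Prop}
    (hq : ∀ᵐ z ∂(covLaw P), q z) : ∀ᵐ d ∂(armPi P t), ∀ i, q (d i).1 := by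
  rw [ae_all_iff]
  intro i
  have h1 : ∀ᵐ u ∂P, q u.1 := ae_of_ae_map measurable_fst.aemeasurable hq
  have h2 : ∀ᵐ u ∂(armLaw P (t i)), q u.1 := (armLaw_absolutelyContinuous P _).ae_le h1
  exact (h.measurePreserving_eval_armPi t i).quasiMeasurePreserving.ae h2

/-- Markov's inequality for a sum of nonnegative functions of the covariates over one arm. -/
lemma armPi_sum_lt_le (h : IsPopulation P e m₀) (t : Fin n → Bool) {b : Bool} {I : Finset (Fin n)}
    (hI : ∀ i ∈ I, t i = b) {f : PotentialUnit 𝓩 → ℝ} (hf0 : ∀ u, 0 ≤ f u)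
    (hf : Integrable f (armLaw P b)) {A : ℝ} (hA : 0 < A) :
    armPi P t {d | A * (I.card * ∫ u, f u ∂(armLaw P b)) < ∑ i ∈ I, f (d i)} ≤
      ENNReal.ofReal (1 / A) := by
  have := h.isProbabilityMeasure_armPi t
  have hint : ∀ i ∈ I, Integrable (fun d : Fin n → PotentialUnit 𝓩 => f (d i)) (armPi P t) :=
    fun i hi => (h.measurePreserving_eval_armPi t i).integrable_comp_of_integrable
      (by rw [hI i hi]; exact hf)
  refine measure_mul_integral_lt_le (integrable_finsetSum _ hint)
    (ae_of_all _ fun d => Finset.sum_nonneg fun i _ => hf0 _) (le_of_eq ?_) hA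
  rw [integral_finsetSum _ hint, ← nsmul_eq_mul, ← Finset.sum_const]
  refine Finset.sum_congr rfl fun i hi => ?_
  have hmp := h.measurePreserving_eval_armPi t i
  rw [← hI i hi, ← hmp.map_eq, integral_map hmp.measurable.aemeasurable]
  rw [hmp.map_eq, hI i hi]; exact hf.1

/-- The second moment of a centred sum of independent terms. -/
lemma integral_sq_sum_armPi_le (h : IsPopulation P e m₀) (t : Fin n → Bool)
    {X : Fin n → PotentialUnit 𝓩 → ℝ} (hX : ∀ i, MemLp (X i) 2 (armLaw P (t i)))
    (h0 : ∑ i, ∫ u, X i u ∂(armLaw P (t i)) = 0) :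
    Integrable (fun d => (∑ i, X i (d i)) ^ 2) (armPi P t) ∧
    ∫ d, (∑ i, X i (d i)) ^ 2 ∂(armPi P t) ≤ ∑ i, ∫ u, X i u ^ 2 ∂(armLaw P (t i)) := by
  have := h.isProbabilityMeasure_armLaw
  have := h.isProbabilityMeasure_armPi t
  have hmem : ∀ i, MemLp (fun d : Fin n → PotentialUnit 𝓩 => X i (d i)) 2 (armPi P t) := fun i =>
    (hX i).comp_measurePreserving (h.measurePreserving_eval_armPi t i)
  have hsum : MemLp (∑ i, fun d : Fin n → PotentialUnit 𝓩 => X i (d i)) 2 (armPi P t) :=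
    memLp_finsetSum' _ fun i _ => hmem i
  have hmean : ∫ d, (∑ i, fun d : Fin n → PotentialUnit 𝓩 => X i (d i)) d ∂(armPi P t) = 0 := by
    simp_rw [Finset.sum_apply]
    rw [integral_finsetSum _ fun i _ => (hmem i).integrable (by norm_num), ← h0]
    refine Finset.sum_congr rfl fun i _ => ?_
    have hmp := h.measurePreserving_eval_armPi t i
    rw [← hmp.map_eq, integral_map hmp.measurable.aemeasurable]
    rw [hmp.map_eq]; exact (hX i).1
  have hfun : (fun d : Fin n → PotentialUnit 𝓩 => (∑ i, X i (d i)) ^ 2) =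
      fun d => (∑ i, fun d : Fin n → PotentialUnit 𝓩 => X i (d i)) d ^ 2 := by
    ext d; rw [Finset.sum_apply]
  refine ⟨by rw [hfun]; exact hsum.integrable_sq, ?_⟩
  -- Only the total mean is zero, not each term's mean. Variances add by independence, and each is
  -- at most the second moment of its term.
  calc ∫ d, (∑ i, X i (d i)) ^ 2 ∂(armPi P t)
      = Var[∑ i, fun d : Fin n → PotentialUnit 𝓩 => X i (d i); armPi P t] := by
        rw [hfun, variance_of_integral_eq_zero hsum.1.aemeasurable hmean]
    _ = ∑ i, Var[X i; armLaw P (t i)] := variance_sum_pi hX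
    _ ≤ ∑ i, ∫ u, X i u ^ 2 ∂(armLaw P (t i)) := by
        gcongr with i
        simpa using variance_le_expectation_sq (hX i).1

lemma memLp_resid (h : IsPopulation P e m₀)
    (hresid : Integrable (fun u => (y0 u - m₀ u.1) ^ 2) P) :
    MemLp (fun u => y0 u - m₀ u.1) 2 P := by
  have := h.measurable_m
  exact (memLp_two_iff_integrable_sq (Measurable.aestronglyMeasurable (by fun_prop))).2 hresid

lemma nonneg_of_condVar_le (_h : IsPopulation P e m₀) {M₁ : ℝ}
    (hM₁ : ∀ᵐ u ∂P, (P[fun u => (y0 u - m₀ u.1) ^ 2 | covAlg 𝓩]) u ≤ M₁) : 0 ≤ M₁ := by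
  have h0 : 0 ≤ᵐ[P] P[fun u => (y0 u - m₀ u.1) ^ 2 | covAlg 𝓩] :=
    condExp_nonneg (ae_of_all _ fun u => sq_nonneg _)
  obtain ⟨u, h1, h2⟩ := (hM₁.and h0).exists
  exact le_trans h2 h1

/-- The second moment of a weighted sum of outcome residuals, when the weights do not depend on the
outcomes of the units they are attached to. -/
lemma integral_sq_sum_resid_le (h : IsPopulation P e m₀) {M₁ : ℝ}
    (hresid : Integrable (fun u => (y0 u - m₀ u.1) ^ 2) P)
    (hM₁ : ∀ᵐ u ∂P, (P[fun u => (y0 u - m₀ u.1) ^ 2 | covAlg 𝓩]) u ≤ M₁)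
    (t : Fin n → Bool) (I : Finset (Fin n)) {a : Fin n → (Fin n → PotentialUnit 𝓩) → ℝ}
    (ha : ∀ i, Measurable (a i)) {B : ℝ} (hB : ∀ d, ∑ i ∈ I, a i d ^ 2 ≤ B)
    (hdep : ∀ i ∈ I, ∀ j ∈ I, ∀ d x x', x.1 = x'.1 →
      a j (Function.update d i x) = a j (Function.update d i x')) :
    Integrable (fun d => (∑ i ∈ I, a i d * (y0 (d i) - m₀ (d i).1)) ^ 2) (armPi P t) ∧
    ∫ d, (∑ i ∈ I, a i d * (y0 (d i) - m₀ (d i).1)) ^ 2 ∂(armPi P t) ≤ M₁ * B := by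
  have := h.isProbabilityMeasure_armLaw
  have hprob := h.isProbabilityMeasure_armPi t
  have hm := h.measurable_m
  have hM0 := h.nonneg_of_condVar_le hM₁
  obtain ⟨d₀, -⟩ : ∃ d₀ : Fin n → PotentialUnit 𝓩, True := by
    obtain ⟨d₀⟩ := (armPi P t).nonempty_of_neZero
    exact ⟨d₀, trivial⟩
  have hB0 : 0 ≤ B := (Finset.sum_nonneg fun i _ => sq_nonneg _).trans (hB d₀)
  have hab : ∀ i ∈ I, ∀ d, |a i d| ≤ Real.sqrt B := fun i hi d => by
    refine Real.abs_le_sqrt ?_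
    exact (Finset.single_le_sum (f := fun i => a i d ^ 2) (fun i _ => sq_nonneg _) hi).trans (hB d)
  have hε : ∀ i, MemLp (fun d : Fin n → PotentialUnit 𝓩 => y0 (d i) - m₀ (d i).1) 2 (armPi P t) :=
    fun i => (h.memLp_armLaw (t i) (h.memLp_resid hresid)).comp_measurePreserving
      (h.measurePreserving_eval_armPi t i)
  have haε : ∀ i ∈ I, MemLp (fun d => a i d * (y0 (d i) - m₀ (d i).1)) 2 (armPi P t) :=
    fun i hi => (hε i).of_le_mul (c := Real.sqrt B)
      (Measurable.aestronglyMeasurable (by have := ha i; fun_prop))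
      (ae_of_all _ fun d => by rw [norm_mul]; gcongr; exact hab i hi d)
  -- Integrate over unit i alone. Both weights depend on it only through its covariates and the
  -- residual of unit j not at all, so the residual of unit i averages to zero.
  have hcross : ∀ i ∈ I, ∀ j ∈ I, i ≠ j →
      ∫ d, (a i d * (y0 (d i) - m₀ (d i).1)) * (a j d * (y0 (d j) - m₀ (d j).1)) ∂(armPi P t) = 0 := by
    intro i hi j hj hij
    have hmi := ha i
    have hmj := ha j
    have hint : Integrable (fun d : Fin n → PotentialUnit 𝓩 =>
        (a i d * (y0 (d i) - m₀ (d i).1)) * (a j d * (y0 (d j) - m₀ (d j).1))) (armPi P t) :=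
      MemLp.integrable_mul (haε i hi) (haε j hj)
    refine (integral_pi_eq_integral_update _ i (by fun_prop) hint).trans ?_
    refine integral_eq_zero_of_ae (ae_of_all _ fun d => ?_)
    -- A unit with the given covariates and dummy treatment and outcomes. By `hdep`, inserting it
    -- leaves the weights unchanged, which exhibits them as functions of z only.
    let z0 : 𝓩 → PotentialUnit 𝓩 := fun z => (z, false, 0, 0)
    have hz0 : Measurable z0 := by fun_prop
    have hupd : Measurable fun z => Function.update d i (z0 z) := (measurable_update d).comp hz0
    have h1 : ∀ x, a i (Function.update d i x) = a i (Function.update d i (z0 x.1)) := fun x =>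
      hdep i hi i hi d x _ rfl
    have h2 : ∀ x, a j (Function.update d i x) = a j (Function.update d i (z0 x.1)) := fun x =>
      hdep i hi j hj d x _ rfl
    have key := h.integral_armLaw_mul_resid (t i)
      (g := fun z => a i (Function.update d i (z0 z)) * a j (Function.update d i (z0 z)))
      ((hmi.comp hupd).mul (hmj.comp hupd)) (C := Real.sqrt B * Real.sqrt B) (fun z => by
        rw [abs_mul]; gcongr
        · exact hab i hi _
        · exact hab j hj _)
    simp only [Pi.zero_apply]
    rw [← zero_mul (y0 (d j) - m₀ (d j).1), ← key, ← integral_mul_const]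
    refine integral_congr_ae (ae_of_all _ fun x => ?_)
    simp only [Function.update_self, Function.update_of_ne hij.symm]
    rw [h1 x, h2 x]; ring
  have hdiag : ∀ i ∈ I, ∫ d, (a i d * (y0 (d i) - m₀ (d i).1)) ^ 2 ∂(armPi P t) ≤
      M₁ * ∫ d, a i d ^ 2 ∂(armPi P t) := by
    intro i hi
    have hmi := ha i
    have hai : Integrable (fun d => a i d ^ 2) (armPi P t) :=
      Integrable.of_bound (Measurable.aestronglyMeasurable (by fun_prop)) (Real.sqrt B ^ 2)
        (ae_of_all _ fun d => by rw [norm_pow]; gcongr; exact hab i hi d)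
    have e1 := integral_pi_eq_integral_update (fun i => armLaw P (t i)) i
      (F := fun d => (a i d * (y0 (d i) - m₀ (d i).1)) ^ 2) (by fun_prop) (haε i hi).integrable_sq
    have e2 := integral_pi_eq_integral_update (fun i => armLaw P (t i)) i
      (F := fun d => a i d ^ 2) (by fun_prop) hai
    have hupd : Measurable fun x : (Fin n → PotentialUnit 𝓩) × PotentialUnit 𝓩 =>
        Function.update x.1 i x.2 := by
      refine measurable_pi_lambda _ fun j => ?_
      by_cases hj : j = i
      · subst hj; simpa using measurable_snd
      · simp only [Function.update_of_ne hj]; fun_prop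
    change ∫ d, _ ∂(Measure.pi fun i => armLaw P (t i)) ≤
      M₁ * ∫ d, _ ∂(Measure.pi fun i => armLaw P (t i))
    rw [e1, e2, ← integral_const_mul]
    refine integral_mono_of_nonneg (ae_of_all _ fun d => integral_nonneg fun x => sq_nonneg _)
      (Integrable.const_mul ?_ _) (ae_of_all _ fun d => ?_)
    · refine Integrable.of_bound (C := Real.sqrt B ^ 2) ?_ (ae_of_all _ fun d => ?_)
      · refine StronglyMeasurable.aestronglyMeasurable ?_
        refine StronglyMeasurable.integral_prod_right'
          (f := fun (x : (Fin n → PotentialUnit 𝓩) × PotentialUnit 𝓩) =>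
            a i (Function.update x.1 i x.2) ^ 2) ?_
        exact ((hmi.comp hupd).pow_const 2).stronglyMeasurable
      · refine (norm_integral_le_of_norm_le_const (C := Real.sqrt B ^ 2)
          (ae_of_all _ fun x => ?_)).trans (by simp)
        rw [norm_pow]; gcongr; exact hab i hi _
    · let z0 : 𝓩 → PotentialUnit 𝓩 := fun z => (z, false, 0, 0)
      have hz0 : Measurable z0 := by fun_prop
      have hupd' : Measurable fun z => Function.update d i (z0 z) := (measurable_update d).comp hz0
      have h1 : ∀ x, a i (Function.update d i x) = a i (Function.update d i (z0 x.1)) := fun x =>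
        hdep i hi i hi d x _ rfl
      have key := h.integral_armLaw_mul_sq_resid_le (t i) hresid hM₁
        (g := fun z => a i (Function.update d i (z0 z)) ^ 2)
        ((hmi.comp hupd').pow_const 2) (C := Real.sqrt B ^ 2)
        (fun z => by rw [abs_pow]; gcongr; exact hab i hi _) (fun z => sq_nonneg _)
      have e1 : ∀ x, (a i (Function.update d i x) *
          (y0 (Function.update d i x i) - m₀ (Function.update d i x i).1)) ^ 2 =
          a i (Function.update d i (z0 x.1)) ^ 2 * (y0 x - m₀ x.1) ^ 2 := fun x => by
        rw [Function.update_self, h1 x, mul_pow]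
      have e2 : ∀ x, a i (Function.update d i x) ^ 2 =
          a i (Function.update d i (z0 x.1)) ^ 2 := fun x => by rw [h1 x]
      beta_reduce
      rw [integral_congr_ae (ae_of_all _ e1), integral_congr_ae (ae_of_all _ e2)]
      exact key
  have hexp : ∀ d : Fin n → PotentialUnit 𝓩, (∑ i ∈ I, a i d * (y0 (d i) - m₀ (d i).1)) ^ 2 =
      ∑ i ∈ I, ∑ j ∈ I, (a i d * (y0 (d i) - m₀ (d i).1)) * (a j d * (y0 (d j) - m₀ (d j).1)) :=
    fun d => by rw [sq, Finset.sum_mul_sum]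
  have hij : ∀ i ∈ I, ∀ j ∈ I, Integrable (fun d : Fin n → PotentialUnit 𝓩 =>
      (a i d * (y0 (d i) - m₀ (d i).1)) * (a j d * (y0 (d j) - m₀ (d j).1))) (armPi P t) :=
    fun i hi j hj => MemLp.integrable_mul (haε i hi) (haε j hj)
  simp_rw [hexp]
  refine ⟨integrable_finsetSum _ fun i hi => integrable_finsetSum _ fun j hj => hij i hi j hj, ?_⟩
  rw [integral_finsetSum _ fun i hi => integrable_finsetSum _ fun j hj => hij i hi j hj]
  calc ∑ i ∈ I, ∫ d, ∑ j ∈ I, (a i d * (y0 (d i) - m₀ (d i).1)) *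
        (a j d * (y0 (d j) - m₀ (d j).1)) ∂(armPi P t)
      = ∑ i ∈ I, ∫ d, (a i d * (y0 (d i) - m₀ (d i).1)) ^ 2 ∂(armPi P t) := by
        refine Finset.sum_congr rfl fun i hi => ?_
        rw [integral_finsetSum _ fun j hj => hij i hi j hj,
          Finset.sum_eq_single_of_mem i hi fun j hj hji => hcross i hi j hj hji.symm]
        simp_rw [sq]
    _ ≤ ∑ i ∈ I, M₁ * ∫ d, a i d ^ 2 ∂(armPi P t) := Finset.sum_le_sum hdiag
    _ = M₁ * ∫ d, ∑ i ∈ I, a i d ^ 2 ∂(armPi P t) := by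
        rw [← Finset.mul_sum, integral_finsetSum]
        intro i hi
        exact Integrable.of_bound (Measurable.aestronglyMeasurable (by have := ha i; fun_prop))
          (Real.sqrt B ^ 2) (ae_of_all _ fun d => by rw [norm_pow]; gcongr; exact hab i hi d)
    _ ≤ M₁ * B := by
        gcongr
        calc ∫ d, ∑ i ∈ I, a i d ^ 2 ∂(armPi P t) ≤ ∫ _, B ∂(armPi P t) :=
              integral_mono_of_nonneg (ae_of_all _ fun d => Finset.sum_nonneg fun i _ => sq_nonneg _)
                (integrable_const _) (ae_of_all _ hB)
          _ = B := by simp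

end IsPopulation

/-! ### Sub-Gaussian bounds on each arm. -/

/-- Second-order Taylor remainder of the exponential, with the factor v² absorbed into 2e^{|v|}. For
a centred variable the linear term integrates away and a bound 1 + O(s²) remains, as needed for
small s. -/
lemma exp_mul_le_quadratic {s v : ℝ} (hs : |s| ≤ 1) :
    Real.exp (s * v) ≤ 1 + s * v + 2 * s ^ 2 * Real.exp (2 * |v|) := by
  have h1 : |Real.exp (s * v) - (1 + s * v)| ≤ |s * v| ^ 2 * Real.exp |s * v| := by
    have := Complex.norm_exp_sub_sum_le_norm_mul_exp ((s * v : ℝ) : ℂ) 2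
    simp only [Finset.sum_range_succ, Finset.sum_range_zero, pow_zero, Nat.factorial, pow_one,
      Nat.cast_one, div_one, zero_add, mul_one] at this
    rw [← Complex.ofReal_exp, Complex.norm_real, Real.norm_eq_abs] at this
    have h2 : ((Real.exp (s * v) : ℂ) - (1 + ((s * v : ℝ) : ℂ))) =
        ((Real.exp (s * v) - (1 + s * v) : ℝ) : ℂ) := by push_cast; ring
    rw [h2, Complex.norm_real, Real.norm_eq_abs] at this
    exact this
  have h3 : |s * v| ≤ |v| := by
    rw [abs_mul]; nlinarith [abs_nonneg v]
  have h4 : |v| ^ 2 ≤ 2 * Real.exp |v| := by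
    have := Real.quadratic_le_exp_of_nonneg (abs_nonneg v)
    nlinarith [abs_nonneg v]
  have h5 : |s * v| ^ 2 * Real.exp |s * v| ≤ 2 * s ^ 2 * Real.exp (2 * |v|) := by
    calc |s * v| ^ 2 * Real.exp |s * v| = s ^ 2 * (|v| ^ 2 * Real.exp |s * v|) := by
          rw [abs_mul, mul_pow, sq_abs]; ring
      _ ≤ s ^ 2 * (2 * Real.exp |v| * Real.exp |v|) := by gcongr
      _ = 2 * s ^ 2 * Real.exp (2 * |v|) := by
          rw [two_mul |v|, Real.exp_add]; ring
  linarith [(abs_le.1 h1).2]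

/-- A random variable with Gaussian-type exponential moments is sub-Gaussian after centring. -/
lemma hasSubgaussianMGF_of_exp_growth {α : Type*} [MeasurableSpace α] {ν : Measure α}
    [IsProbabilityMeasure ν] {V : α → ℝ} (hV : Measurable V) {K : ℝ} (hK : 1 ≤ K)
    (hint : ∀ s : ℝ, 0 ≤ s → Integrable (fun x => Real.exp (s * |V x|)) ν)
    (hle : ∀ s : ℝ, 0 ≤ s → ∫ x, Real.exp (s * |V x|) ∂ν ≤ K * Real.exp (K * s ^ 2)) :
    let L := K + K * Real.exp K
    let K' := K * Real.exp (K * Real.exp K)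
    HasSubgaussianMGF (fun x => V x - ∫ y, V y ∂ν)
      (Real.toNNReal (2 * (Real.log K' + L + 2 * K' * Real.exp (4 * L)))) ν := by
  intro L K'
  set m := ∫ y, V y ∂ν with hm
  have hVint : Integrable V ν := by
    refine (hint 1 zero_le_one).mono' hV.aestronglyMeasurable (ae_of_all _ fun x => ?_)
    rw [Real.norm_eq_abs, one_mul]
    linarith [Real.add_one_le_exp |V x|]
  have hmK : |m| ≤ K * Real.exp K := by
    calc |m| ≤ ∫ x, |V x| ∂ν := abs_integral_le_integral_abs
      _ ≤ ∫ x, Real.exp (1 * |V x|) ∂ν := by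
          refine integral_mono hVint.abs (hint 1 zero_le_one) fun x => ?_
          rw [one_mul]
          linarith [Real.add_one_le_exp |V x|]
      _ ≤ K * Real.exp K := by simpa using hle 1 zero_le_one
  have hK' : 1 ≤ K' := by
    have : 1 ≤ Real.exp (K * Real.exp K) := Real.one_le_exp (by positivity)
    nlinarith
  have hL : 0 ≤ L := by positivity
  have hbound : ∀ s : ℝ, 0 ≤ s → ∀ x,
      Real.exp (s * |V x - m|) ≤ Real.exp (s * |m|) * Real.exp (s * |V x|) := fun s hs x => by
    rw [← Real.exp_add, Real.exp_le_exp, ← mul_add]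
    gcongr
    rw [add_comm]; exact abs_sub _ _
  have hint' : ∀ s : ℝ, 0 ≤ s → Integrable (fun x => Real.exp (s * |V x - m|)) ν := fun s hs => by
    refine ((hint s hs).const_mul (Real.exp (s * |m|))).mono'
      (Measurable.aestronglyMeasurable (by fun_prop)) (ae_of_all _ fun x => ?_)
    rw [Real.norm_eq_abs, Real.abs_exp]
    exact hbound s hs x
  have hle' : ∀ s : ℝ, 0 ≤ s →
      ∫ x, Real.exp (s * |V x - m|) ∂ν ≤ K' * Real.exp (L * s ^ 2) := fun s hs => by
    calc ∫ x, Real.exp (s * |V x - m|) ∂ν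
        ≤ ∫ x, Real.exp (s * |m|) * Real.exp (s * |V x|) ∂ν :=
          integral_mono (hint' s hs) ((hint s hs).const_mul _) (hbound s hs)
      _ = Real.exp (s * |m|) * ∫ x, Real.exp (s * |V x|) ∂ν := integral_const_mul _ _
      _ ≤ Real.exp ((1 + s ^ 2) * (K * Real.exp K)) * (K * Real.exp (K * s ^ 2)) := by
          -- Centring costs a factor e^{s|m|}, linear in s in the exponent. The inequality s ≤ 1 +
          -- s² splits it into a constant, which goes into K', and a quadratic rate, which goes into
          -- L.
          have hs1 : s ≤ 1 + s ^ 2 := by nlinarith [sq_nonneg (s - 1)]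
          have hsm : s * |m| ≤ (1 + s ^ 2) * (K * Real.exp K) :=
            mul_le_mul hs1 hmK (abs_nonneg m) (by positivity)
          exact mul_le_mul (Real.exp_le_exp.2 hsm) (hle s hs)
            (integral_nonneg fun x => (Real.exp_pos (s * |V x|)).le) (Real.exp_pos _).le
      _ = K' * Real.exp (L * s ^ 2) := by
          simp only [K', L]
          rw [mul_left_comm, ← Real.exp_add, mul_assoc, ← Real.exp_add]
          ring_nf
  have hintexp : ∀ s : ℝ, Integrable (fun x => Real.exp (s * (V x - m))) ν := fun s => by
    refine (hint' |s| (abs_nonneg s)).mono' (Measurable.aestronglyMeasurable (by fun_prop))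
      (ae_of_all _ fun x => ?_)
    rw [Real.norm_eq_abs, Real.abs_exp, Real.exp_le_exp, ← abs_mul]
    exact le_abs_self _
  have hlogK : 0 ≤ Real.log K' := Real.log_nonneg hK'
  refine ⟨hintexp, fun s => ?_⟩
  rw [Real.coe_toNNReal _ (by positivity), mgf]
  have hexponent : 2 * (Real.log K' + L + 2 * K' * Real.exp (4 * L)) * s ^ 2 / 2 =
      (Real.log K' + L + 2 * K' * Real.exp (4 * L)) * s ^ 2 := by ring
  rw [hexponent]
  have hE : 0 ≤ 2 * K' * Real.exp (4 * L) := by positivity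
  -- For |s| ≤ 1 the mean-zero Taylor bound applies. For |s| ≥ 1 the prefactor is harmless, since
  -- log K' ≤ s² log K'.
  rcases le_total |s| 1 with h1 | h1
  · have hi0 : Integrable (fun x => V x - m) ν := hVint.sub (integrable_const _)
    have hz : ∫ x, (V x - m) ∂ν = 0 := by
      rw [integral_sub hVint (integrable_const _)]; simp [hm]
    calc ∫ x, Real.exp (s * (V x - m)) ∂ν
        ≤ ∫ x, (1 + s * (V x - m) + 2 * s ^ 2 * Real.exp (2 * |V x - m|)) ∂ν :=
          integral_mono (hintexp s) (((integrable_const 1).add (hi0.const_mul s)).add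
            ((hint' 2 zero_le_two).const_mul _)) fun x => exp_mul_le_quadratic h1
      _ = 1 + 2 * s ^ 2 * ∫ x, Real.exp (2 * |V x - m|) ∂ν := by
          have e1 : ∫ x, (1 + s * (V x - m)) ∂ν = 1 := by
            rw [integral_add (integrable_const 1) (hi0.const_mul s), integral_const_mul, hz]; simp
          refine (integral_add ((integrable_const 1).add (hi0.const_mul s))
            ((hint' 2 zero_le_two).const_mul _)).trans ?_
          rw [integral_const_mul]
          exact congrArg (· + _) e1
      _ ≤ 1 + 2 * s ^ 2 * (K' * Real.exp (L * 2 ^ 2)) := by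
          gcongr; exact hle' 2 zero_le_two
      _ = 2 * K' * Real.exp (4 * L) * s ^ 2 + 1 := by ring_nf
      _ ≤ Real.exp (2 * K' * Real.exp (4 * L) * s ^ 2) := Real.add_one_le_exp _
      _ ≤ _ := by
          rw [Real.exp_le_exp]
          gcongr
          linarith
  · have hs2 : 1 ≤ s ^ 2 := by rw [← sq_abs]; nlinarith
    calc ∫ x, Real.exp (s * (V x - m)) ∂ν ≤ ∫ x, Real.exp (|s| * |V x - m|) ∂ν :=
          integral_mono (hintexp s) (hint' |s| (abs_nonneg s)) fun x => by
            rw [Real.exp_le_exp, ← abs_mul]; exact le_abs_self _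
      _ ≤ K' * Real.exp (L * |s| ^ 2) := hle' _ (abs_nonneg s)
      _ = Real.exp (Real.log K' + L * s ^ 2) := by
          rw [Real.exp_add, Real.exp_log (by linarith), sq_abs]
      _ ≤ _ := by
          rw [Real.exp_le_exp]
          nlinarith

/-- Use e^{s|f|} ≤ e^{sf} + e^{−sf}, the sub-Gaussian bound for f minus its mean, and |mean| ≤ B.
Bounds on e^{s|f|} are preferred because, unlike sub-Gaussianity, they survive multiplication by
bounded functions and a change of law of bounded density. -/
lemma integral_exp_abs_le {𝓩 : Type*} [MeasurableSpace 𝓩] {ν : Measure 𝓩} {f : 𝓩 → ℝ} {c : ℝ≥0} {B : ℝ}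
    (hf : Measurable f) (hB : |∫ z, f z ∂ν| ≤ B)
    (hsub : HasSubgaussianMGF (fun z => f z - ∫ z', f z' ∂ν) c ν) {s : ℝ} (hs : 0 ≤ s) :
    Integrable (fun z => Real.exp (s * |f z|)) ν ∧
      ∫ z, Real.exp (s * |f z|) ∂ν ≤ 2 * Real.exp (s * B + c * s ^ 2 / 2) := by
  set m := ∫ z, f z ∂ν with hm
  have hone : ∀ r : ℝ, |r| = s → Integrable (fun z => Real.exp (r * f z)) ν ∧
      ∫ z, Real.exp (r * f z) ∂ν ≤ Real.exp (s * B + c * s ^ 2 / 2) := by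
    intro r hr
    have heq : (fun z => Real.exp (r * f z)) =
        fun z => Real.exp (r * m) * Real.exp (r * (f z - m)) := by
      ext z; rw [← Real.exp_add]; ring_nf
    rw [heq]
    refine ⟨(hsub.integrable_exp_mul r).const_mul _, ?_⟩
    rw [integral_const_mul, Real.exp_add]
    have h1 : r * m ≤ s * B := by
      calc r * m ≤ |r * m| := le_abs_self _
        _ = s * |m| := by rw [abs_mul, hr]
        _ ≤ s * B := by gcongr
    have h2 := hsub.mgf_le r
    rw [← sq_abs, hr] at h2
    exact mul_le_mul (Real.exp_le_exp.2 h1) h2 (integral_nonneg fun _ => (Real.exp_pos _).le)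
      (Real.exp_pos _).le
  obtain ⟨i1, l1⟩ := hone s (abs_of_nonneg hs)
  obtain ⟨i2, l2⟩ := hone (-s) (by rw [abs_neg, abs_of_nonneg hs])
  have hpt : ∀ z, Real.exp (s * |f z|) ≤ Real.exp (s * f z) + Real.exp (-s * f z) := fun z => by
    rcases abs_cases (f z) with ⟨h, -⟩ | ⟨h, -⟩
    · rw [h]; linarith [Real.exp_pos (-s * f z)]
    · rw [h, mul_neg, ← neg_mul]; linarith [Real.exp_pos (s * f z)]
  have hi : Integrable (fun z => Real.exp (s * |f z|)) ν := by
    refine (i1.add i2).mono' (Measurable.aestronglyMeasurable (by fun_prop))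
      (ae_of_all _ fun z => ?_)
    rw [Real.norm_eq_abs, Real.abs_exp]; exact hpt z
  refine ⟨hi, ?_⟩
  calc ∫ z, Real.exp (s * |f z|) ∂ν ≤ ∫ z, (Real.exp (s * f z) + Real.exp (-s * f z)) ∂ν :=
        integral_mono hi (i1.add i2) hpt
    _ = _ := integral_add i1 i2
    _ ≤ _ := by linarith

namespace IsPopulation

variable {𝓩 : Type*} [MeasurableSpace 𝓩] [StandardBorelSpace 𝓩]
  {P : Measure (PotentialUnit 𝓩)} [IsProbabilityMeasure P] {e m₀ : 𝓩 → ℝ} {n : ℕ}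

/-- Products of uniformly sub-Gaussian features and bounded multipliers are uniformly sub-Gaussian
on each arm. -/
lemma exists_hasSubgaussianMGF_arm (h : IsPopulation P e m₀) (c : ℝ≥0) (B L : ℝ) :
    ∃ C : ℝ≥0, 0 < C ∧ ∀ (f l : 𝓩 → ℝ) (b : Bool), Measurable f → Measurable l →
      |∫ z, f z ∂(covLaw P)| ≤ B →
      HasSubgaussianMGF (fun z => f z - ∫ z', f z' ∂(covLaw P)) c (covLaw P) →
      (∀ᵐ z ∂(covLaw P), |l z| ≤ L) →
      HasSubgaussianMGF (fun u : PotentialUnit 𝓩 =>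
        l u.1 * f u.1 - ∫ u, l u.1 * f u.1 ∂(armLaw P b)) C (armLaw P b) := by
  have hp := h.treatProb_mem
  have hprob := h.isProbabilityMeasure_armLaw
  -- A common bound for the densities of both arm laws relative to P.
  let q : ℝ := (armProb true (treatProb P))⁻¹ + (armProb false (treatProb P))⁻¹
  have hpos := fun b => armProb_pos hp b
  have hq : ∀ b, (armProb b (treatProb P))⁻¹ ≤ q := fun b => by
    have := hpos true
    have := hpos false
    cases b
    · exact le_add_of_nonneg_left (by positivity)
    · exact le_add_of_nonneg_right (by positivity)
  have hq0 : 0 ≤ q := (inv_nonneg.2 (hpos true).le).trans (hq true)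
  -- One constant at least 1 that dominates both the prefactor 2q e^{|L||B|} and the Gaussian rate
  -- |L||B| + cL²/2 arising below. It does not depend on the feature or the multiplier, which makes
  -- the conclusion uniform.
  let K : ℝ := 1 + 2 * q * Real.exp (|L| * |B|) + (|L| * |B| + c * |L| ^ 2 / 2)
  have hK1 : 1 ≤ K := by
    have : 0 ≤ 2 * q * Real.exp (|L| * |B|) + (|L| * |B| + c * |L| ^ 2 / 2) := by positivity
    simp only [K]; linarith
  have hKa : 2 * q * Real.exp (|L| * |B|) ≤ K := by
    have : 0 ≤ |L| * |B| + c * |L| ^ 2 / 2 := by positivity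
    simp only [K]; linarith
  have hKb : |L| * |B| + c * |L| ^ 2 / 2 ≤ K := by
    have : 0 ≤ 2 * q * Real.exp (|L| * |B|) := by positivity
    simp only [K]; linarith
  refine ⟨_, ?_, fun f l b hf hl hB hsub hlL => hasSubgaussianMGF_of_exp_growth
    (V := fun u : PotentialUnit 𝓩 => l u.1 * f u.1) (by fun_prop) hK1 ?_ ?_⟩
  · rw [Real.toNNReal_pos]
    have h1 : 1 ≤ K * Real.exp (K * Real.exp K) := by
      have : 1 ≤ Real.exp (K * Real.exp K) := Real.one_le_exp (by positivity)
      nlinarith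
    have := Real.log_nonneg h1
    positivity
  all_goals
    intro s hs
    have hint := integral_exp_abs_le hf (hB.trans (le_abs_self B)) hsub
      (mul_nonneg hs (abs_nonneg L))
    have hmeas : Measurable fun z => Real.exp (s * |L| * |f z|) := by fun_prop
    have hintP : Integrable (fun u : PotentialUnit 𝓩 => Real.exp (s * |L| * |f u.1|)) P :=
      (integrable_map_measure hmeas.aestronglyMeasurable measurable_fst.aemeasurable).1 hint.1
    have hintb := h.integrable_armLaw b hintP
    have hae : ∀ᵐ u ∂(armLaw P b),
        Real.exp (s * |l u.1 * f u.1|) ≤ Real.exp (s * |L| * |f u.1|) := by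
      have h1 : ∀ᵐ u ∂P, |l u.1| ≤ L := ae_of_ae_map measurable_fst.aemeasurable hlL
      filter_upwards [(armLaw_absolutelyContinuous P b).ae_le h1] with u hu
      rw [Real.exp_le_exp, abs_mul, mul_assoc]
      exact mul_le_mul_of_nonneg_left (mul_le_mul_of_nonneg_right (hu.trans (le_abs_self _))
        (abs_nonneg _)) hs
    have hi : Integrable (fun u : PotentialUnit 𝓩 => Real.exp (s * |l u.1 * f u.1|))
        (armLaw P b) := by
      refine hintb.mono' (Measurable.aestronglyMeasurable (by fun_prop)) ?_
      filter_upwards [hae] with u hu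
      rwa [Real.norm_eq_abs, Real.abs_exp]
  · exact hi
  · have hmono : ∫ u, Real.exp (s * |L| * |f u.1|) ∂(armLaw P b) ≤
        q * ∫ z, Real.exp (s * |L| * |f z|) ∂(covLaw P) := by
      rw [covLaw, integral_map measurable_fst.aemeasurable hmeas.aestronglyMeasurable]
      calc ∫ u, Real.exp (s * |L| * |f u.1|) ∂(armLaw P b)
          ≤ ∫ u, Real.exp (s * |L| * |f u.1|)
              ∂(ENNReal.ofReal (armProb b (treatProb P))⁻¹ • P) :=
            integral_mono_measure (h.armLaw_le b) (ae_of_all _ fun u => (Real.exp_pos _).le)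
              (hintP.smul_measure (by simp))
        _ = (armProb b (treatProb P))⁻¹ * ∫ u, Real.exp (s * |L| * |f u.1|) ∂P := by
            rw [integral_smul_measure, ENNReal.toReal_ofReal (inv_nonneg.2 (hpos b).le), smul_eq_mul]
        _ ≤ _ := by
            exact mul_le_mul_of_nonneg_right (hq b)
              (integral_nonneg fun u => (Real.exp_pos (s * |L| * |f u.1|)).le)
    calc ∫ u, Real.exp (s * |l u.1 * f u.1|) ∂(armLaw P b)
        ≤ ∫ u, Real.exp (s * |L| * |f u.1|) ∂(armLaw P b) := integral_mono_ae hi hintb hae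
      _ ≤ q * (2 * Real.exp (s * |L| * |B| + c * (s * |L|) ^ 2 / 2)) :=
          hmono.trans (by gcongr; exact hint.2)
      _ ≤ q * (2 * Real.exp (|L| * |B| + (|L| * |B| + c * |L| ^ 2 / 2) * s ^ 2)) := by
          have h1 : s ≤ 1 + s ^ 2 := by nlinarith [sq_nonneg (s - 1)]
          have h2 := mul_le_mul_of_nonneg_right h1 (show 0 ≤ |L| * |B| by positivity)
          refine mul_le_mul_of_nonneg_left (mul_le_mul_of_nonneg_left
            (Real.exp_le_exp.2 ?_) zero_le_two) hq0
          calc s * |L| * |B| + c * (s * |L|) ^ 2 / 2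
              = s * (|L| * |B|) + c * |L| ^ 2 / 2 * s ^ 2 := by ring
            _ ≤ (1 + s ^ 2) * (|L| * |B|) + c * |L| ^ 2 / 2 * s ^ 2 := by gcongr
            _ = _ := by ring
      _ = 2 * q * Real.exp (|L| * |B|) * Real.exp ((|L| * |B| + c * |L| ^ 2 / 2) * s ^ 2) := by
          rw [Real.exp_add]; ring
      _ ≤ K * Real.exp (K * s ^ 2) := by gcongr

/-- Maximal inequality for arm averages of sub-Gaussian functions. -/
lemma armPi_exists_le (h : IsPopulation P e m₀) (t : Fin n → Bool) {b : Bool} {I : Finset (Fin n)}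
    (hI : ∀ i ∈ I, t i = b) {J : Type*} (S : Finset J) {f : J → PotentialUnit 𝓩 → ℝ}
    (hf : ∀ j ∈ S, Measurable (f j)) {C : ℝ≥0}
    (hsub : ∀ j ∈ S, HasSubgaussianMGF (fun u => f j u - ∫ u, f j u ∂(armLaw P b)) C (armLaw P b))
    {y : ℝ} (hy : 0 ≤ y) :
    armPi P t {d | ∃ j ∈ S, I.card * y ≤
        |∑ i ∈ I, (f j (d i) - ∫ u, f j u ∂(armLaw P b))|} ≤
      ENNReal.ofReal (S.card * (2 * Real.exp (-(I.card * y ^ 2 / (2 * C))))) := by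
  have hprob := h.isProbabilityMeasure_armPi t
  have hone : ∀ g : PotentialUnit 𝓩 → ℝ, Measurable g → HasSubgaussianMGF g C (armLaw P b) →
      (armPi P t).real {d | I.card * y ≤ ∑ i ∈ I, g (d i)} ≤
        Real.exp (-(I.card * y ^ 2 / (2 * C))) := by
    intro g hg hgs
    have := h.isProbabilityMeasure_armLaw
    have hind : iIndepFun (fun i (d : Fin n → PotentialUnit 𝓩) => g (d i)) (armPi P t) :=
      iIndepFun_pi (X := fun _ => g) fun i => hg.aemeasurable
    have hsg : ∀ i ∈ I, HasSubgaussianMGF (fun d : Fin n → PotentialUnit 𝓩 => g (d i)) C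
        (armPi P t) := fun i hi => by
      have hmp := h.measurePreserving_eval_armPi t i
      refine HasSubgaussianMGF.of_map (X := g) hmp.measurable.aemeasurable ?_
      rw [hmp.map_eq, hI i hi]; exact hgs
    have key := HasSubgaussianMGF.measure_sum_ge_le_of_iIndepFun hind (c := fun _ => C) hsg
      (ε := I.card * y) (by positivity)
    refine key.trans (le_of_eq ?_)
    congr 1
    rw [Finset.sum_const, nsmul_eq_mul]
    rcases eq_or_ne (I.card : ℝ) 0 with h0 | h0
    · simp [h0]
    · rw [neg_div, NNReal.coe_mul, NNReal.coe_natCast,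
        show (I.card * y) ^ 2 = I.card * (I.card * y ^ 2) by ring,
        show (2 * (I.card * C) : ℝ) = I.card * (2 * C) by ring, mul_div_mul_left _ _ h0]
  have hset : {d : Fin n → PotentialUnit 𝓩 | ∃ j ∈ S, I.card * y ≤
        |∑ i ∈ I, (f j (d i) - ∫ u, f j u ∂(armLaw P b))|} ⊆
      ⋃ j ∈ S, {d | I.card * y ≤ |∑ i ∈ I, (f j (d i) - ∫ u, f j u ∂(armLaw P b))|} := by
    rintro d ⟨j, hj, hd⟩
    exact Set.mem_biUnion hj hd
  refine (measure_mono hset).trans ((measure_biUnion_finset_le _ _).trans ?_)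
  calc ∑ j ∈ S, armPi P t {d | I.card * y ≤ |∑ i ∈ I, (f j (d i) - ∫ u, f j u ∂(armLaw P b))|}
      ≤ ∑ j ∈ S, ENNReal.ofReal (2 * Real.exp (-(I.card * y ^ 2 / (2 * C)))) := by
        refine Finset.sum_le_sum fun j hj => ?_
        have h1 := hone _ ((hf j hj).sub_const _) (hsub j hj)
        have h2 := hone _ ((hf j hj).sub_const (∫ u, f j u ∂(armLaw P b))).neg (hsub j hj).neg
        have hsub2 : {d : Fin n → PotentialUnit 𝓩 | I.card * y ≤
            |∑ i ∈ I, (f j (d i) - ∫ u, f j u ∂(armLaw P b))|} ⊆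
            {d | I.card * y ≤ ∑ i ∈ I, (f j (d i) - ∫ u, f j u ∂(armLaw P b))} ∪
            {d | I.card * y ≤ ∑ i ∈ I,
              (-fun u => f j u - ∫ u, f j u ∂(armLaw P b)) (d i)} := by
          intro d hd
          have hd' : I.card * y ≤ |∑ i ∈ I, (f j (d i) - ∫ u, f j u ∂(armLaw P b))| := hd
          rcases le_abs.1 hd' with h | h
          · exact Or.inl h
          · right
            simpa [Finset.sum_neg_distrib] using h
        rw [← ofReal_measureReal]
        refine ENNReal.ofReal_le_ofReal ?_
        calc _ ≤ _ := measureReal_mono hsub2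
          _ ≤ _ := measureReal_union_le _ _
          _ ≤ _ := by rw [two_mul]; exact add_le_add h1 h2
    _ = _ := by
        rw [Finset.sum_const, nsmul_eq_mul, ENNReal.ofReal_mul (by positivity)]
        simp

end IsPopulation

/-! ### Measurable selection of minimal-norm points -/

/-- Bounding the norm puts the second coordinate in a compact ball, and projection along a compact
factor is closed. -/
lemma isClosed_setOf_exists_norm_le {α E : Type*} [TopologicalSpace α] [NormedAddCommGroup E]
    [ProperSpace E] {K : Set (α × E)} (hK : IsClosed K) {C : Set E} (hC : IsClosed C) (r : ℝ) :
    IsClosed {x | ∃ w ∈ C, (x, w) ∈ K ∧ ‖w‖ ≤ r} := by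
  have hcomp : CompactSpace (Metric.closedBall (0 : E) r) :=
    isCompact_iff_compactSpace.1 (isCompact_closedBall 0 r)
  have hcl : IsClosed {y : α × Metric.closedBall (0 : E) r |
      (y.1, (y.2 : E)) ∈ K ∧ (y.2 : E) ∈ C} :=
    (hK.preimage (by fun_prop)).inter (hC.preimage (by fun_prop))
  convert isClosedMap_fst_of_compactSpace _ hcl using 1
  ext x
  constructor
  · rintro ⟨w, hw, hk, hr⟩
    exact ⟨(x, ⟨w, by simpa using hr⟩), ⟨hk, hw⟩, rfl⟩
  · rintro ⟨⟨x', w, hr⟩, ⟨hk, hw⟩, rfl⟩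
    exact ⟨w, hw, hk, by simpa using hr⟩

/-- Parallelogram law: the midpoint of two distinct points of equal norm is strictly shorter. This
gives uniqueness of minimal-norm points in convex fibres. -/
lemma eq_of_norm_minimal {E : Type*} [NormedAddCommGroup E] [InnerProductSpace ℝ E] {w w' : E}
    (h : ‖w‖ = ‖w'‖) (hmid : ‖w‖ ≤ ‖(1 / 2 : ℝ) • (w + w')‖) : w = w' := by
  have hp := parallelogram_law_with_norm ℝ w w'
  rw [norm_smul] at hmid
  norm_num at hmid
  have h0 : ‖w - w'‖ * ‖w - w'‖ ≤ 0 := by nlinarith [norm_nonneg w, norm_nonneg (w + w')]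
  have : ‖w - w'‖ = 0 := by nlinarith [norm_nonneg (w - w')]
  exact sub_eq_zero.1 (norm_eq_zero.1 this)

/-- A closed relation with convex fibres in a finite-dimensional Euclidean space has a measurable
selection of the points of minimal norm. -/
lemma exists_measurable_argmin {α E : Type*} [TopologicalSpace α] [MeasurableSpace α]
    [OpensMeasurableSpace α] [NormedAddCommGroup E] [InnerProductSpace ℝ E] [ProperSpace E]
    [MeasurableSpace E] [BorelSpace E] {K : Set (α × E)} (hK : IsClosed K)
    (hconv : ∀ x w w', (x, w) ∈ K → (x, w') ∈ K → (x, (1 / 2 : ℝ) • (w + w')) ∈ K) :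
    ∃ s : α → E, Measurable s ∧ ∀ x, (∃ w, (x, w) ∈ K) →
      (x, s x) ∈ K ∧ ∀ w, (x, w) ∈ K → ‖s x‖ ≤ ‖w‖ := by
  classical
  have hfib : ∀ x, IsClosed {w | (x, w) ∈ K} := fun x => hK.preimage (by fun_prop)
  have hatt : ∀ (x : α) (C : Set E), IsClosed C → (∃ w ∈ C, (x, w) ∈ K) →
      ∃ w ∈ C, (x, w) ∈ K ∧ ∀ w' ∈ C, (x, w') ∈ K → ‖w‖ ≤ ‖w'‖ := by
    rintro x C hC ⟨w₀, hw₀, hk₀⟩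
    obtain ⟨w, ⟨hwC, hwK⟩, hw⟩ := (hC.inter (hfib x)).exists_infDist_eq_dist ⟨w₀, hw₀, hk₀⟩ 0
    refine ⟨w, hwC, hwK, fun w' hC' hK' => ?_⟩
    have := Metric.infDist_le_dist_of_mem (x := (0 : E)) (show w' ∈ C ∩ {w | (x, w) ∈ K} from
      ⟨hC', hK'⟩)
    rw [hw] at this
    simpa [dist_zero_left] using this
  have hmin : ∀ x, (∃ w, (x, w) ∈ K) → ∃ w, (x, w) ∈ K ∧ ∀ w', (x, w') ∈ K → ‖w‖ ≤ ‖w'‖ := by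
    rintro x ⟨w, hw⟩
    obtain ⟨v, -, h1, h2⟩ := hatt x Set.univ isClosed_univ ⟨w, trivial, hw⟩
    exact ⟨v, h1, fun w' => h2 w' trivial⟩
  let s : α → E := fun x => if hx : ∃ w, (x, w) ∈ K then (hmin x hx).choose else 0
  have hs : ∀ x, (∃ w, (x, w) ∈ K) → (x, s x) ∈ K ∧ ∀ w, (x, w) ∈ K → ‖s x‖ ≤ ‖w‖ := by
    intro x hx
    simp only [s, dif_pos hx]
    exact (hmin x hx).choose_spec
  refine ⟨s, measurable_of_isClosed fun C hC => ?_, hs⟩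
  have hex : MeasurableSet {x | ∃ w, (x, w) ∈ K} := by
    have : {x | ∃ w, (x, w) ∈ K} = ⋃ r : ℕ, {x | ∃ w ∈ Set.univ, (x, w) ∈ K ∧ ‖w‖ ≤ (r : ℝ)} := by
      ext x
      simp only [Set.mem_ofPred_eq, Set.mem_iUnion, Set.mem_univ, true_and]
      constructor
      · rintro ⟨w, hw⟩
        obtain ⟨r, hr⟩ := exists_nat_ge ‖w‖
        exact ⟨r, w, hw, hr⟩
      · rintro ⟨r, w, hw, -⟩
        exact ⟨w, hw⟩
    rw [this]
    exact MeasurableSet.iUnion fun r =>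
      (isClosed_setOf_exists_norm_le hK isClosed_univ _).measurableSet
  -- The minimiser lies in C exactly when the fibre meets C at no larger norm than it is met at all.
  -- Comparing at rational radii r makes this a countable combination of closed sets. On empty
  -- fibres the selection has the default value 0.
  have hpre : s ⁻¹' C = ({x | ∃ w, (x, w) ∈ K} ∩ ⋂ r : ℚ,
      ({x | ∃ w ∈ Set.univ, (x, w) ∈ K ∧ ‖w‖ ≤ (r : ℝ)}ᶜ ∪
        {x | ∃ w ∈ C, (x, w) ∈ K ∧ ‖w‖ ≤ (r : ℝ)})) ∪
      ({x | ∃ w, (x, w) ∈ K}ᶜ ∩ {_x | (0 : E) ∈ C}) := by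
    ext x
    by_cases hx : ∃ w, (x, w) ∈ K
    · have hx' : x ∈ {x | ∃ w, (x, w) ∈ K} := hx
      simp only [Set.mem_union, Set.mem_inter_iff, hx', true_and, Set.mem_compl_iff, not_true,
        false_and, or_false, Set.mem_preimage, Set.mem_iInter]
      constructor
      · intro hC r
        by_cases hr : ‖s x‖ ≤ (r : ℝ)
        · exact Or.inr ⟨s x, hC, (hs x hx).1, hr⟩
        · refine Or.inl ?_
          rintro ⟨w, -, hw, hwr⟩
          exact hr (((hs x hx).2 w hw).trans hwr)
      · intro hall
        obtain ⟨r₀, hr₀⟩ := exists_rat_gt ‖s x‖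
        have hne : ∃ w ∈ C, (x, w) ∈ K := by
          rcases hall r₀ with h | ⟨w, hw, hk, -⟩
          · exact absurd ⟨s x, trivial, (hs x hx).1, hr₀.le⟩ h
          · exact ⟨w, hw, hk⟩
        obtain ⟨w, hwC, hwK, hwmin⟩ := hatt x C hC hne
        have hle : ‖w‖ ≤ ‖s x‖ := by
          by_contra! hlt
          obtain ⟨r, hr1, hr2⟩ := exists_rat_btwn hlt
          rcases hall r with h | ⟨w', hw', hk', hr'⟩
          · exact h ⟨s x, trivial, (hs x hx).1, hr1.le⟩
          · exact absurd ((hwmin w' hw' hk').trans hr') (not_le.2 hr2)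
        -- The shortest point of the fibre inside C is as short as the overall minimiser, so by
        -- uniqueness it is the minimiser.
        have heq : ‖s x‖ = ‖w‖ := le_antisymm ((hs x hx).2 w hwK) hle
        rw [eq_of_norm_minimal heq ((hs x hx).2 _ (hconv x _ _ (hs x hx).1 hwK))]
        exact hwC
    · have hx' : x ∉ {x | ∃ w, (x, w) ∈ K} := hx
      have h0 : s x = 0 := dif_neg hx
      simp [hx', h0]
  rw [hpre]
  refine (hex.inter (MeasurableSet.iInter fun r => ?_)).union (hex.compl.inter (.const _))
  exact ((isClosed_setOf_exists_norm_le hK isClosed_univ _).measurableSet.compl).union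
    (isClosed_setOf_exists_norm_le hK hC _).measurableSet

/-! ### The balancing program -/

section Program

variable {n p : ℕ} {Ic It : Finset (Fin n)} {S : Finset (Fin p)} {x : Fin n → Fin p → ℝ} {δ : ℝ}
  {w : Fin n → ℝ}

/-- The constraints of the balancing program with feature matrix `x`, control units `Ic` and treated
units `It`. -/
def Balances (Ic It : Finset (Fin n)) (S : Finset (Fin p)) (x : Fin n → Fin p → ℝ) (δ : ℝ)
    (w : Fin n → ℝ) : Prop :=
  (∀ j ∈ S, |(1 / (Ic.card : ℝ)) * ∑ i ∈ Ic, w i * x i j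
      - (1 / (It.card : ℝ)) * ∑ i ∈ It, x i j| ≤ δ) ∧
  (1 / (Ic.card : ℝ)) * ∑ i ∈ Ic, w i = 1

/-- Solutions of the balancing program. -/
def MinimallyBalances (Ic It : Finset (Fin n)) (S : Finset (Fin p)) (x : Fin n → Fin p → ℝ) (δ : ℝ)
    (w : Fin n → ℝ) : Prop :=
  Balances Ic It S x δ w ∧
    ∀ w', Balances Ic It S x δ w' → ∑ i ∈ Ic, w i ^ 2 ≤ ∑ i ∈ Ic, w' i ^ 2

lemma Balances.congr (hw : Balances Ic It S x δ w) {w' : Fin n → ℝ} (h : ∀ i ∈ Ic, w' i = w i) :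
    Balances Ic It S x δ w' := by
  refine ⟨fun j hj => ?_, ?_⟩
  · rw [Finset.sum_congr rfl fun i hi => by rw [h i hi]]
    exact hw.1 j hj
  · rw [Finset.sum_congr rfl h]
    exact hw.2

lemma Balances.midpoint {w' : Fin n → ℝ} (hw : Balances Ic It S x δ w)
    (hw' : Balances Ic It S x δ w') : Balances Ic It S x δ fun i => 1 / 2 * (w i + w' i) := by
  refine ⟨fun j hj => ?_, ?_⟩
  · have h1 := hw.1 j hj
    have h2 := hw'.1 j hj
    have : (∑ i ∈ Ic, 1 / 2 * (w i + w' i) * x i j) =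
        1 / 2 * (∑ i ∈ Ic, w i * x i j + ∑ i ∈ Ic, w' i * x i j) := by
      rw [← Finset.sum_add_distrib, Finset.mul_sum]
      exact Finset.sum_congr rfl fun i _ => by ring
    rw [this]
    rw [abs_le] at *
    constructor <;> linarith
  · rw [← Finset.mul_sum, Finset.sum_add_distrib]
    linarith [hw.2, hw'.2]

/-- Entries outside the control fold are free, so they are forced to vanish (`cut`) to make the
minimiser unique. All solutions then agree on the control fold with one measurable function of
features and tolerance, so the estimator may use an arbitrary solution. -/
lemma exists_measurable_solution (Ic It : Finset (Fin n)) (S : Finset (Fin p)) :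
    ∃ s : (Fin n → Fin p → ℝ) × ℝ → Fin n → ℝ, Measurable s ∧
      ∀ x δ, (∃ w, Balances Ic It S x δ w) → MinimallyBalances Ic It S x δ (s (x, δ)) ∧
        ∀ w, MinimallyBalances Ic It S x δ w → ∀ i ∈ Ic, w i = s (x, δ) i := by
  classical
  let K : Set (((Fin n → Fin p → ℝ) × ℝ) × EuclideanSpace ℝ (Fin n)) :=
    {y | Balances Ic It S y.1.1 y.1.2 (fun i => y.2 i) ∧ ∀ i ∉ Ic, y.2 i = 0}
  have hK : IsClosed K := by
    have h1 : IsClosed {y : ((Fin n → Fin p → ℝ) × ℝ) × EuclideanSpace ℝ (Fin n) |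
        ∀ j ∈ S, |(1 / (Ic.card : ℝ)) * ∑ i ∈ Ic, y.2 i * y.1.1 i j
          - (1 / (It.card : ℝ)) * ∑ i ∈ It, y.1.1 i j| ≤ y.1.2} := by
      simp only [Set.ofPred_forall]
      refine isClosed_iInter fun j => isClosed_iInter fun _ => isClosed_le ?_ (by fun_prop)
      fun_prop
    have h2 : IsClosed {y : ((Fin n → Fin p → ℝ) × ℝ) × EuclideanSpace ℝ (Fin n) |
        (1 / (Ic.card : ℝ)) * ∑ i ∈ Ic, y.2 i = 1} := isClosed_eq (by fun_prop) (by fun_prop)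
    have h3 : IsClosed {y : ((Fin n → Fin p → ℝ) × ℝ) × EuclideanSpace ℝ (Fin n) | ∀ i ∉ Ic, y.2 i = 0} := by
      simp only [Set.ofPred_forall]
      exact isClosed_iInter fun j => isClosed_iInter fun _ => isClosed_eq (by fun_prop) (by fun_prop)
    exact (h1.inter h2).inter h3
  have hconv : ∀ z w w', (z, w) ∈ K → (z, w') ∈ K → (z, (1 / 2 : ℝ) • (w + w')) ∈ K := by
    rintro z w w' ⟨h1, h2⟩ ⟨h3, h4⟩
    refine ⟨h1.midpoint h3, fun i hi => ?_⟩
    have e2 : w i = 0 := h2 i hi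
    have e4 : w' i = 0 := h4 i hi
    simp [e2, e4]
  obtain ⟨s, hs, hmin⟩ := exists_measurable_argmin hK hconv
  have hnorm : ∀ w : EuclideanSpace ℝ (Fin n), (∀ i ∉ Ic, w i = 0) → ‖w‖ ^ 2 = ∑ i ∈ Ic, w i ^ 2 := fun w hw => by
    rw [EuclideanSpace.real_norm_sq_eq]
    exact (Finset.sum_subset (Finset.subset_univ _) fun i _ hi => by simp [hw i hi]).symm
  let cut : (Fin n → ℝ) → EuclideanSpace ℝ (Fin n) := fun w => WithLp.toLp 2 fun i => if i ∈ Ic then w i else 0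
  have hcut : ∀ w, ∀ i ∉ Ic, cut w i = 0 := fun w i hi => by simp [cut, hi]
  have hcut' : ∀ w, ∀ i ∈ Ic, cut w i = w i := fun w i hi => by simp [cut, hi]
  have hmem : ∀ z w, Balances Ic It S z.1 z.2 w → (z, cut w) ∈ K := fun z w hw =>
    ⟨hw.congr (hcut' w), hcut w⟩
  have hnc : ∀ w, ‖cut w‖ ^ 2 = ∑ i ∈ Ic, w i ^ 2 := fun w => by
    rw [hnorm _ (hcut w)]
    exact Finset.sum_congr rfl fun i hi => by rw [hcut' w i hi]
  refine ⟨fun z i => s z i, by fun_prop, fun x δ ⟨w, hw⟩ => ?_⟩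
  obtain ⟨h1, h2⟩ := hmin (x, δ) ⟨_, hmem (x, δ) w hw⟩
  refine ⟨⟨h1.1, fun w' hw' => ?_⟩, fun w' hw' i hi => ?_⟩
  · rw [← hnorm _ h1.2, ← hnc]
    exact pow_le_pow_left₀ (norm_nonneg _) (h2 _ (hmem (x, δ) w' hw')) 2
  · have hle := h2 _ (hmem (x, δ) w' hw'.1)
    have hge := hw'.2 _ h1.1
    rw [← hnorm _ h1.2, ← hnc] at hge
    have heq : ‖s (x, δ)‖ = ‖cut w'‖ :=
      le_antisymm hle (le_of_sq_le_sq hge (norm_nonneg _))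
    have := eq_of_norm_minimal heq (h2 _ (hconv _ _ _ h1 (hmem (x, δ) w' hw'.1)))
    rw [← hcut' w' i hi, ← this]

/-- Least squares by orthogonal projection onto the span of the columns; no rank condition is
needed. -/
lemma exists_normal_equations {ι J : Type*} (I : Finset ι) (S : Finset J) (x : ι → J → ℝ)
    (w : ι → ℝ) : ∃ v : S → ℝ, ∀ j ∈ S, ∑ i ∈ I, (w i - ∑ l : S, v l * x i l) * x i j = 0 := by
  classical
  let c : S → EuclideanSpace ℝ I := fun j => WithLp.toLp 2 fun i => x i j
  let V : Submodule ℝ (EuclideanSpace ℝ I) := Submodule.span ℝ (Set.range c)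
  let w' : EuclideanSpace ℝ I := WithLp.toLp 2 fun i => w i
  obtain ⟨v, hv⟩ := (Submodule.mem_span_range_iff_exists_fun ℝ).1 (V.starProjection_apply_mem w')
  refine ⟨v, fun j hj => ?_⟩
  have h1 := V.sub_starProjection_mem_orthogonal w'
  rw [← hv, Submodule.mem_orthogonal] at h1
  have h2 := h1 (c ⟨j, hj⟩) (Submodule.subset_span ⟨_, rfl⟩)
  rw [PiLp.inner_apply] at h2
  rw [← Finset.sum_coe_sort]
  refine Eq.trans (Finset.sum_congr rfl fun i _ => ?_) h2
  simp [c, w']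

lemma linComb_sum_mul {a : Fin n → ℝ} {I : Finset (Fin n)} (η : S → ℝ) :
    ∑ i ∈ I, a i * linComb (x i) S η = ∑ j, η j * ∑ i ∈ I, a i * x i j := by
  simp only [linComb, Finset.mul_sum]
  rw [Finset.sum_comm]
  exact Finset.sum_congr rfl fun j _ => Finset.sum_congr rfl fun i _ => by ring

/-- If the intercept is balanced, minimal weights are linear in the balanced features. -/
lemma MinimallyBalances.exists_linComb (hw : MinimallyBalances Ic It S x δ w) {η : S → ℝ}
    (hη : ∀ i ∈ Ic, linComb (x i) S η = 1) : ∃ v : S → ℝ, ∀ i ∈ Ic, w i = linComb (x i) S v := by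
  obtain ⟨v, hv⟩ := exists_normal_equations Ic S x w
  refine ⟨v, ?_⟩
  set w' : Fin n → ℝ := fun i => linComb (x i) S v with hw'
  have hv' : ∀ j ∈ S, ∑ i ∈ Ic, (w i - w' i) * x i j = 0 := hv
  have hlin : ∀ u : S → ℝ, ∑ i ∈ Ic, (w i - w' i) * linComb (x i) S u = 0 := fun u => by
    rw [linComb_sum_mul]
    exact Finset.sum_eq_zero fun j _ => by rw [hv' j j.2, mul_zero]
  -- The intercept is in the span, so projecting onto the features preserves the total weight and
  -- the projection w' stays feasible.
  have hsum : ∑ i ∈ Ic, w' i = ∑ i ∈ Ic, w i := by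
    have := hlin η
    rw [Finset.sum_congr rfl fun i hi => by rw [hη i hi, mul_one], Finset.sum_sub_distrib] at this
    linarith
  have hbal : Balances Ic It S x δ w' := by
    refine ⟨fun j hj => ?_, ?_⟩
    · have : ∑ i ∈ Ic, w' i * x i j = ∑ i ∈ Ic, w i * x i j := by
        have := hv' j hj
        simp only [sub_mul, Finset.sum_sub_distrib] at this
        linarith
      rw [this]; exact hw.1.1 j hj
    · rw [hsum]; exact hw.1.2
  have hle := hw.2 w' hbal
  -- Pythagoras: a nonzero residual would make the feasible w' strictly shorter than the minimal w.
  have hpyth : ∑ i ∈ Ic, w i ^ 2 = ∑ i ∈ Ic, w' i ^ 2 + ∑ i ∈ Ic, (w i - w' i) ^ 2 := by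
    have h0 := hlin v
    rw [← Finset.sum_add_distrib]
    have : ∑ i ∈ Ic, w i ^ 2 - ∑ i ∈ Ic, (w' i ^ 2 + (w i - w' i) ^ 2) =
        2 * ∑ i ∈ Ic, (w i - w' i) * linComb (x i) S v := by
      rw [← Finset.sum_sub_distrib, Finset.mul_sum]
      exact Finset.sum_congr rfl fun i _ => by simp only [hw']; ring
    rw [h0] at this
    linarith
  have hz : ∑ i ∈ Ic, (w i - w' i) ^ 2 = 0 :=
    le_antisymm (by linarith) (Finset.sum_nonneg fun i _ => sq_nonneg _)
  intro i hi
  have := (Finset.sum_eq_zero_iff_of_nonneg fun i _ => sq_nonneg _).1 hz i hi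
  exact sub_eq_zero.1 (pow_eq_zero_iff two_ne_zero |>.1 this)

lemma abs_sum_mul_le_l1norm (η : S → ℝ) {a : Fin p → ℝ} {c : ℝ} (ha : ∀ j ∈ S, |a j| ≤ c) :
    |∑ j : S, η j * a j| ≤ l1norm η * c := by
  refine (Finset.abs_sum_le_sum_abs _ _).trans ?_
  rw [l1norm, Finset.sum_mul]
  exact Finset.sum_le_sum fun j _ => by
    rw [abs_mul]; exact mul_le_mul_of_nonneg_left (ha j j.2) (abs_nonneg _)

/-- The balancing program is feasible when the restricted Gram matrix is nonsingular. -/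
lemma exists_balances {ξ c : ℝ} (hξ : 0 < ξ)
    (hgram : ∀ v : S → ℝ, ξ * l1norm v ^ 2 ≤ c * ∑ i ∈ Ic, linComb (x i) S v ^ 2)
    {η : S → ℝ} (hη : ∀ i ∈ Ic, linComb (x i) S η = 1) (hη' : ∀ i ∈ It, linComb (x i) S η = 1)
    (hIc : Ic.Nonempty) (hIt : It.Nonempty) (hδ : 0 ≤ δ) : ∃ w, Balances Ic It S x δ w := by
  have hc : (Ic.card : ℝ) ≠ 0 := by exact_mod_cast hIc.card_pos.ne'
  have ht : (It.card : ℝ) ≠ 0 := by exact_mod_cast hIt.card_pos.ne'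
  -- The Gram operator of the control features. The eigenvalue bound makes it injective, hence
  -- surjective, so linear weights exist that balance all the features exactly.
  let G : (S → ℝ) →ₗ[ℝ] (S → ℝ) :=
    { toFun := fun v j => ∑ i ∈ Ic, linComb (x i) S v * x i j
      map_add' := fun v v' => by
        ext j
        simp only [linComb, Pi.add_apply, add_mul, Finset.sum_add_distrib]
      map_smul' := fun r v => by
        ext j
        simp only [linComb, Pi.smul_apply, smul_eq_mul, RingHom.id_apply, Finset.mul_sum,
          Finset.sum_mul, mul_assoc] }
  have hinj : Function.Injective G := by
    rw [← LinearMap.ker_eq_bot, LinearMap.ker_eq_bot']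
    intro v hv
    have h0 : ∑ i ∈ Ic, linComb (x i) S v ^ 2 = 0 := by
      have : ∑ i ∈ Ic, linComb (x i) S v * linComb (x i) S v = 0 := by
        rw [linComb_sum_mul]
        exact Finset.sum_eq_zero fun j _ => by
          rw [show ∑ i ∈ Ic, linComb (x i) S v * x i j = 0 from congrFun hv j, mul_zero]
      simpa [sq] using this
    have h1 := hgram v
    rw [h0, mul_zero] at h1
    have h2 : l1norm v ^ 2 ≤ 0 := by
      by_contra! hlt
      exact absurd h1 (not_le.2 (mul_pos hξ hlt))
    have h3 : l1norm v = 0 := pow_eq_zero_iff two_ne_zero |>.1 (le_antisymm h2 (sq_nonneg _))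
    ext j
    exact abs_eq_zero.1 ((Finset.sum_eq_zero_iff_of_nonneg fun _ _ => abs_nonneg _).1 h3 j
      (Finset.mem_univ j))
  obtain ⟨v, hv⟩ := (LinearMap.injective_iff_surjective.1 hinj)
    fun j => (Ic.card : ℝ) * ((1 / (It.card : ℝ)) * ∑ i ∈ It, x i j)
  have hbal : ∀ j : S, ∑ i ∈ Ic, linComb (x i) S v * x i j =
      (Ic.card : ℝ) * ((1 / (It.card : ℝ)) * ∑ i ∈ It, x i j) := fun j => congrFun hv j
  refine ⟨fun i => linComb (x i) S v, fun j hj => ?_, ?_⟩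
  · rw [hbal ⟨j, hj⟩, ← mul_assoc, one_div, inv_mul_cancel₀ hc, one_mul, sub_self, abs_zero]
    exact hδ
  -- The normalisation is not a further equation: the constant 1 is a combination of features that
  -- are exactly balanced.
  · have h1 : ∑ i ∈ Ic, linComb (x i) S v = ∑ i ∈ Ic, linComb (x i) S v * linComb (x i) S η :=
      Finset.sum_congr rfl fun i hi => by rw [hη i hi, mul_one]
    have h2 : (It.card : ℝ) = ∑ i ∈ It, 1 * linComb (x i) S η := by
      rw [Finset.sum_congr rfl fun i hi => by rw [hη' i hi, one_mul]]
      simp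
    rw [linComb_sum_mul] at h1 h2
    rw [h1, Finset.sum_congr rfl fun j _ => by rw [hbal j]]
    simp only [one_mul] at h2
    have h3 : ∑ j : S, η j * ((Ic.card : ℝ) * ((1 / (It.card : ℝ)) * ∑ i ∈ It, x i j)) =
        (Ic.card : ℝ) * (1 / (It.card : ℝ)) * ∑ j : S, η j * ∑ i ∈ It, x i j := by
      rw [Finset.mul_sum]
      exact Finset.sum_congr rfl fun j _ => by ring
    rw [h3, ← h2]
    field_simp

/-- Distance from minimal weights to any linear weights that balance approximately. -/
lemma MinimallyBalances.sum_sq_sub_le (hw : MinimallyBalances Ic It S x δ w) {ξ τ : ℝ} (hξ : 0 < ξ)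
    (hn : 0 < n)
    (hgram : ∀ v : S → ℝ, ξ * l1norm v ^ 2 ≤ (1 / (n : ℝ)) * ∑ i ∈ Ic, linComb (x i) S v ^ 2)
    {η ηw : S → ℝ} (hη : ∀ i ∈ Ic, linComb (x i) S η = 1) (hIc : Ic.Nonempty)
    (hτ : ∀ j ∈ S, |(1 / (It.card : ℝ)) * ∑ i ∈ It, x i j -
      (1 / (Ic.card : ℝ)) * ∑ i ∈ Ic, linComb (x i) S ηw * x i j| ≤ τ) :
    ∑ i ∈ Ic, (w i - linComb (x i) S ηw) ^ 2 ≤ (Ic.card : ℝ) ^ 2 * (δ + τ) ^ 2 / (n * ξ) := by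
  have hc : (Ic.card : ℝ) ≠ 0 := by exact_mod_cast hIc.card_pos.ne'
  have hn' : (0 : ℝ) < n := by exact_mod_cast hn
  obtain ⟨v₀, hv₀⟩ := hw.exists_linComb hη
  let v : S → ℝ := fun j => v₀ j - ηw j
  have hv : ∀ i ∈ Ic, w i - linComb (x i) S ηw = linComb (x i) S v := fun i hi => by
    rw [hv₀ i hi]
    simp only [linComb, v, sub_mul, Finset.sum_sub_distrib]
  -- The inner product of vᵀX with each feature is a difference of two weighted averages, one within
  -- δ and the other within τ of the treated mean.
  have hip : ∀ j ∈ S, |∑ i ∈ Ic, linComb (x i) S v * x i j| ≤ Ic.card * (δ + τ) := fun j hj => by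
    have h1 := hw.1.1 j hj
    have h2 := hτ j hj
    have h3 : ∑ i ∈ Ic, linComb (x i) S v * x i j =
        Ic.card * (((1 / (Ic.card : ℝ)) * ∑ i ∈ Ic, w i * x i j
          - (1 / (It.card : ℝ)) * ∑ i ∈ It, x i j) + ((1 / (It.card : ℝ)) * ∑ i ∈ It, x i j -
      (1 / (Ic.card : ℝ)) * ∑ i ∈ Ic, linComb (x i) S ηw * x i j)) := by
      rw [Finset.sum_congr rfl fun i hi => by rw [← hv i hi, sub_mul], Finset.sum_sub_distrib]
      field_simp
      ring
    rw [h3, abs_mul, Nat.abs_cast]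
    exact mul_le_mul_of_nonneg_left ((abs_add_le _ _).trans (add_le_add h1 h2)) (Nat.cast_nonneg _)
  rw [Finset.sum_congr rfl fun i hi => by rw [hv i hi]]
  set q := ∑ i ∈ Ic, linComb (x i) S v ^ 2 with hq
  have hq0 : 0 ≤ q := Finset.sum_nonneg fun i _ => sq_nonneg _
  -- The quadratic form is at most ‖v‖₁ times the largest inner product, while the eigenvalue
  -- condition gives nξ‖v‖₁² ≤ q. Eliminating ‖v‖₁ bounds q with no dependence on the number of
  -- features other than through τ and ξ.
  have hq1 : q ≤ l1norm v * (Ic.card * (δ + τ)) := by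
    have : q = ∑ j, v j * ∑ i ∈ Ic, linComb (x i) S v * x i j := by
      rw [← linComb_sum_mul, hq]
      exact Finset.sum_congr rfl fun i _ => sq _
    rw [this]
    exact (le_abs_self _).trans (abs_sum_mul_le_l1norm v hip)
  have hq2 : n * ξ * l1norm v ^ 2 ≤ q := by
    have := hgram v
    calc n * ξ * l1norm v ^ 2 = n * (ξ * l1norm v ^ 2) := by ring
      _ ≤ n * ((1 / (n : ℝ)) * q) := by gcongr
      _ = q := by field_simp
  rw [le_div_iff₀ (by positivity), ← mul_pow]
  rcases eq_or_lt_of_le hq0 with h0 | h0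
  · rw [← h0, zero_mul]; positivity
  · have h4 : q ^ 2 ≤ (l1norm v * (Ic.card * (δ + τ))) ^ 2 := pow_le_pow_left₀ hq0 hq1 2
    have h5 : q * (q * (n * ξ)) ≤ q * (Ic.card * (δ + τ)) ^ 2 := by
      calc q * (q * (n * ξ)) = q ^ 2 * (n * ξ) := by ring
        _ ≤ (l1norm v * (Ic.card * (δ + τ))) ^ 2 * (n * ξ) := by gcongr
        _ = (n * ξ * l1norm v ^ 2) * (Ic.card * (δ + τ)) ^ 2 := by ring
        _ ≤ q * (Ic.card * (δ + τ)) ^ 2 := by gcongr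
    exact le_of_mul_le_mul_left h5 h0

/-- With a single constant feature the weights are uniform. -/
lemma MinimallyBalances.eq_one_of_card_eq_one (hw : MinimallyBalances Ic It S x δ w)
    (hS : S.card = 1) {η : S → ℝ} (hη : ∀ i ∈ Ic, linComb (x i) S η = 1) :
    ∀ i ∈ Ic, w i = 1 := by
  obtain ⟨j, rfl⟩ := Finset.card_eq_one.1 hS
  obtain ⟨v, hv⟩ := hw.exists_linComb hη
  have hlc : ∀ (u : ({j} : Finset (Fin p)) → ℝ) i, linComb (x i) {j} u =
      u ⟨j, Finset.mem_singleton_self j⟩ * x i j := fun u i => by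
    rw [linComb]
    exact Fintype.sum_unique (fun l : ({j} : Finset (Fin p)) => u l * x i l)
  set a := v ⟨j, Finset.mem_singleton_self j⟩
  set b := η ⟨j, Finset.mem_singleton_self j⟩
  have hb : ∀ i ∈ Ic, b * x i j = 1 := fun i hi => by rw [← hη i hi, hlc]
  have hw1 : ∀ i ∈ Ic, w i = a / b := fun i hi => by
    have hb0 : b ≠ 0 := left_ne_zero_of_mul (by rw [hb i hi]; exact one_ne_zero)
    rw [hv i hi, hlc, eq_div_iff hb0, mul_assoc, mul_comm (x i j), hb i hi, mul_one]
  intro i hi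
  have hc : (Ic.card : ℝ) ≠ 0 := by exact_mod_cast (Finset.card_pos.2 ⟨i, hi⟩).ne'
  have h1 := hw.1.2
  rw [Finset.sum_congr rfl hw1, Finset.sum_const, nsmul_eq_mul, ← mul_assoc, one_div,
    inv_mul_cancel₀ hc, one_mul] at h1
  rw [hw1 i hi, h1]

end Program

/-! ### Best linear approximation -/

section BestApproximation

variable {𝓩 : Type*} [MeasurableSpace 𝓩] {ν : Measure 𝓩} {p : ℕ} {φ : 𝓩 → Fin p → ℝ}
  {S : Finset (Fin p)} {f : 𝓩 → ℝ} {η : S → ℝ}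

lemma toReal_eLpNorm_two_sq {α : Type*} [MeasurableSpace α] {κ : Measure α} {g : α → ℝ}
    (hg : MemLp g 2 κ) : (eLpNorm g 2 κ).toReal ^ 2 = ∫ x, g x ^ 2 ∂κ := by
  have h0 : 0 ≤ ∫ x, g x ^ 2 ∂κ := integral_nonneg fun x => sq_nonneg _
  rw [hg.eLpNorm_eq_integral_rpow_norm two_ne_zero ENNReal.ofNat_ne_top]
  simp only [ENNReal.toReal_ofNat, Real.rpow_ofNat, Real.norm_eq_abs, sq_abs]
  rw [ENNReal.toReal_ofReal (by positivity), ← Real.rpow_natCast, ← Real.rpow_mul h0]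
  norm_num

lemma eLpNorm_two_le_iff {α : Type*} [MeasurableSpace α] {κ : Measure α} {g g' : α → ℝ}
    (hg : MemLp g 2 κ) (hg' : MemLp g' 2 κ) (hle : eLpNorm g 2 κ ≤ eLpNorm g' 2 κ) :
    ∫ x, g x ^ 2 ∂κ ≤ ∫ x, g' x ^ 2 ∂κ := by
  rw [← toReal_eLpNorm_two_sq hg, ← toReal_eLpNorm_two_sq hg']
  gcongr
  exact hg'.2.ne

lemma IsBestCoef.toReal_sq (hη : IsBestCoef ν φ S f η)
    (hf : MemLp (fun z => f z - linComb (φ z) S η) 2 ν) :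
    (approxError ν φ S f).toReal ^ 2 = ∫ z, (f z - linComb (φ z) S η) ^ 2 ∂ν := by
  rw [← toReal_eLpNorm_two_sq hf, hη]

/-- The residual of a best linear approximation is orthogonal to the features. -/
lemma IsBestCoef.integral_mul_eq_zero (hη : IsBestCoef ν φ S f η)
    (hf : MemLp (fun z => f z - linComb (φ z) S η) 2 ν) {j : Fin p} (hj : j ∈ S)
    (hφ : MemLp (fun z => φ z j) 2 ν) : ∫ z, (f z - linComb (φ z) S η) * φ z j ∂ν = 0 := by
  classical
  set g : 𝓩 → ℝ := fun z => f z - linComb (φ z) S η with hg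
  have hint : Integrable (fun z => g z * φ z j) ν := hf.integrable_mul hφ
  -- Moving the coefficient of feature j by s cannot decrease the L² distance.
  have key : ∀ s : ℝ, 0 ≤ s ^ 2 * ∫ z, φ z j ^ 2 ∂ν - 2 * s * ∫ z, g z * φ z j ∂ν := by
    intro s
    let η' : S → ℝ := fun l => η l + if l = ⟨j, hj⟩ then s else 0
    have h1 : ∀ z, f z - linComb (φ z) S η' = g z - s * φ z j := fun z => by
      simp only [hg, linComb, η', add_mul, Finset.sum_add_distrib, ite_mul, zero_mul,
        Finset.sum_ite_eq', Finset.mem_univ, if_true]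
      ring
    have h2 : eLpNorm g 2 ν ≤ eLpNorm (fun z => g z - s * φ z j) 2 ν := by
      have : eLpNorm g 2 ν = approxError ν φ S f := hη
      rw [this]
      refine (iInf_le _ η').trans (le_of_eq ?_)
      simp only [h1]
    have h3 := eLpNorm_two_le_iff hf (hf.sub (hφ.const_mul s)) h2
    have h4 : ∫ z, (g z - s * φ z j) ^ 2 ∂ν =
        ∫ z, g z ^ 2 ∂ν + ((-(2 * s)) * ∫ z, g z * φ z j ∂ν + s ^ 2 * ∫ z, φ z j ^ 2 ∂ν) := by
      have i1 := hf.integrable_sq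
      have i2 := hint.const_mul (-(2 * s))
      have i3 := hφ.integrable_sq.const_mul (s ^ 2)
      calc ∫ z, (g z - s * φ z j) ^ 2 ∂ν
          = ∫ z, (g z ^ 2 + ((-(2 * s)) * (g z * φ z j) + s ^ 2 * φ z j ^ 2)) ∂ν :=
            integral_congr_ae (ae_of_all _ fun z => by ring)
        _ = _ := by
            refine (integral_add i1 (i2.add i3)).trans (congrArg _ ?_)
            refine (integral_add i2 i3).trans ?_
            rw [integral_const_mul, integral_const_mul]
    simp only [Pi.sub_apply] at h3
    linarith [h3, h4]
  set b := ∫ z, g z * φ z j ∂ν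
  set a := ∫ z, φ z j ^ 2 ∂ν with ha
  have ha0 : 0 ≤ a := integral_nonneg fun z => sq_nonneg _
  -- This step makes the quadratic strictly negative unless b = 0. The denominator is a + 1 rather
  -- than a, so that features of zero norm need no separate case.
  have h1 := key (b / (a + 1))
  have h2 : (b / (a + 1)) ^ 2 * a - 2 * (b / (a + 1)) * b = -(b ^ 2 * (a + 2) / (a + 1) ^ 2) := by
    field_simp; ring
  rw [h2] at h1
  by_contra hb
  have : 0 < b ^ 2 * (a + 2) / (a + 1) ^ 2 := by positivity
  linarith

end BestApproximation

/-! ### Admissible selections -/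

section Selection

variable {𝓩 : Type*} [MeasurableSpace 𝓩] [StandardBorelSpace 𝓩]
  {P : Measure (PotentialUnit 𝓩)} [IsProbabilityMeasure P] {e m₀ : 𝓩 → ℝ} {n p : ℕ}
  {φ : 𝓩 → Fin p → ℝ} {S : Finset (Fin p)} {M₂ M₃ : ℝ}

/-- A measurable dictionary of sub-Gaussian features with bounded means. -/
structure IsDictionary (P : Measure (PotentialUnit 𝓩)) (φ : 𝓩 → Fin p → ℝ) (c : ℝ≥0) (B : ℝ) :
    Prop where
  meas : Measurable φ
  mean_le : ∀ j, |∫ z, φ z j ∂(covLaw P)| ≤ B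
  subgaussian : ∀ j, HasSubgaussianMGF (fun z => φ z j - ∫ z', φ z' j ∂(covLaw P)) c (covLaw P)

/-- Best linear approximations of the weight function and of the regression function by the
selected features, with the regularity of the theorem. -/
structure Admissible (P : Measure (PotentialUnit 𝓩)) (e m₀ : 𝓩 → ℝ) (φ : 𝓩 → Fin p → ℝ)
    (S : Finset (Fin p)) (M₂ M₃ : ℝ) where
  one : S → ℝ
  linComb_one : ∀ᵐ z ∂(covLaw P), linComb (φ z) S one = 1
  weight : S → ℝ
  best_weight : IsBestCoef (controlLaw P) φ S (oddsWeight P e) weight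
  weight_close : ∀ᵐ z ∂(covLaw P), |oddsWeight P e z - linComb (φ z) S weight| ≤ M₂
  regr : S → ℝ
  best_regr : IsBestCoef (controlLaw P) φ S m₀ regr
  l1norm_regr : l1norm regr ≤ M₃

lemma controlLaw_absolutelyContinuous (P : Measure (PotentialUnit 𝓩)) :
    controlLaw P ≪ covLaw P :=
  (armLaw_absolutelyContinuous P false).map measurable_fst

lemma integral_controlLaw {f : 𝓩 → ℝ} (hf : Measurable f) :
    ∫ z, f z ∂(controlLaw P) = ∫ u, f u.1 ∂(armLaw P false) := by
  rw [← map_armLaw_false, integral_map measurable_fst.aemeasurable hf.aestronglyMeasurable]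

@[fun_prop]
lemma measurable_linComb {η : S → ℝ} (hφ : Measurable φ) :
    Measurable fun z => linComb (φ z) S η := by
  unfold linComb; fun_prop

namespace IsDictionary

variable {c : ℝ≥0} {B : ℝ}

lemma measurable_apply (hφ : IsDictionary P φ c B) (j : Fin p) : Measurable fun z => φ z j :=
  (measurable_pi_apply j).comp hφ.meas

lemma memLp (hφ : IsDictionary P φ c B) (j : Fin p) :
    MemLp (fun u : PotentialUnit 𝓩 => φ u.1 j) 2 P := by
  have hprob : IsProbabilityMeasure (covLaw P) :=
    Measure.isProbabilityMeasure_map measurable_fst.aemeasurable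
  have h0 : (0 : ℝ) ∈ interior (integrableExpSet
      (fun z => φ z j - ∫ z', φ z' j ∂(covLaw P)) (covLaw P)) := by
    rw [(hφ.subgaussian j).integrableExpSet_eq_univ, interior_univ]; trivial
  have h1 : MemLp (fun z => φ z j - ∫ z', φ z' j ∂(covLaw P)) 2 (covLaw P) :=
    memLp_of_mem_interior_integrableExpSet h0 2
  have h2 : MemLp (fun z => φ z j) 2 (covLaw P) := by
    have := h1.add (memLp_const (∫ z', φ z' j ∂(covLaw P)))
    convert this using 1
    ext z; simp
  exact h2.comp_measurePreserving ⟨measurable_fst, rfl⟩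

lemma memLp_controlLaw (h : IsPopulation P e m₀) (hφ : IsDictionary P φ c B) (j : Fin p) :
    MemLp (fun z => φ z j) 2 (controlLaw P) :=
  (memLp_map_measure_iff (hφ.measurable_apply j).aestronglyMeasurable
    measurable_fst.aemeasurable).2 (h.memLp_armLaw false (hφ.memLp j))

lemma memLp_linComb (h : IsPopulation P e m₀) (hφ : IsDictionary P φ c B) (η : S → ℝ) :
    MemLp (fun z => linComb (φ z) S η) 2 (controlLaw P) := by
  unfold linComb
  exact memLp_finsetSum _ fun j _ => (hφ.memLp_controlLaw h j).const_mul (η j)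

end IsDictionary

lemma IsPopulation.memLp_oddsWeight (h : IsPopulation P e m₀)
    (hM₂ : ∀ᵐ z ∂(covLaw P), oddsWeight P e z ≤ M₂) :
    MemLp (oddsWeight P e) 2 (controlLaw P) := by
  have := h.isProbabilityMeasure_armLaw false
  have hprob : IsProbabilityMeasure (controlLaw P) := by
    rw [← map_armLaw_false]
    exact Measure.isProbabilityMeasure_map measurable_fst.aemeasurable
  refine MemLp.of_bound h.measurable_oddsWeight.aestronglyMeasurable M₂ ?_
  filter_upwards [(controlLaw_absolutelyContinuous P).ae_le hM₂] with z hz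
  rwa [Real.norm_eq_abs, abs_of_pos (h.oddsWeight_pos z)]

lemma IsPopulation.pos_of_oddsWeight_le (h : IsPopulation P e m₀)
    (hM₂ : ∀ᵐ z ∂(covLaw P), oddsWeight P e z ≤ M₂) : 0 < M₂ := by
  have hprob : IsProbabilityMeasure (covLaw P) :=
    Measure.isProbabilityMeasure_map measurable_fst.aemeasurable
  obtain ⟨z, hz⟩ := hM₂.exists
  exact (h.oddsWeight_pos z).trans_le hz

namespace Admissible

variable {c : ℝ≥0} {B : ℝ}

/-- The linear approximation of the weight function. -/
def wt (G : Admissible P e m₀ φ S M₂ M₃) (z : 𝓩) : ℝ := linComb (φ z) S G.weight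

/-- The residual of the linear approximation of the regression function. -/
def res (G : Admissible P e m₀ φ S M₂ M₃) (z : 𝓩) : ℝ := m₀ z - linComb (φ z) S G.regr

lemma measurable_wt (G : Admissible P e m₀ φ S M₂ M₃) (hφ : IsDictionary P φ c B) :
    Measurable G.wt := measurable_linComb hφ.meas

lemma measurable_res (h : IsPopulation P e m₀) (G : Admissible P e m₀ φ S M₂ M₃)
    (hφ : IsDictionary P φ c B) : Measurable G.res :=
  h.measurable_m.sub (measurable_linComb hφ.meas)

lemma memLp_res (h : IsPopulation P e m₀) (G : Admissible P e m₀ φ S M₂ M₃)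
    (hφ : IsDictionary P φ c B) (hm : MemLp m₀ 2 (controlLaw P)) :
    MemLp G.res 2 (controlLaw P) := hm.sub (hφ.memLp_linComb h _)

lemma memLp_sub_wt (h : IsPopulation P e m₀) (G : Admissible P e m₀ φ S M₂ M₃)
    (hφ : IsDictionary P φ c B) (hM₂ : ∀ᵐ z ∂(covLaw P), oddsWeight P e z ≤ M₂) :
    MemLp (fun z => oddsWeight P e z - G.wt z) 2 (controlLaw P) :=
  (h.memLp_oddsWeight hM₂).sub (hφ.memLp_linComb h _)

lemma approxError_regr_sq (h : IsPopulation P e m₀) (G : Admissible P e m₀ φ S M₂ M₃)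
    (hφ : IsDictionary P φ c B) (hm : MemLp m₀ 2 (controlLaw P)) :
    (approxError (controlLaw P) φ S m₀).toReal ^ 2 = ∫ u, G.res u.1 ^ 2 ∂(armLaw P false) := by
  rw [G.best_regr.toReal_sq (G.memLp_res h hφ hm)]
  exact integral_controlLaw (f := fun z => G.res z ^ 2) ((G.measurable_res h hφ).pow_const 2)

lemma approxError_weight_sq (h : IsPopulation P e m₀) (G : Admissible P e m₀ φ S M₂ M₃)
    (hφ : IsDictionary P φ c B) (hM₂ : ∀ᵐ z ∂(covLaw P), oddsWeight P e z ≤ M₂) :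
    (approxError (controlLaw P) φ S (oddsWeight P e)).toReal ^ 2 =
      ∫ u, (oddsWeight P e u.1 - G.wt u.1) ^ 2 ∂(armLaw P false) := by
  rw [G.best_weight.toReal_sq (G.memLp_sub_wt h hφ hM₂)]
  exact integral_controlLaw (f := fun z => (oddsWeight P e z - G.wt z) ^ 2)
    ((h.measurable_oddsWeight.sub (G.measurable_wt hφ)).pow_const 2)

/-- By the normal equations w̃ and w* have the same control moments with each selected feature, and
w* turns control moments into treated ones. The linear weights w̃ therefore balance the selected
features exactly in the population. -/
lemma integral_wt_mul (h : IsPopulation P e m₀) (G : Admissible P e m₀ φ S M₂ M₃)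
    (hφ : IsDictionary P φ c B) (hM₂ : ∀ᵐ z ∂(covLaw P), oddsWeight P e z ≤ M₂) {j : Fin p}
    (hj : j ∈ S) :
    ∫ u, G.wt u.1 * φ u.1 j ∂(armLaw P false) = ∫ u, φ u.1 j ∂(armLaw P true) := by
  have hφj := hφ.measurable_apply j
  have hw := h.measurable_oddsWeight
  have hwt := G.measurable_wt hφ
  have h0 := G.best_weight.integral_mul_eq_zero (G.memLp_sub_wt h hφ hM₂) hj
    (hφ.memLp_controlLaw h j)
  have i1 := (h.memLp_oddsWeight hM₂).integrable_mul (hφ.memLp_controlLaw h j)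
  have i2 := (hφ.memLp_linComb h G.weight).integrable_mul (hφ.memLp_controlLaw h j)
  simp only [sub_mul] at h0
  have h0' := (integral_sub i1 i2).symm.trans h0
  rw [← h.integral_oddsWeight_mul (F := fun x => φ x.1 j) (by fun_prop),
    ← integral_controlLaw (f := fun z => G.wt z * φ z j) (by fun_prop),
    ← integral_controlLaw (f := fun z => oddsWeight P e z * φ z j) (by fun_prop)]
  exact (sub_eq_zero.1 h0').symm

/-- Boundedness of w̃ makes its products with the features sub-Gaussian with a constant independent
of the selection. -/
lemma abs_wt_le (h : IsPopulation P e m₀) (G : Admissible P e m₀ φ S M₂ M₃)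
    (hM₂ : ∀ᵐ z ∂(covLaw P), oddsWeight P e z ≤ M₂) : ∀ᵐ z ∂(covLaw P), |G.wt z| ≤ 2 * M₂ := by
  filter_upwards [hM₂, G.weight_close] with z h1 h2
  have h3 := h.oddsWeight_pos z
  rw [abs_le] at *
  constructor <;> simp only [wt] <;> linarith

lemma card_pos (G : Admissible P e m₀ φ S M₂ M₃) : 0 < S.card := by
  have hprob : IsProbabilityMeasure (covLaw P) :=
    Measure.isProbabilityMeasure_map measurable_fst.aemeasurable
  obtain ⟨z, hz⟩ := G.linComb_one.exists
  rw [Finset.card_pos, Finset.nonempty_iff_ne_empty]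
  intro h0
  subst h0
  simp [linComb] at hz

/-- A single feature spanning the constants is itself almost surely constant, and population balance
fixes its multiple at 1. Here log|S| = 0, so the rate leaves no room for error and w̃ has to be
known exactly. -/
lemma wt_eq_one (h : IsPopulation P e m₀) (G : Admissible P e m₀ φ S M₂ M₃)
    (hφ : IsDictionary P φ c B) (hM₂ : ∀ᵐ z ∂(covLaw P), oddsWeight P e z ≤ M₂)
    (hS : S.card = 1) : ∀ᵐ z ∂(covLaw P), G.wt z = 1 := by
  have hpr := h.isProbabilityMeasure_armLaw
  have hprob : IsProbabilityMeasure (covLaw P) :=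
    Measure.isProbabilityMeasure_map measurable_fst.aemeasurable
  obtain ⟨j, rfl⟩ := Finset.card_eq_one.1 hS
  have hlc : ∀ (u : ({j} : Finset (Fin p)) → ℝ) z, linComb (φ z) {j} u =
      u ⟨j, Finset.mem_singleton_self j⟩ * φ z j := fun u z => by
    rw [linComb]
    exact Fintype.sum_unique (fun l : ({j} : Finset (Fin p)) => u l * φ z l)
  set a := G.weight ⟨j, Finset.mem_singleton_self j⟩ with ha
  set b := G.one ⟨j, Finset.mem_singleton_self j⟩ with hb
  have hone : ∀ᵐ z ∂(covLaw P), b * φ z j = 1 := by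
    filter_upwards [G.linComb_one] with z hz
    rw [← hz, hlc]
  have hb0 : b ≠ 0 := by
    obtain ⟨z, hz⟩ := hone.exists
    exact left_ne_zero_of_mul (by rw [hz]; exact one_ne_zero)
  have hφj : ∀ᵐ z ∂(covLaw P), φ z j = b⁻¹ := by
    filter_upwards [hone] with z hz
    exact eq_inv_of_mul_eq_one_right hz
  have harm : ∀ t, ∀ᵐ u ∂(armLaw P t), φ u.1 j = b⁻¹ := fun t =>
    (armLaw_absolutelyContinuous P t).ae_le (ae_of_ae_map measurable_fst.aemeasurable hφj)
  have h1 := G.integral_wt_mul h hφ hM₂ (Finset.mem_singleton_self j)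
  have e1 : ∫ u, G.wt u.1 * φ u.1 j ∂(armLaw P false) = a * b⁻¹ * b⁻¹ := by
    rw [integral_congr_ae (g := fun _ => a * b⁻¹ * b⁻¹) ?_]
    · simp
    · filter_upwards [harm false] with u hu
      simp only [wt, hlc, hu, ha]
  have e2 : ∫ u, φ u.1 j ∂(armLaw P true) = b⁻¹ := by
    rw [integral_congr_ae (g := fun _ => b⁻¹) (harm true)]
    simp
  rw [e1, e2] at h1
  have h2 : a * b⁻¹ = 1 := by
    have := inv_ne_zero hb0
    exact mul_right_cancel₀ this (by rw [h1, one_mul])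
  filter_upwards [hφj] with z hz
  rw [wt, hlc, hz, h2]

end Admissible

end Selection

/-! ### Concentration of the averages over one fold. -/

section FoldEvents

variable {𝓩 : Type*} [MeasurableSpace 𝓩] [StandardBorelSpace 𝓩]
  {P : Measure (PotentialUnit 𝓩)} [IsProbabilityMeasure P] {e m₀ : 𝓩 → ℝ} {n p : ℕ}
  {φ : 𝓩 → Fin p → ℝ} {S : Finset (Fin p)} {M₂ M₃ : ℝ} {c : ℝ≥0} {B : ℝ}

/-- The averages over one fold are close to their population values. -/
structure FoldRegular (G : Admissible P e m₀ φ S M₂ M₃) (A : ℝ) (Ic It : Finset (Fin n))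
    (z : Fin n → 𝓩) : Prop where
  one : ∀ i ∈ Ic ∪ It, linComb (φ (z i)) S G.one = 1
  uniform : S.card = 1 → ∀ i ∈ Ic, G.wt (z i) = 1
  weight : ∑ i ∈ Ic, (oddsWeight P e (z i) - G.wt (z i)) ^ 2 ≤
    A * (Ic.card * (approxError (controlLaw P) φ S (oddsWeight P e)).toReal ^ 2)
  regr : ∑ i ∈ Ic, G.res (z i) ^ 2 ≤ A * (Ic.card * (approxError (controlLaw P) φ S m₀).toReal ^ 2)
  bias : ((1 / (Ic.card : ℝ)) * ∑ i ∈ Ic, oddsWeight P e (z i) * G.res (z i) -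
      (1 / (It.card : ℝ)) * ∑ i ∈ It, G.res (z i)) ^ 2 ≤
    A * ((1 / (Ic.card : ℝ) + 1 / (It.card : ℝ)) *
      ((M₂ ^ 2 + M₂) * (approxError (controlLaw P) φ S m₀).toReal ^ 2))
  balance : 2 ≤ S.card → ∀ j ∈ S, |(1 / (It.card : ℝ)) * ∑ i ∈ It, φ (z i) j -
      (1 / (Ic.card : ℝ)) * ∑ i ∈ Ic, G.wt (z i) * φ (z i) j| ≤
    2 * Real.sqrt (A * Real.log S.card / n)

lemma measurableSet_foldRegular (h : IsPopulation P e m₀) (G : Admissible P e m₀ φ S M₂ M₃)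
    (hφ : IsDictionary P φ c B) (A : ℝ) (I : Finset (Fin n) × Finset (Fin n)) :
    MeasurableSet {d : Fin n → PotentialUnit 𝓩 | FoldRegular G A I.1 I.2 fun i => (d i).1} := by
  have hw := h.measurable_oddsWeight
  have hwt := G.measurable_wt hφ
  have hres := G.measurable_res h hφ
  have hφj := hφ.measurable_apply
  have hone : Measurable fun z => linComb (φ z) S G.one := measurable_linComb hφ.meas
  have hset : {d : Fin n → PotentialUnit 𝓩 | FoldRegular G A I.1 I.2 fun i => (d i).1} =
      {d | (∀ i, i ∈ I.1 ∪ I.2 → linComb (φ (d i).1) S G.one = 1) ∧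
      (S.card = 1 → ∀ i, i ∈ I.1 → G.wt (d i).1 = 1) ∧
      (∑ i ∈ I.1, (oddsWeight P e (d i).1 - G.wt (d i).1) ^ 2 ≤
        A * (I.1.card * (approxError (controlLaw P) φ S (oddsWeight P e)).toReal ^ 2)) ∧
      (∑ i ∈ I.1, G.res (d i).1 ^ 2 ≤
        A * (I.1.card * (approxError (controlLaw P) φ S m₀).toReal ^ 2)) ∧
      (((1 / (I.1.card : ℝ)) * ∑ i ∈ I.1, oddsWeight P e (d i).1 * G.res (d i).1 -
          (1 / (I.2.card : ℝ)) * ∑ i ∈ I.2, G.res (d i).1) ^ 2 ≤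
        A * ((1 / (I.1.card : ℝ) + 1 / (I.2.card : ℝ)) *
          ((M₂ ^ 2 + M₂) * (approxError (controlLaw P) φ S m₀).toReal ^ 2))) ∧
      (2 ≤ S.card → ∀ j, j ∈ S → |(1 / (I.2.card : ℝ)) * ∑ i ∈ I.2, φ (d i).1 j -
          (1 / (I.1.card : ℝ)) * ∑ i ∈ I.1, G.wt (d i).1 * φ (d i).1 j| ≤
        2 * Real.sqrt (A * Real.log S.card / n))} := by
    ext d
    exact ⟨fun ⟨h1, h2, h3, h4, h5, h6⟩ => ⟨h1, h2, h3, h4, h5, h6⟩,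
      fun ⟨h1, h2, h3, h4, h5, h6⟩ => ⟨h1, h2, h3, h4, h5, h6⟩⟩
  rw [hset]
  refine Measurable.setOf (Measurable.and (Measurable.forall fun i =>
    Measurable.imp measurable_const ?_) (Measurable.and (Measurable.imp measurable_const
    (Measurable.forall fun i => Measurable.imp measurable_const ?_)) (Measurable.and ?_
    (Measurable.and ?_ (Measurable.and ?_ (Measurable.imp measurable_const
    (Measurable.forall fun j => Measurable.imp measurable_const ?_)))))))
  · refine measurableSet_setOfPred.1 (measurableSet_eq_fun ?_ ?_) <;> fun_prop
  · refine measurableSet_setOfPred.1 (measurableSet_eq_fun ?_ ?_) <;> fun_prop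
  · refine measurableSet_setOfPred.1 (measurableSet_le ?_ ?_) <;> fun_prop
  · refine measurableSet_setOfPred.1 (measurableSet_le ?_ ?_) <;> fun_prop
  · refine measurableSet_setOfPred.1 (measurableSet_le ?_ ?_) <;> fun_prop
  · have := hφj j
    refine measurableSet_setOfPred.1 (measurableSet_le ?_ ?_) <;> fun_prop

/-- For a ≥ 1 the quantity s·e^{−a log s} is nonincreasing in s, so s = 2 is the worst case, and
e^{−x} ≤ 1/x finishes. The union bound over the selected features is thus uniformly small once the
threshold constant is large. -/
lemma card_mul_exp_le {s : ℕ} (hs : 2 ≤ s) {a : ℝ} (ha : 1 ≤ a) :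
    s * (2 * Real.exp (-(a * Real.log s))) ≤ 4 / (a * Real.log 2) := by
  have hl2 : 0 < Real.log 2 := Real.log_pos one_lt_two
  have hs0 : (0 : ℝ) < s := by positivity
  have hls : Real.log 2 ≤ Real.log s := Real.log_le_log two_pos (by exact_mod_cast hs)
  have h1 : (s : ℝ) * Real.exp (-(a * Real.log s)) = Real.exp (-((a - 1) * Real.log s)) := by
    nth_rw 1 [← Real.exp_log hs0]
    rw [← Real.exp_add]; ring_nf
  have h2 : Real.exp (-((a - 1) * Real.log s)) ≤ Real.exp (Real.log 2 - a * Real.log 2) := by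
    rw [Real.exp_le_exp]; nlinarith
  have h3 : Real.exp (-(a * Real.log 2)) ≤ 1 / (a * Real.log 2) := by
    rw [Real.exp_neg, ← one_div]
    exact one_div_le_one_div_of_le (by positivity) ((Real.add_one_le_exp _).trans' (by linarith))
  calc s * (2 * Real.exp (-(a * Real.log s))) = 2 * (s * Real.exp (-(a * Real.log s))) := by ring
    _ ≤ 2 * Real.exp (Real.log 2 - a * Real.log 2) := by rw [h1]; gcongr
    _ = 4 * Real.exp (-(a * Real.log 2)) := by
        rw [sub_eq_add_neg, Real.exp_add, Real.exp_log two_pos]; ring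
    _ ≤ 4 * (1 / (a * Real.log 2)) := by gcongr
    _ = _ := by ring

/-- Fluctuations of the averages of the selected features, in units of the log-cardinality. -/
lemma IsPopulation.armPi_exists_sqrt_lt_le (h : IsPopulation P e m₀) (t : Fin n → Bool) {b : Bool}
    {I : Finset (Fin n)} (hI : ∀ i ∈ I, t i = b) {f : Fin p → PotentialUnit 𝓩 → ℝ}
    (hf : ∀ j, Measurable (f j)) {C : ℝ≥0} (hC : 0 < C)
    (hsub : ∀ j, HasSubgaussianMGF (fun u => f j u - ∫ u, f j u ∂(armLaw P b)) C (armLaw P b))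
    {A c₀ : ℝ} (hc₀ : 0 < c₀) (hA : 2 * C ≤ c₀ * A) (hcard : c₀ * n ≤ I.card) (hn : 0 < n)
    (hS : 2 ≤ S.card) :
    armPi P t {d | ∃ j ∈ S, I.card * Real.sqrt (A * Real.log S.card / n) <
        |∑ i ∈ I, (f j (d i) - ∫ u, f j u ∂(armLaw P b))|} ≤
      ENNReal.ofReal (8 * C / (c₀ * Real.log 2) / A) := by
  have hC' : (0 : ℝ) < C := by exact_mod_cast hC
  have hA0 : 0 < A := by
    by_contra! hle
    nlinarith
  have hn' : (0 : ℝ) < n := by exact_mod_cast hn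
  have hls : 0 ≤ Real.log S.card := Real.log_natCast_nonneg _
  have hl2 : 0 < Real.log 2 := Real.log_pos one_lt_two
  refine (measure_mono ?_).trans ((h.armPi_exists_le t hI S (fun j _ => hf j) (fun j _ => hsub j)
    (Real.sqrt_nonneg (A * Real.log S.card / n))).trans (ENNReal.ofReal_le_ofReal ?_))
  · rintro d ⟨j, hj, hd⟩
    exact ⟨j, hj, hd.le⟩
  · rw [Real.sq_sqrt (by positivity)]
    have ha : 1 ≤ c₀ * A / (2 * C) := by rw [le_div_iff₀ (by positivity)]; linarith
    calc S.card * (2 * Real.exp (-(I.card * (A * Real.log S.card / n) / (2 * C))))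
        ≤ S.card * (2 * Real.exp (-(c₀ * A / (2 * C) * Real.log S.card))) := by
          gcongr
          calc c₀ * A / (2 * C) * Real.log S.card
              = c₀ * n * (A * Real.log S.card / n) / (2 * C) := by field_simp
            _ ≤ I.card * (A * Real.log S.card / n) / (2 * C) := by gcongr
      _ ≤ 4 / (c₀ * A / (2 * C) * Real.log 2) := card_mul_exp_le hS ha
      _ = _ := by field_simp; norm_num

variable (P) in
/-- A common sub-Gaussian constant for the features and their products with bounded weights. -/
def IsArmSubgaussian (c : ℝ≥0) (B L : ℝ) (C : ℝ≥0) : Prop :=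
  ∀ (f l : 𝓩 → ℝ) (b : Bool), Measurable f → Measurable l →
    |∫ z, f z ∂(covLaw P)| ≤ B →
    HasSubgaussianMGF (fun z => f z - ∫ z', f z' ∂(covLaw P)) c (covLaw P) →
    (∀ᵐ z ∂(covLaw P), |l z| ≤ L) →
    HasSubgaussianMGF (fun u : PotentialUnit 𝓩 =>
      l u.1 * f u.1 - ∫ u, l u.1 * f u.1 ∂(armLaw P b)) C (armLaw P b)

/-- The two averages of the residual have the same mean, since w* carries controls to treated. Their
difference is centred, and w* ≤ M₂ bounds the second moments by M₂²ε² on controls and M₂ε² on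
treated; Markov's inequality gives the claim. -/
lemma Admissible.armPi_bias_le (h : IsPopulation P e m₀) (G : Admissible P e m₀ φ S M₂ M₃)
    (hφ : IsDictionary P φ c B) (hM₂ : ∀ᵐ z ∂(covLaw P), oddsWeight P e z ≤ M₂)
    (hm : MemLp m₀ 2 (controlLaw P)) (t : Fin n → Bool) {Ic It : Finset (Fin n)}
    (hIc : ∀ i ∈ Ic, t i = false) (hIt : ∀ i ∈ It, t i = true) (hIc0 : Ic.Nonempty)
    (hIt0 : It.Nonempty) {A : ℝ} (hA : 0 < A) :
    armPi P t {d | A * ((1 / (Ic.card : ℝ) + 1 / (It.card : ℝ)) *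
        ((M₂ ^ 2 + M₂) * (approxError (controlLaw P) φ S m₀).toReal ^ 2)) <
      ((1 / (Ic.card : ℝ)) * ∑ i ∈ Ic, oddsWeight P e (d i).1 * G.res (d i).1 -
        (1 / (It.card : ℝ)) * ∑ i ∈ It, G.res (d i).1) ^ 2} ≤ ENNReal.ofReal (1 / A) := by
  classical
  have hw := h.measurable_oddsWeight
  have hres := G.measurable_res h hφ
  have hprob := h.isProbabilityMeasure_armPi t
  have hM0 := h.pos_of_oddsWeight_le hM₂
  have hc : (0 : ℝ) < Ic.card := by exact_mod_cast hIc0.card_pos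
  have ht : (0 : ℝ) < It.card := by exact_mod_cast hIt0.card_pos
  have hMP : ∀ b, MemLp (fun u : PotentialUnit 𝓩 => G.res u.1) 2 (armLaw P b) := fun b =>
    h.memLp_armLaw b (h.memLp_treated hM₂ hres (G.memLp_res h hφ hm))
  have hwb : ∀ b, ∀ᵐ u ∂(armLaw P b), oddsWeight P e u.1 ≤ M₂ := fun b =>
    (armLaw_absolutelyContinuous P b).ae_le (ae_of_ae_map measurable_fst.aemeasurable hM₂)
  have hMPw : MemLp (fun u : PotentialUnit 𝓩 => oddsWeight P e u.1 * G.res u.1) 2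
      (armLaw P false) := by
    refine (hMP false).of_le_mul (c := M₂) (Measurable.aestronglyMeasurable (by fun_prop)) ?_
    filter_upwards [hwb false] with u hu
    rw [norm_mul, Real.norm_eq_abs, abs_of_pos (h.oddsWeight_pos _)]
    gcongr
  set εm := (approxError (controlLaw P) φ S m₀).toReal with hεm
  have hε : ∫ u, G.res u.1 ^ 2 ∂(armLaw P false) = εm ^ 2 :=
    (G.approxError_regr_sq h hφ hm).symm
  have hb1 : ∫ u, (oddsWeight P e u.1 * G.res u.1) ^ 2 ∂(armLaw P false) ≤ M₂ ^ 2 * εm ^ 2 := by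
    rw [← hε, ← integral_const_mul]
    refine integral_mono_ae hMPw.integrable_sq ((hMP false).integrable_sq.const_mul _) ?_
    filter_upwards [hwb false] with u hu
    rw [mul_pow]
    have := h.oddsWeight_pos u.1
    gcongr
  have hb2 : ∫ u, G.res u.1 ^ 2 ∂(armLaw P true) ≤ M₂ * εm ^ 2 := by
    rw [← h.integral_oddsWeight_mul (F := fun x => G.res x.1 ^ 2) (by fun_prop), ← hε,
      ← integral_const_mul]
    refine integral_mono_of_nonneg (ae_of_all _ fun u =>
      mul_nonneg (h.oddsWeight_pos _).le (sq_nonneg _))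
      ((hMP false).integrable_sq.const_mul _) ?_
    filter_upwards [hwb false] with u hu
    gcongr
  have hmean : ∫ u, oddsWeight P e u.1 * G.res u.1 ∂(armLaw P false) =
      ∫ u, G.res u.1 ∂(armLaw P true) :=
    h.integral_oddsWeight_mul (F := fun x => G.res x.1) (by fun_prop)
  -- The difference of averages written as one sum of independent terms. The terms are not centred
  -- separately; only the control and treated contributions together cancel.
  let X : Fin n → PotentialUnit 𝓩 → ℝ := fun i u =>
    if i ∈ Ic then (1 / (Ic.card : ℝ)) * (oddsWeight P e u.1 * G.res u.1)
    else if i ∈ It then (-(1 / (It.card : ℝ))) * G.res u.1 else 0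
  have hdisj : ∀ i ∈ It, i ∉ Ic := fun i hi hi' => by
    have := hIc i hi'; rw [hIt i hi] at this; cases this
  have hX1 : ∀ i ∈ Ic, X i = fun u => (1 / (Ic.card : ℝ)) * (oddsWeight P e u.1 * G.res u.1) :=
    fun i hi => by ext u; simp [X, hi]
  have hX2 : ∀ i ∈ It, X i = fun u => (-(1 / (It.card : ℝ))) * G.res u.1 :=
    fun i hi => by ext u; simp [X, hi, hdisj i hi]
  have hX3 : ∀ i, i ∉ Ic → i ∉ It → X i = fun _ => 0 :=
    fun i hi hi' => by ext u; simp [X, hi, hi']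
  have hsplit : ∀ F : Fin n → ℝ, (∀ i, i ∉ Ic → i ∉ It → F i = 0) →
      ∑ i, F i = ∑ i ∈ Ic, F i + ∑ i ∈ It, F i := fun F hF => by
    rw [← Finset.sum_union (Finset.disjoint_left.2 fun i hi hi' => hdisj i hi' hi)]
    refine (Finset.sum_subset (Finset.subset_univ _) fun i _ hi => ?_).symm
    rw [Finset.mem_union, not_or] at hi
    exact hF i hi.1 hi.2
  have hXm : ∀ i, MemLp (X i) 2 (armLaw P (t i)) := fun i => by
    by_cases h1 : i ∈ Ic
    · rw [hX1 i h1, hIc i h1]; exact hMPw.const_mul _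
    · by_cases h2 : i ∈ It
      · rw [hX2 i h2]; exact (hMP _).const_mul _
      · rw [hX3 i h1 h2]; exact MemLp.zero
  have hX0 : ∑ i, ∫ u, X i u ∂(armLaw P (t i)) = 0 := by
    rw [hsplit _ fun i h1 h2 => by rw [hX3 i h1 h2]; simp,
      Finset.sum_congr rfl fun i hi => by rw [hX1 i hi, hIc i hi, integral_const_mul, hmean],
      Finset.sum_congr (s₁ := It) rfl fun i hi => by rw [hX2 i hi, hIt i hi, integral_const_mul]]
    simp only [Finset.sum_const, nsmul_eq_mul]
    field_simp
    ring
  have hsum : ∀ d : Fin n → PotentialUnit 𝓩, ∑ i, X i (d i) =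
      (1 / (Ic.card : ℝ)) * ∑ i ∈ Ic, oddsWeight P e (d i).1 * G.res (d i).1 -
        (1 / (It.card : ℝ)) * ∑ i ∈ It, G.res (d i).1 := fun d => by
    rw [hsplit _ fun i h1 h2 => by rw [hX3 i h1 h2],
      Finset.sum_congr rfl fun i hi => by rw [hX1 i hi],
      Finset.sum_congr (s₁ := It) rfl fun i hi => by rw [hX2 i hi],
      ← Finset.mul_sum, ← Finset.mul_sum]
    ring
  obtain ⟨i1, i2⟩ := h.integral_sq_sum_armPi_le t hXm hX0
  simp_rw [hsum] at i1 i2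
  refine measure_mul_integral_lt_le i1 (ae_of_all _ fun d => sq_nonneg _) (i2.trans ?_) hA
  rw [hsplit _ fun i h1 h2 => by rw [hX3 i h1 h2]; simp,
    Finset.sum_congr rfl fun i hi => by
      rw [hX1 i hi, hIc i hi],
    Finset.sum_congr (s₁ := It) rfl fun i hi => by rw [hX2 i hi, hIt i hi]]
  simp only [Finset.sum_const, nsmul_eq_mul, mul_pow (1 / (Ic.card : ℝ)),
    mul_pow (-(1 / (It.card : ℝ))), integral_const_mul]
  have e1 : (Ic.card : ℝ) * ((1 / (Ic.card : ℝ)) ^ 2 *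
      ∫ u, (oddsWeight P e u.1 * G.res u.1) ^ 2 ∂(armLaw P false)) ≤
      1 / (Ic.card : ℝ) * (M₂ ^ 2 * εm ^ 2) := by
    calc _ = 1 / (Ic.card : ℝ) *
        ∫ u, (oddsWeight P e u.1 * G.res u.1) ^ 2 ∂(armLaw P false) := by field_simp
      _ ≤ _ := by gcongr
  have e2 : (It.card : ℝ) * ((-(1 / (It.card : ℝ))) ^ 2 *
      ∫ u, G.res u.1 ^ 2 ∂(armLaw P true)) ≤ 1 / (It.card : ℝ) * (M₂ * εm ^ 2) := by
    calc _ = 1 / (It.card : ℝ) * ∫ u, G.res u.1 ^ 2 ∂(armLaw P true) := by field_simp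
      _ ≤ _ := by gcongr
  have e3 : 0 ≤ 1 / (Ic.card : ℝ) * (M₂ * εm ^ 2) := by positivity
  have e4 : 0 ≤ 1 / (It.card : ℝ) * (M₂ ^ 2 * εm ^ 2) := by positivity
  calc _ ≤ 1 / (Ic.card : ℝ) * (M₂ ^ 2 * εm ^ 2) + 1 / (It.card : ℝ) * (M₂ * εm ^ 2) :=
        add_le_add e1 e2
    _ ≤ 1 / (Ic.card : ℝ) * (M₂ ^ 2 * εm ^ 2) + 1 / (It.card : ℝ) * (M₂ * εm ^ 2) +
        (1 / (Ic.card : ℝ) * (M₂ * εm ^ 2) + 1 / (It.card : ℝ) * (M₂ ^ 2 * εm ^ 2)) := by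
        linarith
    _ = _ := by ring

/-- With high probability, uniformly in the treatment indicators, the split and the selected set,
the averages over a fold are close to their population values. -/
lemma Admissible.armPi_not_foldRegular_le (h : IsPopulation P e m₀)
    (G : Admissible P e m₀ φ S M₂ M₃) (hφ : IsDictionary P φ c B)
    (hM₂ : ∀ᵐ z ∂(covLaw P), oddsWeight P e z ≤ M₂) (hm : MemLp m₀ 2 (controlLaw P)) {C : ℝ≥0}
    (hC : 0 < C) (hsub : IsArmSubgaussian P c B (2 * M₂ + 1) C) (t : Fin n → Bool)
    {Ic It : Finset (Fin n)} (hIc : ∀ i ∈ Ic, t i = false) (hIt : ∀ i ∈ It, t i = true)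
    {A c₀ : ℝ} (hc₀ : 0 < c₀) (hA : 2 * C ≤ c₀ * A) (hcc : c₀ * n ≤ Ic.card)
    (hct : c₀ * n ≤ It.card) (hn : 0 < n) :
    armPi P t {d | ¬ FoldRegular G A Ic It fun i => (d i).1} ≤
      ENNReal.ofReal ((3 + 16 * C / (c₀ * Real.log 2)) / A) := by
  have hC' : (0 : ℝ) < C := by exact_mod_cast hC
  have hA0 : 0 < A := by
    by_contra! hle
    nlinarith
  have hn' : (0 : ℝ) < n := by exact_mod_cast hn
  have hl2 : 0 < Real.log 2 := Real.log_pos one_lt_two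
  have hM0 := h.pos_of_oddsWeight_le hM₂
  have hc : (0 : ℝ) < Ic.card := lt_of_lt_of_le (by positivity) hcc
  have ht : (0 : ℝ) < It.card := lt_of_lt_of_le (by positivity) hct
  have hIc0 : Ic.Nonempty := Finset.card_pos.1 (by exact_mod_cast hc)
  have hIt0 : It.Nonempty := Finset.card_pos.1 (by exact_mod_cast ht)
  have hw := h.measurable_oddsWeight
  have hwt := G.measurable_wt hφ
  have hres := G.measurable_res h hφ
  have hφj := hφ.measurable_apply
  -- The five ways regularity can fail with positive probability: mean square of w* − w̃, mean
  -- square of r, the bias, the treated feature averages, and the w̃-weighted control feature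
  -- averages. The remaining two clauses of regularity hold almost surely.
  let B1 : Set (Fin n → PotentialUnit 𝓩) := {d | A * (Ic.card *
    ∫ u, (oddsWeight P e u.1 - G.wt u.1) ^ 2 ∂(armLaw P false)) <
    ∑ i ∈ Ic, (oddsWeight P e (d i).1 - G.wt (d i).1) ^ 2}
  let B2 : Set (Fin n → PotentialUnit 𝓩) := {d | A * (Ic.card *
    ∫ u, G.res u.1 ^ 2 ∂(armLaw P false)) < ∑ i ∈ Ic, G.res (d i).1 ^ 2}
  let B3 : Set (Fin n → PotentialUnit 𝓩) := {d | A * ((1 / (Ic.card : ℝ) + 1 / (It.card : ℝ)) *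
        ((M₂ ^ 2 + M₂) * (approxError (controlLaw P) φ S m₀).toReal ^ 2)) <
      ((1 / (Ic.card : ℝ)) * ∑ i ∈ Ic, oddsWeight P e (d i).1 * G.res (d i).1 -
        (1 / (It.card : ℝ)) * ∑ i ∈ It, G.res (d i).1) ^ 2}
  let B4 : Set (Fin n → PotentialUnit 𝓩) := {d | 2 ≤ S.card ∧ ∃ j ∈ S,
    It.card * Real.sqrt (A * Real.log S.card / n) <
        |∑ i ∈ It, (1 * φ (d i).1 j - ∫ u, 1 * φ u.1 j ∂(armLaw P true))|}
  let B5 : Set (Fin n → PotentialUnit 𝓩) := {d | 2 ≤ S.card ∧ ∃ j ∈ S,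
    Ic.card * Real.sqrt (A * Real.log S.card / n) <
        |∑ i ∈ Ic, (G.wt (d i).1 * φ (d i).1 j -
          ∫ u, G.wt u.1 * φ u.1 j ∂(armLaw P false))|}
  have h1 : armPi P t B1 ≤ ENNReal.ofReal (1 / A) :=
    h.armPi_sum_lt_le t hIc (f := fun u => (oddsWeight P e u.1 - G.wt u.1) ^ 2)
      (fun u => sq_nonneg _) (MemLp.integrable_sq
        ((G.memLp_sub_wt h hφ hM₂).comp_of_map measurable_fst.aemeasurable)) hA0
  have h2 : armPi P t B2 ≤ ENNReal.ofReal (1 / A) :=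
    h.armPi_sum_lt_le t hIc (f := fun u => G.res u.1 ^ 2) (fun u => sq_nonneg _)
      (MemLp.integrable_sq ((G.memLp_res h hφ hm).comp_of_map measurable_fst.aemeasurable)) hA0
  have h3 : armPi P t B3 ≤ ENNReal.ofReal (1 / A) :=
    G.armPi_bias_le h hφ hM₂ hm t hIc hIt hIc0 hIt0 hA0
  -- Treated averages use the constant multiplier 1 and control averages the multiplier w̃, bounded
  -- by 2M₂; the level 2M₂ + 1 in `hsub` covers both.
  have h4 : armPi P t B4 ≤ ENNReal.ofReal (8 * C / (c₀ * Real.log 2) / A) := by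
    by_cases hS : 2 ≤ S.card
    · simp only [B4, hS, true_and]
      exact h.armPi_exists_sqrt_lt_le t hIt (f := fun j u => 1 * φ u.1 j)
        (fun j => by have := hφj j; fun_prop) hC
        (fun j => hsub (fun z => φ z j) (fun _ => 1) true (hφj j) measurable_const (hφ.mean_le j)
          (hφ.subgaussian j) (ae_of_all _ fun z => by rw [abs_one]; linarith)) hc₀ hA hct hn hS
    · simp [B4, hS]
  have h5 : armPi P t B5 ≤ ENNReal.ofReal (8 * C / (c₀ * Real.log 2) / A) := by
    by_cases hS : 2 ≤ S.card
    · simp only [B5, hS, true_and]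
      exact h.armPi_exists_sqrt_lt_le t hIc (f := fun j u => G.wt u.1 * φ u.1 j)
        (fun j => by have := hφj j; fun_prop) hC
        (fun j => hsub (fun z => φ z j) G.wt false (hφj j) hwt (hφ.mean_le j)
          (hφ.subgaussian j) ((G.abs_wt_le h hM₂).mono fun z hz => by linarith)) hc₀ hA hcc hn hS
    · simp [B5, hS]
  have hae1 := h.ae_armPi t G.linComb_one
  have hae2 : ∀ᵐ d ∂(armPi P t), S.card = 1 → ∀ i, G.wt (d i).1 = 1 := by
    by_cases hS : S.card = 1
    · filter_upwards [h.ae_armPi t (G.wt_eq_one h hφ hM₂ hS)] with d hd _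
      exact hd
    · exact ae_of_all _ fun d hS' => absurd hS' hS
  have hle : {d : Fin n → PotentialUnit 𝓩 | ¬ FoldRegular G A Ic It fun i => (d i).1}
      ≤ᵐ[armPi P t] (B1 ∪ (B2 ∪ (B3 ∪ (B4 ∪ B5))) : Set (Fin n → PotentialUnit 𝓩)) := by
    filter_upwards [hae1, hae2] with d hd1 hd2 hd
    by_contra hcon
    have hcon' : d ∉ B1 ∪ (B2 ∪ (B3 ∪ (B4 ∪ B5))) := hcon
    simp only [Set.mem_union, not_or] at hcon'
    obtain ⟨n1, n2, n3, n4, n5⟩ := hcon'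
    refine hd ⟨fun i _ => hd1 i, fun hS i _ => hd2 hS i, ?_, ?_, not_lt.1 n3, fun hS j hj => ?_⟩
    · rw [G.approxError_weight_sq h hφ hM₂]; exact not_lt.1 n1
    · rw [G.approxError_regr_sq h hφ hm]; exact not_lt.1 n2
    · have m4 : |∑ i ∈ It, (1 * φ (d i).1 j - ∫ u, 1 * φ u.1 j ∂(armLaw P true))| ≤
          It.card * Real.sqrt (A * Real.log S.card / n) :=
        not_lt.1 fun hlt => n4 ⟨hS, j, hj, hlt⟩
      have m5 : |∑ i ∈ Ic, (G.wt (d i).1 * φ (d i).1 j -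
          ∫ u, G.wt u.1 * φ u.1 j ∂(armLaw P false))| ≤
          Ic.card * Real.sqrt (A * Real.log S.card / n) :=
        not_lt.1 fun hlt => n5 ⟨hS, j, hj, hlt⟩
      -- By population balance the weighted control average has the treated mean as its expectation,
      -- so both averages fluctuate around the same E and the imbalance of w̃ is a sum of two
      -- fluctuations.
      rw [G.integral_wt_mul h hφ hM₂ hj] at m5
      simp only [one_mul] at m4
      set E := ∫ u, φ u.1 j ∂(armLaw P true)
      set y := Real.sqrt (A * Real.log S.card / n)
      have k4 : |(1 / (It.card : ℝ)) * ∑ i ∈ It, (φ (d i).1 j - E)| ≤ y := by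
        rw [abs_mul, abs_of_pos (by positivity), one_div, inv_mul_le_iff₀ ht]; exact m4
      have k5 : |(1 / (Ic.card : ℝ)) * ∑ i ∈ Ic, (G.wt (d i).1 * φ (d i).1 j - E)| ≤ y := by
        rw [abs_mul, abs_of_pos (by positivity), one_div, inv_mul_le_iff₀ hc]; exact m5
      have heq : (1 / (It.card : ℝ)) * ∑ i ∈ It, φ (d i).1 j -
          (1 / (Ic.card : ℝ)) * ∑ i ∈ Ic, G.wt (d i).1 * φ (d i).1 j =
          (1 / (It.card : ℝ)) * ∑ i ∈ It, (φ (d i).1 j - E) -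
          (1 / (Ic.card : ℝ)) * ∑ i ∈ Ic, (G.wt (d i).1 * φ (d i).1 j - E) := by
        simp only [Finset.sum_sub_distrib, Finset.sum_const, nsmul_eq_mul]
        field_simp
        ring
      rw [heq, two_mul]
      exact (abs_sub _ _).trans (add_le_add k4 k5)
  refine (measure_mono_ae hle).trans ?_
  have hpos : 0 ≤ 8 * C / (c₀ * Real.log 2) / A := by positivity
  have h1A : 0 ≤ 1 / A := by positivity
  calc armPi P t (B1 ∪ (B2 ∪ (B3 ∪ (B4 ∪ B5))))
      ≤ ENNReal.ofReal (1 / A) + (ENNReal.ofReal (1 / A) + (ENNReal.ofReal (1 / A) +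
        (ENNReal.ofReal (8 * C / (c₀ * Real.log 2) / A) +
          ENNReal.ofReal (8 * C / (c₀ * Real.log 2) / A)))) :=
        (measure_union_le _ _).trans (add_le_add h1 ((measure_union_le _ _).trans
          (add_le_add h2 ((measure_union_le _ _).trans (add_le_add h3
            ((measure_union_le _ _).trans (add_le_add h4 h5)))))))
    _ = ENNReal.ofReal ((3 + 16 * C / (c₀ * Real.log 2)) / A) := by
        rw [← ENNReal.ofReal_add hpos hpos, ← ENNReal.ofReal_add h1A (by positivity),
          ← ENNReal.ofReal_add h1A (by positivity), ← ENNReal.ofReal_add h1A (by positivity)]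
        congr 1
        ring

end FoldEvents

/-! ### Outcome noise carried by the balancing weights. -/

lemma measurable_of_countable_cases {α β ι : Type*} [MeasurableSpace α] [MeasurableSpace β]
    [Countable ι] {τ : α → ι} (hτ : ∀ i, MeasurableSet {x | τ x = i}) {F : ι → α → β}
    (hF : ∀ i, Measurable (F i)) : Measurable fun x => F (τ x) x := by
  intro C hC
  have : (fun x => F (τ x) x) ⁻¹' C = ⋃ i, {x | τ x = i} ∩ F i ⁻¹' C := by
    ext x; simp
  rw [this]
  exact MeasurableSet.iUnion fun i => (hτ i).inter (hF i hC)

/-- Units of arm `b` and fold `k`, given the treatment indicators and the fold labels. -/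
def armFold {n : ℕ} (t : Fin n → Bool) (g : Fin n → Fin 2) (b : Bool) (k : Fin 2) :
    Finset (Fin n) :=
  Finset.univ.filter fun i => t i = b ∧ g i = k

lemma trt_of_mem_armFold {n : ℕ} {t : Fin n → Bool} {g : Fin n → Fin 2} {b : Bool} {k : Fin 2}
    {i : Fin n} (hi : i ∈ armFold t g b k) : t i = b := (Finset.mem_filter.1 hi).2.1

lemma label_of_mem_armFold {n : ℕ} {t : Fin n → Bool} {g : Fin n → Fin 2} {b : Bool} {k : Fin 2}
    {i : Fin n} (hi : i ∈ armFold t g b k) : g i = k := (Finset.mem_filter.1 hi).2.2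

/-- A measurable version of the solution of the balancing program. -/
def solution {n p : ℕ} (Ic It : Finset (Fin n)) (S : Finset (Fin p)) :
    (Fin n → Fin p → ℝ) × ℝ → Fin n → ℝ :=
  (exists_measurable_solution Ic It S).choose

@[fun_prop]
lemma measurable_solution {n p : ℕ} (Ic It : Finset (Fin n)) (S : Finset (Fin p)) :
    Measurable (solution Ic It S) := (exists_measurable_solution Ic It S).choose_spec.1

lemma solution_spec {n p : ℕ} {Ic It : Finset (Fin n)} {S : Finset (Fin p)}
    {x : Fin n → Fin p → ℝ} {δ : ℝ} (hx : ∃ w, Balances Ic It S x δ w) :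
    MinimallyBalances Ic It S x δ (solution Ic It S (x, δ)) ∧
      ∀ w, MinimallyBalances Ic It S x δ w → ∀ i ∈ Ic, w i = solution Ic It S (x, δ) i :=
  (exists_measurable_solution Ic It S).choose_spec.2 x δ hx

section Noise

variable {𝓩 𝓤 Ω : Type*} [MeasurableSpace 𝓩] [StandardBorelSpace 𝓩] [MeasurableSpace 𝓤]
  [MeasurableSpace Ω] {P : Measure (PotentialUnit 𝓩)} [IsProbabilityMeasure P] {e m₀ : 𝓩 → ℝ}
  {n p : ℕ} {φ : 𝓩 → Fin p → ℝ}

/-- The balancing weights of fold `k` for given treatment indicators, labels and selected set. -/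
def foldSolution (φ : 𝓩 → Fin p → ℝ) (A : Procedure 𝓩 𝓤 n p) (k : Fin 2) (t : Fin n → Bool)
    (g : Fin n → Fin 2) (S : Finset (Fin p)) (u : 𝓤) (d : Fin n → PotentialUnit 𝓩) : Fin n → ℝ :=
  solution (armFold t g false k) (armFold t g true k) S
    (fun i => φ (d i).1, (A.rule k).tol u g (obsSample d))

lemma measurable_foldSolution (hφ : Measurable φ) (A : Procedure 𝓩 𝓤 n p) (k : Fin 2)
    (t : Fin n → Bool) (g : Fin n → Fin 2) (S : Finset (Fin p)) :
    Measurable fun x : 𝓤 × (Fin n → PotentialUnit 𝓩) => foldSolution φ A k t g S x.1 x.2 := by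
  have h1 : Measurable fun x : 𝓤 × (Fin n → PotentialUnit 𝓩) =>
      (A.rule k).tol x.1 g (obsSample x.2) :=
    ((A.rule k).measurable_tol g).comp
      (measurable_fst.prodMk (measurable_obsSample.comp measurable_snd))
  unfold foldSolution
  refine (measurable_solution _ _ _).comp (Measurable.prodMk ?_ h1)
  fun_prop

/-- The outcome noise carried by the balancing weights of one fold is of the order of the distance
of the weights to the true weight function. -/
lemma IsPopulation.measure_noise_le {μ : Measure Ω} [IsProbabilityMeasure μ]
    (h : IsPopulation P e m₀) {D : ℕ → Ω → PotentialUnit 𝓩} (hDmeas : ∀ i, Measurable (D i))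
    (hDindep : iIndepFun D μ) (hDlaw : ∀ i, μ.map (D i) = P) {U : Ω → 𝓤}
    (hU : Measurable U) (hUindep : IndepFun U (fun ω (i : Fin n) => D i ω) μ)
    (A : Procedure 𝓩 𝓤 n p) (k : Fin 2) (hφ : Measurable φ) {M₁ : ℝ}
    (hresid : Integrable (fun u => (y0 u - m₀ u.1) ^ 2) P)
    (hM₁ : ∀ᵐ u ∂P, (P[fun u => (y0 u - m₀ u.1) ^ 2 | covAlg 𝓩]) u ≤ M₁)
    {b κ : ℝ} (hb : 0 ≤ b) (hκ : 0 < κ) :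
    μ {ω | ∑ i ∈ foldArm (A.labels (U ω) (sample D n ω)) (sample D n ω) false k,
          (foldSolution φ A k (trts fun i : Fin n => D i ω) (A.labels (U ω) (sample D n ω))
            (A.selected k (U ω) (sample D n ω)) (U ω) (fun i => D i ω) i -
              oddsWeight P e (D i ω).1) ^ 2 ≤ b ∧
        κ < (∑ i ∈ foldArm (A.labels (U ω) (sample D n ω)) (sample D n ω) false k,
          (foldSolution φ A k (trts fun i : Fin n => D i ω) (A.labels (U ω) (sample D n ω))
            (A.selected k (U ω) (sample D n ω)) (U ω) (fun i => D i ω) i -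
              oddsWeight P e (D i ω).1) * (y0 (D i ω) - m₀ (D i ω).1)) ^ 2} ≤
      ENNReal.ofReal (M₁ * b / κ) := by
  have hw := h.measurable_oddsWeight
  have hm := h.measurable_m
  -- For a fixed triple of treatments, labels and selected set these statistics are measurable. The
  -- triple takes finitely many values, so measurability survives when it becomes random.
  let stat : (Fin n → Bool) × (Fin n → Fin 2) × Finset (Fin p) →
      𝓤 × (Fin n → PotentialUnit 𝓩) → ℝ × ℝ := fun s x =>
    (∑ i ∈ armFold s.1 s.2.1 false k,
        (foldSolution φ A k s.1 s.2.1 s.2.2 x.1 x.2 i - oddsWeight P e (x.2 i).1) ^ 2,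
      (∑ i ∈ armFold s.1 s.2.1 false k,
        (foldSolution φ A k s.1 s.2.1 s.2.2 x.1 x.2 i - oddsWeight P e (x.2 i).1) *
          (y0 (x.2 i) - m₀ (x.2 i).1)) ^ 2)
  have hstat : ∀ s, Measurable (stat s) := fun s => by
    have := measurable_foldSolution hφ A k s.1 s.2.1 s.2.2
    have := fun i => (measurable_pi_apply i).comp this
    simp only [Function.comp_def] at this
    refine Measurable.prodMk ?_ ?_ <;> fun_prop
  let τ : 𝓤 × (Fin n → PotentialUnit 𝓩) → (Fin n → Bool) × (Fin n → Fin 2) × Finset (Fin p) :=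
    fun x => (trts x.2, A.split.fold x.1 (trts x.2),
      (A.rule k).select x.1 (A.split.fold x.1 (trts x.2)) (obsSample x.2))
  have hsel : ∀ g S, MeasurableSet
      {x : 𝓤 × (Fin n → PotentialUnit 𝓩) | (A.rule k).select x.1 g (obsSample x.2) = S} :=
    fun g S => (measurable_fst.prodMk (measurable_obsSample.comp measurable_snd))
      ((A.rule k).measurable_select g S)
  have hτ : ∀ s, MeasurableSet {x | τ x = s} := by
    rintro ⟨t, g, S⟩
    have : {x | τ x = (t, g, S)} = {x | trts x.2 = t} ∩ {x | A.split.fold x.1 t = g} ∩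
        {x | (A.rule k).select x.1 g (obsSample x.2) = S} := by
      ext x
      simp only [τ, Prod.mk.injEq, Set.mem_ofPred_eq, Set.mem_inter_iff]
      constructor
      · rintro ⟨rfl, rfl, rfl⟩; exact ⟨⟨rfl, rfl⟩, rfl⟩
      · rintro ⟨⟨rfl, rfl⟩, rfl⟩; exact ⟨rfl, rfl, rfl⟩
    rw [this]
    exact ((measurable_snd (measurableSet_trts t)).inter
      (((A.split.measurable_fold t).comp measurable_fst) (measurableSet_singleton g))).inter
      (hsel g S)
  have hmeas : Measurable fun x => stat (τ x) x := measurable_of_countable_cases hτ hstat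
  let E : Set (𝓤 × (Fin n → PotentialUnit 𝓩)) :=
    (fun x => stat (τ x) x) ⁻¹' {y | y.1 ≤ b ∧ κ < y.2}
  have hE : MeasurableSet E := hmeas
    ((measurableSet_le measurable_fst measurable_const).inter
      (measurableSet_lt measurable_const measurable_snd))
  refine (measure_sample_le h hDmeas hDindep hDlaw hU hUindep hE fun u t => ?_ :)
  set g := A.split.fold u t with hg
  set I := armFold t g false k with hI
  have hprob := h.isProbabilityMeasure_armPi t
  let W : (Fin n → PotentialUnit 𝓩) → Fin n → ℝ := fun d =>
    foldSolution φ A k t g ((A.rule k).select u g (obsSample d)) u d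
  have hW : ∀ i, Measurable fun d => W d i := fun i =>
    measurable_of_countable_cases (τ := fun d => (A.rule k).select u g (obsSample d))
      (fun S => measurable_prodMk_left (hsel g S))
      (F := fun S d => foldSolution φ A k t g S u d i)
      (fun S => (measurable_pi_apply i).comp
        ((measurable_foldSolution hφ A k t g S).comp measurable_prodMk_left))
  -- Setting the coefficients to zero when their sum of squares exceeds the budget gives a bound
  -- valid for every sample. On the event of interest nothing is changed.
  let a : Fin n → (Fin n → PotentialUnit 𝓩) → ℝ := fun i d =>
    if ∑ j ∈ I, (W d j - oddsWeight P e (d j).1) ^ 2 ≤ b then W d i - oddsWeight P e (d i).1 else 0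
  have ha : ∀ i, Measurable (a i) := fun i =>
    Measurable.ite (measurableSet_le (by fun_prop) measurable_const) (by fun_prop) measurable_const
  have hB : ∀ d, ∑ i ∈ I, a i d ^ 2 ≤ b := fun d => by
    by_cases hd : ∑ j ∈ I, (W d j - oddsWeight P e (d j).1) ^ 2 ≤ b
    · simp only [a, hd, if_true]
    · simp [a, hd, hb]
  -- A unit of fold k influences the weights only through its covariates: the selected set and the
  -- tolerance come from the other fold, and treatments and labels are held fixed.
  have hdep : ∀ i ∈ I, ∀ j ∈ I, ∀ d x x', x.1 = x'.1 →
      a j (Function.update d i x) = a j (Function.update d i x') := by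
    intro i hi j _ d x x' hx
    have hother : ∀ l, g l ≠ k → obsSample (Function.update d i x) l =
        obsSample (Function.update d i x') l := fun l hl => by
      have hli : l ≠ i := fun hli => hl (hli ▸ label_of_mem_armFold hi)
      simp only [obsSample, Function.update_of_ne hli]
    have hcov : ∀ l, (Function.update d i x l).1 = (Function.update d i x' l).1 := fun l => by
      by_cases hl : l = i
      · subst hl; simpa using hx
      · simp only [Function.update_of_ne hl]
    have hWeq : W (Function.update d i x) = W (Function.update d i x') := by
      simp only [W, foldSolution]
      rw [(A.rule k).select_otherFold u g _ _ hother, (A.rule k).tol_otherFold u g _ _ hother]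
      simp only [hcov]
    simp only [a, hWeq, hcov]
  obtain ⟨i1, i2⟩ := h.integral_sq_sum_resid_le hresid hM₁ t I ha hB hdep
  have hsub : {d | trts d = t} ∩ {d | (u, d) ∈ E} ⊆
      {d | κ ≤ (∑ i ∈ I, a i d * (y0 (d i) - m₀ (d i).1)) ^ 2} := by
    rintro d ⟨hd, h1, h2⟩
    have hd' : trts d = t := hd
    simp only [stat, τ, hd'] at h1 h2
    have h1' : ∑ j ∈ I, (W d j - oddsWeight P e (d j).1) ^ 2 ≤ b := h1
    have h2' : κ < (∑ i ∈ I, (W d i - oddsWeight P e (d i).1) * (y0 (d i) - m₀ (d i).1)) ^ 2 := h2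
    change κ ≤ (∑ i ∈ I, a i d * (y0 (d i) - m₀ (d i).1)) ^ 2
    simp only [a, h1', if_true]
    exact h2'.le
  refine (measure_mono hsub).trans ?_
  rw [← ofReal_measureReal]
  refine ENNReal.ofReal_le_ofReal ?_
  rw [le_div_iff₀ hκ, mul_comm]
  exact (mul_meas_ge_le_integral_of_nonneg (ae_of_all _ fun d => sq_nonneg _) i1 κ).trans i2

end Noise

/-! ### Error of one fold -/

section FoldError

variable {𝓩 : Type*} [MeasurableSpace 𝓩] [StandardBorelSpace 𝓩]
  {P : Measure (PotentialUnit 𝓩)} [IsProbabilityMeasure P] {e m₀ : 𝓩 → ℝ} {n p : ℕ}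
  {φ : 𝓩 → Fin p → ℝ} {S : Finset (Fin p)} {M₂ M₃ : ℝ} {c : ℝ≥0} {B : ℝ}
  {G : Admissible P e m₀ φ S M₂ M₃} {A : ℝ} {Ic It : Finset (Fin n)} {z : Fin n → 𝓩} {w : Fin n → ℝ}
  {δ ξ : ℝ}

/-- With at least two features, nδ² ≤ 1 ≤ log|S|/log 2, so the tolerance is absorbed into the
logarithm; the constants are 2/log 2 from δ² and 8A from the fluctuation of w̃. With one feature the
right side is zero, and both weights are identically 1. -/
lemma FoldRegular.sum_sq_sub_wt_le (hG : FoldRegular G A Ic It z) (hn : 0 < n) (hA : 0 ≤ A)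
    (hξ : 0 < ξ) (hIc : Ic.Nonempty)
    (hgram : ∀ v : S → ℝ, ξ * l1norm v ^ 2 ≤
      (1 / (n : ℝ)) * ∑ i ∈ Ic, linComb (φ (z i)) S v ^ 2)
    (hw : MinimallyBalances Ic It S (fun i => φ (z i)) δ w) (hδ : n * δ ^ 2 ≤ 1) :
    ∑ i ∈ Ic, (w i - G.wt (z i)) ^ 2 ≤
      Real.log S.card / ξ * (2 / Real.log 2 + 8 * A) := by
  have hn' : (0 : ℝ) < n := by exact_mod_cast hn
  have hl2 : 0 < Real.log 2 := Real.log_pos one_lt_two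
  have hls : 0 ≤ Real.log S.card := Real.log_natCast_nonneg _
  rcases Nat.lt_or_ge 1 S.card with hS | hS
  · have h1 := hw.sum_sq_sub_le hξ hn hgram (η := G.one) (ηw := G.weight)
      (fun i hi => hG.one i (Finset.mem_union_left _ hi)) hIc (hG.balance hS)
    refine h1.trans ?_
    set τ := 2 * Real.sqrt (A * Real.log S.card / n) with hτ
    have hτ2 : τ ^ 2 = 4 * (A * Real.log S.card / n) := by
      rw [hτ, mul_pow, Real.sq_sqrt (by positivity)]; norm_num
    have hcard : (Ic.card : ℝ) ≤ n := by
      exact_mod_cast (Finset.card_le_univ Ic).trans (by simp)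
    have hls2 : Real.log 2 ≤ Real.log S.card := Real.log_le_log two_pos (by exact_mod_cast hS)
    have hsq : (δ + τ) ^ 2 ≤ 2 * δ ^ 2 + 2 * τ ^ 2 := by nlinarith [sq_nonneg (δ - τ)]
    calc (Ic.card : ℝ) ^ 2 * (δ + τ) ^ 2 / (n * ξ)
        ≤ (n : ℝ) ^ 2 * (2 * δ ^ 2 + 2 * τ ^ 2) / (n * ξ) := by gcongr
      _ = (2 * (n * δ ^ 2) + 8 * A * Real.log S.card) / ξ := by
          rw [hτ2]; field_simp; ring
      _ ≤ (2 * (Real.log S.card / Real.log 2) + 8 * A * Real.log S.card) / ξ := by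
          gcongr
          exact hδ.trans ((one_le_div hl2).2 hls2)
      _ = _ := by ring
  · have hS1 : S.card = 1 := le_antisymm hS G.card_pos
    rw [hS1]
    simp only [Nat.cast_one, Real.log_one, zero_div, zero_mul]
    refine (Finset.sum_eq_zero fun i hi => ?_).le
    rw [hw.eq_one_of_card_eq_one hS1 (η := G.one)
      (fun i hi => hG.one i (Finset.mem_union_left _ hi)) i hi, hG.uniform hS1 i hi]
    simp

lemma sum_sq_sub_le_two_mul {ι : Type*} (I : Finset ι) (a b c : ι → ℝ) :
    ∑ i ∈ I, (a i - c i) ^ 2 ≤ 2 * ∑ i ∈ I, (a i - b i) ^ 2 + 2 * ∑ i ∈ I, (c i - b i) ^ 2 := by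
  rw [Finset.mul_sum, Finset.mul_sum, ← Finset.sum_add_distrib]
  exact Finset.sum_le_sum fun i _ => by nlinarith [sq_nonneg (a i + c i - 2 * b i)]

lemma abs_sum_mul_le_sqrt {ι : Type*} (I : Finset ι) (a b : ι → ℝ) :
    |∑ i ∈ I, a i * b i| ≤ Real.sqrt (∑ i ∈ I, a i ^ 2) * Real.sqrt (∑ i ∈ I, b i ^ 2) := by
  rw [← Real.sqrt_mul (Finset.sum_nonneg fun i _ => sq_nonneg _)]
  exact Real.abs_le_sqrt (Finset.sum_mul_sq_le_sq_mul_sq I a b)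

/-- Decomposition of the error of one fold into imbalance, bias, approximation error and noise. -/
lemma Admissible.abs_fold_error_le (G : Admissible P e m₀ φ S M₂ M₃) (hIt : It.Nonempty)
    (hw : Balances Ic It S (fun i => φ (z i)) δ w) (hδ : 0 ≤ δ) (y : Fin n → ℝ) (θ : ℝ) :
    |(1 / (Ic.card : ℝ)) * ∑ i ∈ Ic, w i * y i - θ -
      ((1 / (Ic.card : ℝ)) * ∑ i ∈ Ic, oddsWeight P e (z i) * (y i - m₀ (z i)) +
        (1 / (It.card : ℝ)) * ∑ i ∈ It, (m₀ (z i) - θ))| ≤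
    M₃ * δ + |(1 / (Ic.card : ℝ)) * ∑ i ∈ Ic, oddsWeight P e (z i) * G.res (z i) -
      (1 / (It.card : ℝ)) * ∑ i ∈ It, G.res (z i)| +
    (1 / (Ic.card : ℝ)) * |∑ i ∈ Ic, (w i - oddsWeight P e (z i)) * (y i - m₀ (z i))| +
    (1 / (Ic.card : ℝ)) *
      ((Real.sqrt (∑ i ∈ Ic, (w i - G.wt (z i)) ^ 2) +
        Real.sqrt (∑ i ∈ Ic, (oddsWeight P e (z i) - G.wt (z i)) ^ 2)) *
        Real.sqrt (∑ i ∈ Ic, G.res (z i) ^ 2)) := by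
  have ht : (It.card : ℝ) ≠ 0 := by exact_mod_cast hIt.card_pos.ne'
  set kc := 1 / (Ic.card : ℝ) with hkc
  have hkc0 : 0 ≤ kc := by positivity
  set kt := 1 / (It.card : ℝ) with hkt
  have hkt1 : kt * It.card = 1 := by rw [hkt]; field_simp
  set x : Fin n → Fin p → ℝ := fun i => φ (z i) with hx
  -- T1 is the imbalance of the linear part of m₀, T2 the bias of the residual, T3 the noise. T4 −
  -- T5 is Σ(ŵ − w*)r routed through w̃, so that T4 is governed by the eigenvalue bound and T5 by
  -- the product of approximation errors.
  set T1 := kc * ∑ i ∈ Ic, w i * linComb (x i) S G.regr -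
    kt * ∑ i ∈ It, 1 * linComb (x i) S G.regr with hT1
  set T2 := kc * ∑ i ∈ Ic, oddsWeight P e (z i) * G.res (z i) - kt * ∑ i ∈ It, G.res (z i) with hT2
  set T3 := ∑ i ∈ Ic, (w i - oddsWeight P e (z i)) * (y i - m₀ (z i)) with hT3
  set T4 := ∑ i ∈ Ic, (w i - G.wt (z i)) * G.res (z i) with hT4
  set T5 := ∑ i ∈ Ic, (oddsWeight P e (z i) - G.wt (z i)) * G.res (z i) with hT5
  have hdec : kc * ∑ i ∈ Ic, w i * y i - θ -
      (kc * ∑ i ∈ Ic, oddsWeight P e (z i) * (y i - m₀ (z i)) + kt * ∑ i ∈ It, (m₀ (z i) - θ)) =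
      T1 + T2 + kc * T3 + kc * (T4 - T5) := by
    have e1 : ∑ i ∈ It, (m₀ (z i) - θ) =
        ∑ i ∈ It, 1 * linComb (x i) S G.regr + ∑ i ∈ It, G.res (z i) - It.card * θ := by
      rw [Finset.sum_sub_distrib, Finset.sum_const, nsmul_eq_mul, ← Finset.sum_add_distrib]
      congr 1
      exact Finset.sum_congr rfl fun i _ => by simp only [Admissible.res, hx]; ring
    have e2 : ∑ i ∈ Ic, w i * y i - ∑ i ∈ Ic, oddsWeight P e (z i) * (y i - m₀ (z i)) =
        ∑ i ∈ Ic, w i * linComb (x i) S G.regr + ∑ i ∈ Ic, oddsWeight P e (z i) * G.res (z i) + T3 +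
          (T4 - T5) := by
      simp only [hT3, hT4, hT5]
      rw [← Finset.sum_sub_distrib, ← Finset.sum_sub_distrib, ← Finset.sum_add_distrib,
        ← Finset.sum_add_distrib, ← Finset.sum_add_distrib]
      exact Finset.sum_congr rfl fun i _ => by simp only [Admissible.res, hx]; ring
    rw [e1, hT1, hT2]
    linear_combination kc * e2 + θ * hkt1
  have b1 : |T1| ≤ M₃ * δ := by
    have : T1 = ∑ j, G.regr j * (kc * ∑ i ∈ Ic, w i * x i j - kt * ∑ i ∈ It, x i j) := by
      rw [hT1, linComb_sum_mul, linComb_sum_mul, Finset.mul_sum, Finset.mul_sum,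
        ← Finset.sum_sub_distrib]
      refine Finset.sum_congr rfl fun j _ => ?_
      simp only [one_mul]; ring
    rw [this]
    refine (abs_sum_mul_le_l1norm G.regr
      (a := fun j => kc * ∑ i ∈ Ic, w i * x i j - kt * ∑ i ∈ It, x i j) hw.1).trans ?_
    gcongr
    exact G.l1norm_regr
  have b4 : |T4| ≤ Real.sqrt (∑ i ∈ Ic, (w i - G.wt (z i)) ^ 2) *
      Real.sqrt (∑ i ∈ Ic, G.res (z i) ^ 2) := abs_sum_mul_le_sqrt _ _ _
  have b5 : |T5| ≤ Real.sqrt (∑ i ∈ Ic, (oddsWeight P e (z i) - G.wt (z i)) ^ 2) *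
      Real.sqrt (∑ i ∈ Ic, G.res (z i) ^ 2) := abs_sum_mul_le_sqrt _ _ _
  rw [hdec]
  calc |T1 + T2 + kc * T3 + kc * (T4 - T5)|
      ≤ |T1| + |T2| + |kc * T3| + |kc * (T4 - T5)| := by
        refine (abs_add_le _ _).trans (add_le_add ((abs_add_le _ _).trans (add_le_add ?_ le_rfl))
          le_rfl)
        exact abs_add_le _ _
    _ ≤ |T1| + |T2| + kc * |T3| + kc * (|T4| + |T5|) := by
        rw [abs_mul, abs_mul, abs_of_nonneg hkc0]
        gcongr
        exact abs_sub _ _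
    _ ≤ _ := by
        rw [add_mul]
        gcongr

/-- Quantitative form of `Admissible.abs_fold_error_le` at root-`n` scale. -/
lemma FoldRegular.sqrt_mul_fold_error_le (hG : FoldRegular G A Ic It z) (hn : 0 < n) (hA : 0 ≤ A)
    (hM₂ : 0 ≤ M₂) (hξ : 0 < ξ) {c₀ : ℝ} (hc₀ : 0 < c₀) (hIc : c₀ * n ≤ Ic.card)
    (hIt : c₀ * n ≤ It.card)
    (hgram : ∀ v : S → ℝ, ξ * l1norm v ^ 2 ≤
      (1 / (n : ℝ)) * ∑ i ∈ Ic, linComb (φ (z i)) S v ^ 2)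
    (hw : MinimallyBalances Ic It S (fun i => φ (z i)) δ w) (hδ0 : 0 ≤ δ) (hδ : n * δ ^ 2 ≤ 1)
    (y : Fin n → ℝ) (θ : ℝ) :
    Real.sqrt n * |(1 / (Ic.card : ℝ)) * ∑ i ∈ Ic, w i * y i - θ -
      ((1 / (Ic.card : ℝ)) * ∑ i ∈ Ic, oddsWeight P e (z i) * (y i - m₀ (z i)) +
        (1 / (It.card : ℝ)) * ∑ i ∈ It, (m₀ (z i) - θ))| ≤
    M₃ * (Real.sqrt n * δ) +
    Real.sqrt (2 * A * (M₂ ^ 2 + M₂) / c₀) * (approxError (controlLaw P) φ S m₀).toReal +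
    1 / c₀ * (|∑ i ∈ Ic, (w i - oddsWeight P e (z i)) * (y i - m₀ (z i))| / Real.sqrt n) +
    Real.sqrt (A * (2 / Real.log 2 + 8 * A) / c₀) *
      ((approxError (controlLaw P) φ S m₀).toReal * Real.sqrt (Real.log S.card / ξ)) +
    A * (Real.sqrt n * ((approxError (controlLaw P) φ S (oddsWeight P e)).toReal *
      (approxError (controlLaw P) φ S m₀).toReal)) := by
  have hn' : (0 : ℝ) < n := by exact_mod_cast hn
  have hl2 : 0 < Real.log 2 := Real.log_pos one_lt_two
  have hls : 0 ≤ Real.log S.card := Real.log_natCast_nonneg _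
  have hc : (0 : ℝ) < Ic.card := lt_of_lt_of_le (by positivity) hIc
  have ht : (0 : ℝ) < It.card := lt_of_lt_of_le (by positivity) hIt
  have hIc0 : Ic.Nonempty := Finset.card_pos.1 (by exact_mod_cast hc)
  have hIt0 : It.Nonempty := Finset.card_pos.1 (by exact_mod_cast ht)
  set εm := (approxError (controlLaw P) φ S m₀).toReal
  set εw := (approxError (controlLaw P) φ S (oddsWeight P e)).toReal
  have hεm : 0 ≤ εm := ENNReal.toReal_nonneg
  have hεw : 0 ≤ εw := ENNReal.toReal_nonneg
  set K := 2 / Real.log 2 + 8 * A with hK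
  have hK0 : 0 ≤ K := by positivity
  set l := Real.log S.card / ξ with hl
  have hl0 : 0 ≤ l := by positivity
  have hsn : 0 < Real.sqrt n := Real.sqrt_pos.2 hn'
  have hsn2 : Real.sqrt n * Real.sqrt n = n := Real.mul_self_sqrt hn'.le
  have hinvc : 1 / (Ic.card : ℝ) ≤ 1 / (c₀ * n) := one_div_le_one_div_of_le (by positivity) hIc
  have hinvt : 1 / (It.card : ℝ) ≤ 1 / (c₀ * n) := one_div_le_one_div_of_le (by positivity) hIt
  have hmain := G.abs_fold_error_le hIt0 hw.1 hδ0 y θ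
  have b2 : |(1 / (Ic.card : ℝ)) * ∑ i ∈ Ic, oddsWeight P e (z i) * G.res (z i) -
      (1 / (It.card : ℝ)) * ∑ i ∈ It, G.res (z i)| ≤
      Real.sqrt (2 * A * (M₂ ^ 2 + M₂) / c₀) * εm / Real.sqrt n := by
    have h1 := Real.abs_le_sqrt hG.bias
    refine h1.trans ?_
    rw [← Real.sqrt_sq hεm, ← Real.sqrt_mul (by positivity), ← Real.sqrt_div (by positivity)]
    refine Real.sqrt_le_sqrt ?_
    have hM : 0 ≤ M₂ ^ 2 + M₂ := by positivity
    calc A * ((1 / (Ic.card : ℝ) + 1 / (It.card : ℝ)) * ((M₂ ^ 2 + M₂) * εm ^ 2))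
        ≤ A * ((1 / (c₀ * n) + 1 / (c₀ * n)) * ((M₂ ^ 2 + M₂) * εm ^ 2)) := by gcongr
      _ = _ := by field_simp; ring
  have q1 : Real.sqrt (∑ i ∈ Ic, (w i - G.wt (z i)) ^ 2) ≤ Real.sqrt (l * K) :=
    Real.sqrt_le_sqrt (hG.sum_sq_sub_wt_le hn hA hξ hIc0 hgram hw hδ)
  have q2 : Real.sqrt (∑ i ∈ Ic, (oddsWeight P e (z i) - G.wt (z i)) ^ 2) ≤
      Real.sqrt (A * Ic.card) * εw := by
    refine (Real.sqrt_le_sqrt hG.weight).trans (le_of_eq ?_)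
    rw [← mul_assoc, Real.sqrt_mul (by positivity), Real.sqrt_sq hεw]
  have q3 : Real.sqrt (∑ i ∈ Ic, G.res (z i) ^ 2) ≤ Real.sqrt (A * Ic.card) * εm := by
    refine (Real.sqrt_le_sqrt hG.regr).trans (le_of_eq ?_)
    rw [← mul_assoc, Real.sqrt_mul (by positivity), Real.sqrt_sq hεm]
  have hac : Real.sqrt (A * Ic.card) * Real.sqrt (A * Ic.card) = A * Ic.card :=
    Real.mul_self_sqrt (by positivity)
  -- Cauchy–Schwarz: the residuals have norm of order √n ε(m₀), paired with √(log|S|/ξ) for ŵ − w̃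
  -- and with √n ε(w*) for w* − w̃.
  have b4 : (1 / (Ic.card : ℝ)) *
      ((Real.sqrt (∑ i ∈ Ic, (w i - G.wt (z i)) ^ 2) +
        Real.sqrt (∑ i ∈ Ic, (oddsWeight P e (z i) - G.wt (z i)) ^ 2)) *
        Real.sqrt (∑ i ∈ Ic, G.res (z i) ^ 2)) ≤
      Real.sqrt (A * K / c₀) * (εm * Real.sqrt l) / Real.sqrt n + A * (εw * εm) := by
    calc _ ≤ (1 / (Ic.card : ℝ)) * ((Real.sqrt (l * K) + Real.sqrt (A * Ic.card) * εw) *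
          (Real.sqrt (A * Ic.card) * εm)) := by gcongr
      _ = (1 / (Ic.card : ℝ)) * (Real.sqrt (l * K) * Real.sqrt (A * Ic.card)) * εm +
          (1 / (Ic.card : ℝ)) * (Real.sqrt (A * Ic.card) * Real.sqrt (A * Ic.card)) * (εw * εm) := by
          ring
      _ = (1 / (Ic.card : ℝ)) * (Real.sqrt (l * K) * Real.sqrt (A * Ic.card)) * εm +
          A * (εw * εm) := by
          rw [hac]
          congr 2
          field_simp
      _ ≤ _ := by
          gcongr
          have h1 : (1 / (Ic.card : ℝ)) * (Real.sqrt (l * K) * Real.sqrt (A * Ic.card)) ≤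
              Real.sqrt (A * K / c₀) * Real.sqrt l / Real.sqrt n := by
            rw [← Real.sqrt_mul (by positivity), ← Real.sqrt_mul (by positivity),
              ← Real.sqrt_div (by positivity)]
            refine Real.le_sqrt_of_sq_le ?_
            rw [mul_pow, Real.sq_sqrt (by positivity)]
            calc (1 / (Ic.card : ℝ)) ^ 2 * (l * K * (A * Ic.card)) =
                (1 / (Ic.card : ℝ)) * (l * K * A) := by field_simp
              _ ≤ 1 / (c₀ * n) * (l * K * A) := by gcongr
              _ = _ := by field_simp
          calc _ ≤ Real.sqrt (A * K / c₀) * Real.sqrt l / Real.sqrt n * εm := by gcongr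
            _ = _ := by ring
  have b3 : (1 / (Ic.card : ℝ)) *
      |∑ i ∈ Ic, (w i - oddsWeight P e (z i)) * (y i - m₀ (z i))| ≤
      1 / (c₀ * n) * |∑ i ∈ Ic, (w i - oddsWeight P e (z i)) * (y i - m₀ (z i))| := by
    gcongr
  set T3 := |∑ i ∈ Ic, (w i - oddsWeight P e (z i)) * (y i - m₀ (z i))|
  have hb := hmain.trans (add_le_add (add_le_add (add_le_add le_rfl b2) b3) b4)
  refine (mul_le_mul_of_nonneg_left hb hsn.le).trans (le_of_eq ?_)
  have e3 : Real.sqrt n * (1 / (c₀ * n) * T3) = 1 / c₀ * (T3 / Real.sqrt n) := by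
    rw [show c₀ * (n : ℝ) = c₀ * (Real.sqrt n * Real.sqrt n) by rw [hsn2]]
    generalize Real.sqrt n = s at hsn ⊢
    field_simp
  have e2 : ∀ a : ℝ, Real.sqrt n * (a / Real.sqrt n) = a := fun a => by field_simp
  linear_combination e3 + e2 (Real.sqrt (2 * A * (M₂ ^ 2 + M₂) / c₀) * εm) +
    e2 (Real.sqrt (A * K / c₀) * (εm * Real.sqrt l))

end FoldError

/-! ### Asymptotic linearity on one fold. -/

section Asymptotics

variable {𝓩 𝓤 Ω : Type*} [MeasurableSpace 𝓩] [StandardBorelSpace 𝓩] [MeasurableSpace 𝓤]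
  [MeasurableSpace Ω]

/-- A sequence of events whose (outer) probability tends to zero. -/
def Vanishing (μ : Measure Ω) (E : ℕ → Set Ω) : Prop := Tendsto (fun n => μ (E n)) atTop (𝓝 0)

lemma Vanishing.union {μ : Measure Ω} {E F : ℕ → Set Ω} (hE : Vanishing μ E)
    (hF : Vanishing μ F) : Vanishing μ fun n => E n ∪ F n := by
  have := Tendsto.add hE hF
  rw [add_zero] at this
  exact tendsto_of_tendsto_of_tendsto_of_le_of_le tendsto_const_nhds this (fun _ => zero_le)
    fun n => measure_union_le _ _

lemma vanishing_of_ae {μ : Measure Ω} {p : ℕ → Ω → Prop} (h : ∀ᶠ n in atTop, ∀ᵐ ω ∂μ, p n ω) :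
    Vanishing μ fun n => {ω | ¬ p n ω} :=
  tendsto_const_nhds.congr' (h.mono fun _ hn => (ae_iff.1 hn).symm)

/-- Allows all truncation and threshold constants to be chosen after the target probability η. -/
lemma vanishing_of_forall_le {μ : Measure Ω} {E : ℕ → Set Ω}
    (h : ∀ η : ℝ, 0 < η → ∀ᶠ n in atTop, μ (E n) ≤ ENNReal.ofReal η) : Vanishing μ E := by
  rw [Vanishing, ENNReal.tendsto_nhds_zero]
  intro ε hε
  rcases eq_or_ne ε ∞ with rfl | hε'
  · simp
  · filter_upwards [h ε.toReal (ENNReal.toReal_pos hε.ne' hε')] with n hn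
    rwa [ENNReal.ofReal_toReal hε'] at hn

lemma Vanishing.eventually_le {μ : Measure Ω} {E : ℕ → Set Ω} (h : Vanishing μ E) {η : ℝ}
    (hη : 0 < η) : ∀ᶠ n in atTop, μ (E n) ≤ ENNReal.ofReal η :=
  ENNReal.tendsto_nhds_zero.1 h _ (ENNReal.ofReal_pos.2 hη)

/-- Independent units from `P`, and seeds independent of them. -/
structure IsSampling (μ : Measure Ω) (P : Measure (PotentialUnit 𝓩)) (D : ℕ → Ω → PotentialUnit 𝓩)
    (U : ℕ → Ω → 𝓤) : Prop where
  meas : ∀ i, Measurable (D i)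
  indep : iIndepFun D μ
  law : ∀ i, μ.map (D i) = P
  meas_seed : ∀ n, Measurable (U n)
  indep_seed : ∀ n, IndepFun (U n) (fun ω (i : Fin n) => D i ω) μ

/-- The conditions of the theorem on one fold. -/
structure FoldConditions (μ : Measure Ω) (P : Measure (PotentialUnit 𝓩)) (e m₀ : 𝓩 → ℝ)
    (D : ℕ → Ω → PotentialUnit 𝓩) (U : ℕ → Ω → 𝓤) {p : ℕ → ℕ} (φ : ∀ n, 𝓩 → Fin (p n) → ℝ)
    (A : ∀ n, Procedure 𝓩 𝓤 n (p n)) (k : Fin 2) (M₂ M₃ : ℝ)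
    (ξ : ∀ n, Finset (Fin (p n)) → ℝ) (c₀ : ℝ) : Prop where
  admissible : ∀ᶠ n in atTop, ∀ᵐ ω ∂μ,
    Nonempty (Admissible P e m₀ (φ n) ((A n).selected k (U n ω) (sample D n ω)) M₂ M₃)
  weight : IsLittleOP μ (fun n ω => approxError (controlLaw P) (φ n)
    ((A n).selected k (U n ω) (sample D n ω)) (oddsWeight P e)) (fun _ => 1)
  regr : IsLittleOP μ (fun n ω => approxError (controlLaw P) (φ n)
    ((A n).selected k (U n ω) (sample D n ω)) m₀) (fun _ => 1)
  prod : IsLittleOP μ (fun n ω =>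
    approxError (controlLaw P) (φ n)
        ((A n).selected k (U n ω) (sample D n ω)) (oddsWeight P e) *
      approxError (controlLaw P) (φ n) ((A n).selected k (U n ω) (sample D n ω)) m₀)
    (fun n => 1 / Real.sqrt n)
  tol : IsLittleOP μ
    (fun n ω => ENNReal.ofReal ((A n).tolerance k (U n ω) (sample D n ω)))
    (fun n => 1 / Real.sqrt n)
  eigen_pos : ∀ n S, 0 < ξ n S
  eigen : Vanishing μ (fun n => {ω | ¬ EigenCondition (φ n) (sample D n ω)
    ((A n).labels (U n ω) (sample D n ω)) k ((A n).selected k (U n ω) (sample D n ω))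
    (ξ n ((A n).selected k (U n ω) (sample D n ω)))})
  eigen_log : IsLittleOP μ (fun n ω => ENNReal.ofReal
    (Real.log ((A n).selected k (U n ω) (sample D n ω)).card /
      ξ n ((A n).selected k (U n ω) (sample D n ω)))) (fun n => n)
  eigen_regr : IsLittleOP μ (fun n ω =>
    approxError (controlLaw P) (φ n) ((A n).selected k (U n ω) (sample D n ω)) m₀ *
      ENNReal.ofReal (Real.sqrt
        (Real.log ((A n).selected k (U n ω) (sample D n ω)).card /
          ξ n ((A n).selected k (U n ω) (sample D n ω))))) (fun _ => 1)
  size : ∀ b, Vanishing μ (fun n => {ω | ¬ c₀ * n ≤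
    ((foldArm ((A n).labels (U n ω) (sample D n ω)) (sample D n ω) b k).card : ℝ)})

/-- The linearization of the estimator on one fold. -/
def foldLinear (P : Measure (PotentialUnit 𝓩)) (e m₀ : 𝓩 → ℝ) {n : ℕ} (g : Fin n → Fin 2)
    (k : Fin 2) (d : Fin n → PotentialUnit 𝓩) : ℝ :=
  (1 / ((foldArm g (obsSample d) false k).card : ℝ)) *
      ∑ i ∈ foldArm g (obsSample d) false k, oddsWeight P e (d i).1 * (y0 (d i) - m₀ (d i).1) +
    (1 / ((foldArm g (obsSample d) true k).card : ℝ)) *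
      ∑ i ∈ foldArm g (obsSample d) true k, (m₀ (d i).1 - estimand P)

lemma IsLittleOP.vanishing {μ : Measure Ω} {X : ℕ → Ω → ℝ≥0∞} {r : ℕ → ℝ} (h : IsLittleOP μ X r)
    {c : ℝ} (hc : 0 < c) : Vanishing μ fun n => {ω | ENNReal.ofReal (c * r n) < X n ω} := h c hc

variable {μ : Measure Ω} [IsProbabilityMeasure μ] {P : Measure (PotentialUnit 𝓩)}
  [IsProbabilityMeasure P] {e m₀ : 𝓩 → ℝ} {D : ℕ → Ω → PotentialUnit 𝓩} {U : ℕ → Ω → 𝓤}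
  {p : ℕ → ℕ} {φ : ∀ n, 𝓩 → Fin (p n) → ℝ} {A : ∀ n, Procedure 𝓩 𝓤 n (p n)} {k : Fin 2}
  {M₁ M₂ M₃ : ℝ} {ξ : ∀ n, Finset (Fin (p n)) → ℝ} {c₀ : ℝ} {c : ℝ≥0} {B : ℝ}

/-- Regularity of the averages over one fold has probability close to one. -/
lemma IsPopulation.measure_not_foldRegular_le (h : IsPopulation P e m₀)
    (hs : IsSampling μ P D U) {n : ℕ} (hφ : IsDictionary P (φ n) c B)
    (hM₂ : ∀ᵐ z ∂(covLaw P), oddsWeight P e z ≤ M₂) (hm : MemLp m₀ 2 (controlLaw P)) {C : ℝ≥0}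
    (hC : 0 < C) (hsub : IsArmSubgaussian P c B (2 * M₂ + 1) C) {a : ℝ} (hc₀ : 0 < c₀)
    (ha : 2 * C ≤ c₀ * a) (hn : 0 < n) :
    μ {ω | ∃ G : Nonempty (Admissible P e m₀ (φ n)
          ((A n).selected k (U n ω) (sample D n ω)) M₂ M₃),
        (∀ b, c₀ * n ≤
          ((foldArm ((A n).labels (U n ω) (sample D n ω)) (sample D n ω) b k).card : ℝ)) ∧
        ¬ FoldRegular G.some a
          (foldArm ((A n).labels (U n ω) (sample D n ω)) (sample D n ω) false k)
          (foldArm ((A n).labels (U n ω) (sample D n ω)) (sample D n ω) true k)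
          (fun i => (D i ω).1)} ≤
      ENNReal.ofReal ((3 + 16 * C / (c₀ * Real.log 2)) / a) := by
  have hmeasG := fun {S : Finset (Fin (p n))} (G : Admissible P e m₀ (φ n) S M₂ M₃) =>
    measurableSet_foldRegular (n := n) h G hφ a
  -- Indexed by fixed treatments, labels and selected set. The approximating coefficients are a
  -- chosen witness depending on the set alone, so the event involves the covariates of fold k only.
  let bad : (Fin n → Bool) → (Fin n → Fin 2) → Finset (Fin (p n)) →
      Set (Fin n → PotentialUnit 𝓩) := fun t g S =>
    {d | ∃ G : Nonempty (Admissible P e m₀ (φ n) S M₂ M₃),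
      (∀ b, c₀ * n ≤ ((armFold t g b k).card : ℝ)) ∧
      ¬ FoldRegular G.some a (armFold t g false k) (armFold t g true k) fun i => (d i).1}
  have hbad : ∀ t g S, ∀ G : Nonempty (Admissible P e m₀ (φ n) S M₂ M₃),
      (∀ b, c₀ * n ≤ ((armFold t g b k).card : ℝ)) → bad t g S =
        {d | FoldRegular G.some a (armFold t g false k) (armFold t g true k)
          fun i => (d i).1}ᶜ := fun t g S G hG => by
    ext d
    exact ⟨fun ⟨_, _, hd⟩ => hd, fun hd => ⟨G, hG, hd⟩⟩
  have hbad' : ∀ t g S, ¬ (Nonempty (Admissible P e m₀ (φ n) S M₂ M₃) ∧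
      ∀ b, c₀ * n ≤ ((armFold t g b k).card : ℝ)) → bad t g S = ∅ := fun t g S hG =>
    Set.eq_empty_of_forall_notMem fun d ⟨G, hb, _⟩ => hG ⟨G, hb⟩
  refine measure_fold_event_le h hs.meas hs.indep hs.law (hs.meas_seed n) (hs.indep_seed n) (A n) k
    bad (fun t g S => ?_) (fun t g S d d' hdd => ?_) fun t g S => ?_
  · by_cases hG : Nonempty (Admissible P e m₀ (φ n) S M₂ M₃) ∧
        ∀ b, c₀ * n ≤ ((armFold t g b k).card : ℝ)
    · rw [hbad t g S hG.1 hG.2]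
      exact (hmeasG hG.1.some (armFold t g false k, armFold t g true k)).compl
    · rw [hbad' t g S hG]; exact MeasurableSet.empty
  · rintro ⟨G, hb, hd⟩
    refine ⟨G, hb, fun hd' => hd ?_⟩
    have hc : ∀ i ∈ armFold t g false k, (d i).1 = (d' i).1 := fun i hi => by
      rw [hdd i (label_of_mem_armFold hi)]
    have ht : ∀ i ∈ armFold t g true k, (d i).1 = (d' i).1 := fun i hi => by
      rw [hdd i (label_of_mem_armFold hi)]
    refine ⟨fun i hi => ?_, fun hS i hi => ?_, ?_, ?_, ?_, fun hS j hj => ?_⟩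
    · have : (d i).1 = (d' i).1 := (Finset.mem_union.1 hi).elim (hc i) (ht i)
      rw [this]; exact hd'.one i hi
    · rw [hc i hi]; exact hd'.uniform hS i hi
    · rw [Finset.sum_congr rfl fun i hi => by rw [hc i hi]]; exact hd'.weight
    · rw [Finset.sum_congr rfl fun i hi => by rw [hc i hi]]; exact hd'.regr
    · rw [Finset.sum_congr rfl fun i hi => by rw [hc i hi],
        Finset.sum_congr (s₁ := armFold t g true k) rfl fun i hi => by rw [ht i hi]]
      exact hd'.bias
    · rw [Finset.sum_congr (s₁ := armFold t g false k) rfl fun i hi => by rw [hc i hi],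
        Finset.sum_congr (s₁ := armFold t g true k) rfl fun i hi => by rw [ht i hi]]
      exact hd'.balance hS j hj
  · by_cases hG : Nonempty (Admissible P e m₀ (φ n) S M₂ M₃) ∧
        ∀ b, c₀ * n ≤ ((armFold t g b k).card : ℝ)
    · rw [hbad t g S hG.1 hG.2]
      exact hG.1.some.armPi_not_foldRegular_le h hφ hM₂ hm hC hsub t
        (fun i hi => trt_of_mem_armFold hi) (fun i hi => trt_of_mem_armFold hi) hc₀ ha (hG.2 false)
        (hG.2 true) hn
    · rw [hbad' t g S hG]; simp

/-- On each fold the estimation error equals its linearization up to `o_P(n^{-1/2})`. -/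
lemma FoldConditions.vanishing_fold_error
    (hF : FoldConditions μ P e m₀ D U φ A k M₂ M₃ ξ c₀) (h : IsPopulation P e m₀)
    (hs : IsSampling μ P D U) (hφ : ∀ n, IsDictionary P (φ n) c B) (hc₀ : 0 < c₀)
    (hM₂ : ∀ᵐ z ∂(covLaw P), oddsWeight P e z ≤ M₂) (hm : MemLp m₀ 2 (controlLaw P))
    (hresid : Integrable (fun u => (y0 u - m₀ u.1) ^ 2) P)
    (hM₁ : ∀ᵐ u ∂P, (P[fun u => (y0 u - m₀ u.1) ^ 2 | covAlg 𝓩]) u ≤ M₁) {κ : ℝ} (hκ : 0 < κ) :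
    Vanishing μ fun n => {ω | ¬ ∀ w : Fin n → ℝ,
      ((∃ w', Feasible (φ n) (sample D n ω) ((A n).labels (U n ω) (sample D n ω)) k
          ((A n).selected k (U n ω) (sample D n ω))
          ((A n).tolerance k (U n ω) (sample D n ω)) w') →
        IsSolution (φ n) (sample D n ω) ((A n).labels (U n ω) (sample D n ω)) k
          ((A n).selected k (U n ω) (sample D n ω))
          ((A n).tolerance k (U n ω) (sample D n ω)) w) →
      Real.sqrt n * |(1 / ((foldArm ((A n).labels (U n ω) (sample D n ω))
          (sample D n ω) false k).card : ℝ)) *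
        ∑ i ∈ foldArm ((A n).labels (U n ω) (sample D n ω)) (sample D n ω) false k,
          w i * y0 (D i ω) - estimand P -
          foldLinear P e m₀ ((A n).labels (U n ω) (sample D n ω)) k fun i => D i ω| ≤ κ} := by
  have hM0 := h.pos_of_oddsWeight_le hM₂
  have hM10 := h.nonneg_of_condVar_le hM₁
  have hl2 : 0 < Real.log 2 := Real.log_pos one_lt_two
  obtain ⟨C, hC, hsub⟩ := h.exists_hasSubgaussianMGF_arm c B (2 * M₂ + 1)
  have hsub' : IsArmSubgaussian P c B (2 * M₂ + 1) C := hsub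
  have hC' : (0 : ℝ) < C := by exact_mod_cast hC
  refine vanishing_of_forall_le fun η hη => ?_
  set KC : ℝ := 3 + 16 * C / (c₀ * Real.log 2) with hKC
  have hKC0 : 0 < KC := by positivity
  -- The first summand meets the requirement 2C ≤ c₀a of the maximal inequality; the second makes
  -- the probability of irregular averages at most η/3.
  set a : ℝ := 2 * C / c₀ + KC / (η / 3) with ha
  have ha0 : 0 < a := by positivity
  have ha1 : 2 * C ≤ c₀ * a := by
    have : c₀ * a = 2 * C + c₀ * (KC / (η / 3)) := by rw [ha]; field_simp
    rw [this]
    have : 0 ≤ c₀ * (KC / (η / 3)) := by positivity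
    linarith
  have ha2 : KC / a ≤ η / 3 := by
    rw [div_le_comm₀ ha0 (by positivity), ha]
    have : 0 ≤ 2 * C / c₀ := by positivity
    linarith
  set κ' : ℝ := κ * c₀ / 5 with hκ'
  have hκ'0 : 0 < κ' := by positivity
  -- Budget for n⁻¹Σ(ŵ − w*)², small enough for the noise to exceed its share κ/5 with probability
  -- at most η/3. The denominator is M₁ + 1 because M₁ may be zero.
  set b : ℝ := η / 3 * κ' ^ 2 / (M₁ + 1) with hb
  have hb0 : 0 < b := by positivity
  have hb1 : M₁ * b / κ' ^ 2 ≤ η / 3 := by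
    rw [div_le_iff₀ (by positivity), hb, ← mul_div_assoc, div_le_iff₀ (by positivity)]
    nlinarith [show 0 < η / 3 * κ' ^ 2 by positivity]
  set K : ℝ := 2 / Real.log 2 + 8 * a with hK
  have hK0 : 0 < K := by positivity
  -- The thresholds c1 and c2 each allot half of the budget b: one to ŵ − w̃ through log|S|/(ξn),
  -- the other to w* − w̃ through ε(w*).
  set c1 : ℝ := b / (4 * K) with hc1
  have hc10 : 0 < c1 := by positivity
  set c2 : ℝ := Real.sqrt (b / (4 * a)) with hc2
  have hc20 : 0 < c2 := by positivity
  -- The minimum with 1 secures nδ² ≤ 1. Otherwise c3, c4, c5 and c6 each hold one of the five error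
  -- terms below κ/5, the noise being the fifth.
  set c3 : ℝ := min 1 (κ / 5 / (|M₃| + 1)) with hc3
  have hc30 : 0 < c3 := by positivity
  set L4 : ℝ := Real.sqrt (2 * a * (M₂ ^ 2 + M₂) / c₀) with hL4
  have hL40 : 0 < L4 + 1 := by positivity
  set c4 : ℝ := κ / 5 / (L4 + 1) with hc4
  have hc40 : 0 < c4 := by positivity
  set c5 : ℝ := κ / 5 / a with hc5
  have hc50 : 0 < c5 := by positivity
  set L6 : ℝ := Real.sqrt (a * K / c₀) with hL6
  have hL60 : 0 < L6 + 1 := by positivity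
  set c6 : ℝ := κ / 5 / (L6 + 1) with hc6
  have hc60 : 0 < c6 := by positivity
  have hvan := ((vanishing_of_ae hF.admissible).union (hF.weight.vanishing hc20)).union
    (((hF.regr.vanishing hc40).union (hF.prod.vanishing hc50)).union
      (((hF.tol.vanishing hc30).union hF.eigen).union
        (((hF.eigen_log.vanishing hc10).union (hF.eigen_regr.vanishing hc60)).union
          ((hF.size false).union (hF.size true)))))
  filter_upwards [hvan.eventually_le (show 0 < η / 3 by positivity), eventually_gt_atTop 0]
    with n hvn hn
  have hreg := h.measure_not_foldRegular_le (A := A) (k := k) (M₃ := M₃) hs (hφ n) hM₂ hm hC hsub'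
    hc₀ ha1 hn
  have hn' : (0 : ℝ) < n := by exact_mod_cast hn
  have hnoise := h.measure_noise_le hs.meas hs.indep hs.law (hs.meas_seed n) (hs.indep_seed n) (A n)
    k (hφ n).meas hresid hM₁ (b := b * n) (κ := κ' ^ 2 * n) (by positivity) (by positivity)
  have hnoise' : M₁ * (b * n) / (κ' ^ 2 * n) ≤ η / 3 := by
    rw [← mul_assoc, mul_div_mul_right _ _ hn'.ne']; exact hb1
  have htot : ENNReal.ofReal η = ENNReal.ofReal (η / 3) + (ENNReal.ofReal (η / 3) +
      ENNReal.ofReal (η / 3)) := by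
    rw [← ENNReal.ofReal_add (by positivity) (by positivity),
      ← ENNReal.ofReal_add (by positivity) (by positivity)]
    congr 1; ring
  rw [htot]
  refine le_trans (measure_mono ?_) ((measure_union_le _ _).trans (add_le_add hvn
    ((measure_union_le _ _).trans (add_le_add
      (hreg.trans (ENNReal.ofReal_le_ofReal ha2))
      (hnoise.trans (ENNReal.ofReal_le_ofReal hnoise'))))))
  intro ω hω
  by_contra hcon
  simp only [Set.mem_union, not_or, Set.mem_ofPred_eq, not_not, not_lt] at hcon
  obtain ⟨⟨⟨⟨hadm⟩, hεw⟩, ⟨hεm, hεp⟩, ⟨htol, heig⟩, ⟨hlog, hξm⟩, hszc, hszt⟩, hR, hN⟩ := hcon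
  refine hω fun w hw => ?_
  set d : Fin n → PotentialUnit 𝓩 := fun i => D i ω with hd
  set g := (A n).labels (U n ω) (sample D n ω) with hg
  set S := (A n).selected k (U n ω) (sample D n ω) with hS
  set δ := (A n).tolerance k (U n ω) (sample D n ω) with hδ
  set Ic := foldArm g (sample D n ω) false k with hIc
  set It := foldArm g (sample D n ω) true k with hIt
  -- The canonical witness rather than `hadm` itself, because the regularity event is stated for
  -- that choice.
  set G := (Nonempty.intro hadm).some with hG
  have hGreg : FoldRegular G a Ic It fun i => (d i).1 := by
    by_contra hcon
    exact hR ⟨⟨hadm⟩, Bool.forall_bool.2 ⟨hszc, hszt⟩, hcon⟩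
  have hξ0 := hF.eigen_pos n S
  have hcpos : (0 : ℝ) < Ic.card := lt_of_lt_of_le (by positivity) hszc
  have htpos : (0 : ℝ) < It.card := lt_of_lt_of_le (by positivity) hszt
  have hδ0 : 0 ≤ δ := (A n |>.rule k).tol_nonneg _ _ _
  have hsn : 0 < Real.sqrt n := Real.sqrt_pos.2 hn'
  have hsn2 : Real.sqrt n ^ 2 = n := Real.sq_sqrt hn'.le
  have hδ1 : Real.sqrt n * δ ≤ c3 := by
    have h1 : δ ≤ c3 * (1 / Real.sqrt n) := (ENNReal.ofReal_le_ofReal_iff (by positivity)).1 htol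
    rw [mul_one_div, le_div_iff₀ hsn] at h1
    linarith
  have hδ2 : n * δ ^ 2 ≤ 1 := by
    have h1 : Real.sqrt n * δ ≤ 1 := hδ1.trans (min_le_left _ _)
    calc n * δ ^ 2 = (Real.sqrt n * δ) ^ 2 := by rw [mul_pow, hsn2]
      _ ≤ 1 := pow_le_one₀ (by positivity) h1
  have hgram : ∀ v : S → ℝ, ξ n S * l1norm v ^ 2 ≤
      (1 / (n : ℝ)) * ∑ i ∈ Ic, linComb (φ n (d i).1) S v ^ 2 := heig
  -- On the good event the program is feasible, so the given weights do solve it and the arbitrary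
  -- weights allowed in the infeasible case play no role.
  have hfeas := exists_balances (Ic := Ic) (It := It) (x := fun i => φ n (d i).1) hξ0 hgram
    (η := G.one) (fun i hi => hGreg.one i (Finset.mem_union_left _ hi))
    (fun i hi => hGreg.one i (Finset.mem_union_right _ hi))
    (Finset.card_pos.1 (by exact_mod_cast hcpos)) (Finset.card_pos.1 (by exact_mod_cast htpos)) hδ0
  have hwmin : MinimallyBalances Ic It S (fun i => φ n (d i).1) δ w := hw hfeas
  set W := foldSolution (φ n) (A n) k (trts d) g S (U n ω) d with hW
  -- Uniqueness on the control fold replaces the given weights by the measurable solution, for which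
  -- the noise bound was proved.
  have hwW : ∀ i ∈ Ic, w i = W i := (solution_spec hfeas).2 w hwmin
  set εm := (approxError (controlLaw P) (φ n) S m₀).toReal with hεm'
  set εw := (approxError (controlLaw P) (φ n) S (oddsWeight P e)).toReal with hεw'
  set l := Real.log S.card / ξ n S with hl
  have hl0 : 0 ≤ l := div_nonneg (Real.log_natCast_nonneg _) hξ0.le
  have hεm1 : εm ≤ c4 := by
    have := ENNReal.toReal_le_of_le_ofReal (by positivity) hεm
    rwa [mul_one] at this
  have hεw1 : εw ≤ c2 := by
    have := ENNReal.toReal_le_of_le_ofReal (by positivity) hεw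
    rwa [mul_one] at this
  have hεp1 : Real.sqrt n * (εw * εm) ≤ c5 := by
    have := ENNReal.toReal_le_of_le_ofReal (by positivity) hεp
    rw [ENNReal.toReal_mul, mul_one_div, le_div_iff₀ hsn] at this
    linarith
  have hl1 : l ≤ c1 * n := (ENNReal.ofReal_le_ofReal_iff (by positivity)).1 hlog
  have hξm1 : εm * Real.sqrt l ≤ c6 := by
    have := ENNReal.toReal_le_of_le_ofReal (by positivity) hξm
    rwa [mul_one, ENNReal.toReal_mul, ENNReal.toReal_ofReal (Real.sqrt_nonneg _)] at this
  have hεw0 : 0 ≤ εw := ENNReal.toReal_nonneg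
  have hWn : ∑ i ∈ Ic, (W i - oddsWeight P e (d i).1) ^ 2 ≤ b * n := by
    have h1 := sum_sq_sub_le_two_mul Ic w (fun i => G.wt (d i).1)
      (fun i => oddsWeight P e (d i).1)
    have h2 := hGreg.sum_sq_sub_wt_le hn ha0.le hξ0 (Finset.card_pos.1 (by exact_mod_cast hcpos))
      hgram hwmin hδ2
    have h3 := hGreg.weight
    have h4 : l * K ≤ b / 4 * n := by
      calc l * K ≤ c1 * n * K := by gcongr
        _ = b / 4 * n := by rw [hc1]; field_simp
    have hcard : (Ic.card : ℝ) ≤ n := by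
      exact_mod_cast (Finset.card_le_univ Ic).trans (by simp)
    have h5 : a * (Ic.card * εw ^ 2) ≤ b / 4 * n := by
      calc a * (Ic.card * εw ^ 2) ≤ a * (n * c2 ^ 2) := by gcongr
        _ = b / 4 * n := by rw [hc2, Real.sq_sqrt (by positivity)]; field_simp
    have h8 : ∑ i ∈ Ic, (W i - oddsWeight P e (d i).1) ^ 2 =
        ∑ i ∈ Ic, (w i - oddsWeight P e (d i).1) ^ 2 :=
      Finset.sum_congr rfl fun i hi => by rw [hwW i hi]
    have h6 := (mul_le_mul_of_nonneg_left (h2.trans h4) zero_le_two).trans_eq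
      (show 2 * (b / 4 * n) = b * n / 2 by ring)
    have h7 := (mul_le_mul_of_nonneg_left (h3.trans h5) zero_le_two).trans_eq
      (show 2 * (b / 4 * n) = b * n / 2 by ring)
    rw [h8]
    exact (h1.trans (add_le_add h6 h7)).trans_eq (add_halves _)
  set T3 := ∑ i ∈ Ic, (w i - oddsWeight P e (d i).1) * (y0 (d i) - m₀ (d i).1) with hT3
  have hT : |T3| / Real.sqrt n ≤ κ' := by
    have h1 : T3 ^ 2 ≤ κ' ^ 2 * n := by
      by_contra! hlt
      rw [hT3, Finset.sum_congr rfl fun i hi => by rw [hwW i hi]] at hlt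
      exact hN ⟨hWn, hlt⟩
    rw [div_le_iff₀ hsn]
    refine abs_le_of_sq_le_sq ?_ (by positivity)
    rwa [mul_pow, hsn2]
  have hmain := hGreg.sqrt_mul_fold_error_le hn ha0.le hM0.le hξ0 hc₀ hszc hszt hgram hwmin hδ0 hδ2
    (fun i => y0 (d i)) (estimand P)
  refine hmain.trans ?_
  have t1 : M₃ * (Real.sqrt n * δ) ≤ κ / 5 := by
    calc M₃ * (Real.sqrt n * δ) ≤ (|M₃| + 1) * c3 := by
          refine mul_le_mul ?_ hδ1 (by positivity) (by positivity)
          linarith [le_abs_self M₃]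
      _ ≤ (|M₃| + 1) * (κ / 5 / (|M₃| + 1)) := by gcongr; exact min_le_right _ _
      _ = κ / 5 := by field_simp
  have t2 : L4 * εm ≤ κ / 5 := by
    calc L4 * εm ≤ (L4 + 1) * c4 := by gcongr; linarith
      _ = κ / 5 := by exact mul_div_cancel₀ _ hL40.ne'
  have t3 : 1 / c₀ * (|T3| / Real.sqrt n) ≤ κ / 5 := by
    calc 1 / c₀ * (|T3| / Real.sqrt n) ≤ 1 / c₀ * κ' := by gcongr
      _ = κ / 5 := by rw [hκ']; field_simp
  have t4 : L6 * (εm * Real.sqrt l) ≤ κ / 5 := by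
    calc L6 * (εm * Real.sqrt l) ≤ (L6 + 1) * c6 := by gcongr; linarith
      _ = κ / 5 := by exact mul_div_cancel₀ _ hL60.ne'
  have t5 : a * (Real.sqrt n * (εw * εm)) ≤ κ / 5 := by
    calc a * (Real.sqrt n * (εw * εm)) ≤ a * c5 := by gcongr
      _ = κ / 5 := by rw [hc5]; field_simp
  linarith

end Asymptotics

/-! ### Sample sums and the combination of the two folds. -/

section Sums

variable {𝓩 𝓤 Ω : Type*} [MeasurableSpace 𝓩] [StandardBorelSpace 𝓩] [MeasurableSpace 𝓤]
  [MeasurableSpace Ω] {μ : Measure Ω} [IsProbabilityMeasure μ] {P : Measure (PotentialUnit 𝓩)}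
  [IsProbabilityMeasure P] {e m₀ : 𝓩 → ℝ} {D : ℕ → Ω → PotentialUnit 𝓩} {U : ℕ → Ω → 𝓤}

lemma IsSampling.measurePreserving (hs : IsSampling μ P D U) (i : ℕ) :
    MeasurePreserving (D i) μ P := ⟨hs.meas i, hs.law i⟩

/-- Chebyshev's inequality for sums over the sample. -/
lemma IsSampling.measure_sqrt_le_abs_sum_le (hs : IsSampling μ P D U) {f : PotentialUnit 𝓩 → ℝ}
    (hf : Measurable f) (hf2 : MemLp f 2 P) (h0 : ∫ u, f u ∂P = 0) {M : ℝ} (hM : 0 < M) {n : ℕ}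
    (hn : 0 < n) :
    μ {ω | M * Real.sqrt n ≤ |∑ i : Fin n, f (D i ω)|} ≤ ENNReal.ofReal (variance f P / M ^ 2) := by
  have hn' : (0 : ℝ) < n := by exact_mod_cast hn
  let X : Fin n → Ω → ℝ := fun i ω => f (D i ω)
  have hX : ∀ i, MemLp (X i) 2 μ := fun i => hf2.comp_measurePreserving (hs.measurePreserving i)
  have hvar : ∀ i, variance (X i) μ = variance f P := fun i => by
    have := variance_map (μ := μ) (X := f) (Y := D i) (by rw [hs.law]; exact hf.aemeasurable)
      (hs.meas i).aemeasurable
    rw [hs.law] at this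
    exact this.symm
  have hmean : ∀ i, ∫ ω, X i ω ∂μ = 0 := fun i => by
    rw [← h0, ← hs.law i, integral_map (hs.meas i).aemeasurable hf.aestronglyMeasurable]
  have hind : Set.Pairwise (↑(Finset.univ : Finset (Fin n)))
      fun i j => IndepFun (X i) (X j) μ := fun i _ j _ hij =>
    (hs.indep.indepFun (Fin.val_injective.ne hij)).comp hf hf
  have hvs := IndepFun.variance_sum (fun i _ => hX i) hind
  have hm : ∫ ω, (∑ i, X i) ω ∂μ = 0 := by
    simp_rw [Finset.sum_apply]
    rw [integral_finsetSum _ fun i _ => (hX i).integrable (by norm_num)]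
    exact Finset.sum_eq_zero fun i _ => hmean i
  have key := meas_ge_le_variance_div_sq (memLp_finsetSum' Finset.univ fun i _ => hX i)
    (show 0 < M * Real.sqrt n by positivity)
  rw [hm, hvs] at key
  simp only [hvar, Finset.sum_const, Finset.card_univ, Fintype.card_fin, nsmul_eq_mul, sub_zero,
    Finset.sum_apply, mul_pow, Real.sq_sqrt hn'.le] at key
  rwa [mul_comm (M ^ 2), mul_div_mul_left _ _ hn'.ne'] at key

/-- Markov's inequality for averages over the sample. -/
lemma IsSampling.measure_mul_le_sum_abs_le (hs : IsSampling μ P D U) {f : PotentialUnit 𝓩 → ℝ}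
    (hf : Measurable f) (hint : Integrable f P) {M : ℝ} (hM : 0 < M) {n : ℕ} (hn : 0 < n) :
    μ {ω | M * n ≤ ∑ i : Fin n, |f (D i ω)|} ≤ ENNReal.ofReal ((∫ u, |f u| ∂P) / M) := by
  have hn' : (0 : ℝ) < n := by exact_mod_cast hn
  have hi : ∀ i : Fin n, Integrable (fun ω => |f (D i ω)|) μ := fun i =>
    (hs.measurePreserving i).integrable_comp_of_integrable hint.abs
  have hsum : ∫ ω, ∑ i : Fin n, |f (D i ω)| ∂μ = n * ∫ u, |f u| ∂P := by
    rw [integral_finsetSum _ fun i _ => hi i]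
    have : ∀ i : Fin n, ∫ ω, |f (D i ω)| ∂μ = ∫ u, |f u| ∂P := fun i => by
      rw [← hs.law i, integral_map (hs.meas i).aemeasurable
        (Measurable.aestronglyMeasurable (by fun_prop))]
    simp [this]
  have key := mul_meas_ge_le_integral_of_nonneg
    (ae_of_all μ fun ω => Finset.sum_nonneg
      fun (i : Fin n) (_ : i ∈ Finset.univ) => abs_nonneg (f (D i ω)))
    (integrable_finsetSum _ fun i _ => hi i) (M * n)
  rw [hsum] at key
  rw [← ofReal_measureReal]
  refine ENNReal.ofReal_le_ofReal ?_
  rw [le_div_iff₀ hM]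
  refine le_of_mul_le_mul_left ?_ hn'
  calc n * (μ.real {ω | M * n ≤ ∑ i : Fin n, |f (D i ω)|} * M)
      = M * n * μ.real {ω | M * n ≤ ∑ i : Fin n, |f (D i ω)|} := by ring
    _ ≤ _ := key

/-- Centred indicator of an arm. -/
def armDev (P : Measure (PotentialUnit 𝓩)) (b : Bool) (u : PotentialUnit 𝓩) : ℝ :=
  (if trt u = b then 1 else 0) - armProb b (treatProb P)

lemma measurable_armDev (b : Bool) : Measurable (armDev P b) :=
  (Measurable.ite (measurableSet_trt b) measurable_const measurable_const).sub_const _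

lemma IsPopulation.memLp_armDev (h : IsPopulation P e m₀) (b : Bool) : MemLp (armDev P b) 2 P := by
  have hp := armProb_pos h.treatProb_mem b
  have hp1 := armProb_le_one h.treatProb_mem b
  refine MemLp.of_bound (measurable_armDev b).aestronglyMeasurable 1 (ae_of_all _ fun u => ?_)
  rw [Real.norm_eq_abs, abs_le, armDev]
  split_ifs <;> constructor <;> linarith

lemma IsPopulation.integral_armDev (h : IsPopulation P e m₀) (b : Bool) :
    ∫ u, armDev P b u ∂P = 0 := by
  have hi : Integrable (fun u : PotentialUnit 𝓩 => if trt u = b then (1 : ℝ) else 0) P := by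
    have := (h.memLp_armDev b).integrable (by norm_num) |>.add
      (integrable_const (armProb b (treatProb P)))
    refine this.congr (ae_of_all _ fun u => ?_)
    simp [armDev]
  have h1 : ∫ u, (if trt u = b then (1 : ℝ) else 0) ∂P = armProb b (treatProb P) := by
    have : (fun u : PotentialUnit 𝓩 => if trt u = b then (1 : ℝ) else 0) =
        Set.indicator {u | trt u = b} fun _ => 1 := by
      ext u; simp [Set.indicator]
    rw [this, integral_indicator_const _ (measurableSet_trt b), smul_eq_mul, mul_one,
      Measure.real, h.measure_trt, ENNReal.toReal_ofReal (armProb_pos h.treatProb_mem b).le]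
  unfold armDev
  rw [integral_sub hi (integrable_const _), h1]
  simp

/-- The units of arm `b`. -/
def arm {n : ℕ} (d : Fin n → ObservedUnit 𝓩) (b : Bool) : Finset (Fin n) :=
  Finset.univ.filter fun i => (d i).2.1 = b

lemma sum_foldArm {n : ℕ} (g : Fin n → Fin 2) (d : Fin n → ObservedUnit 𝓩) (b : Bool)
    (F : Fin n → ℝ) :
    ∑ i ∈ foldArm g d b 0, F i + ∑ i ∈ foldArm g d b 1, F i = ∑ i ∈ arm d b, F i := by
  have h1 : ∀ k, foldArm g d b k = (arm d b).filter fun i => g i = k := fun k => by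
    rw [arm, Finset.filter_filter]; rfl
  rw [h1, h1, ← Finset.sum_filter_add_sum_filter_not (arm d b) fun i => g i = 0]
  congr 2
  ext i
  simp only [Finset.mem_filter, and_congr_right_iff]
  intro _
  omega

lemma card_foldArm {n : ℕ} (g : Fin n → Fin 2) (d : Fin n → ObservedUnit 𝓩) (b : Bool) :
    ((foldArm g d b 0).card : ℝ) + (foldArm g d b 1).card = (arm d b).card := by
  simpa using sum_foldArm g d b fun _ => 1

lemma abs_card_foldArm_sub_le {n p : ℕ} (A : Procedure 𝓩 𝓤 n p) (u : 𝓤)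
    (d : Fin n → ObservedUnit 𝓩) (b : Bool) :
    |((foldArm (A.labels u d) d b 0).card : ℝ) - (foldArm (A.labels u d) d b 1).card| ≤ 1 := by
  obtain ⟨h1, h2⟩ := A.split.balanced u (fun i => (d i).2.1) b
  have h1' : ((foldArm (A.labels u d) d b 0).card : ℝ) ≤ (foldArm (A.labels u d) d b 1).card + 1 := by
    exact_mod_cast h1
  have h2' : ((foldArm (A.labels u d) d b 1).card : ℝ) ≤ (foldArm (A.labels u d) d b 0).card + 1 := by
    exact_mod_cast h2
  rw [abs_le]
  constructor <;> linarith

lemma sum_armDev {n : ℕ} (D : ℕ → Ω → PotentialUnit 𝓩) (ω : Ω) (b : Bool) :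
    ∑ i : Fin n, armDev P b (D i ω) =
      ((arm (sample D n ω) b).card : ℝ) - n * armProb b (treatProb P) := by
  unfold armDev
  rw [Finset.sum_sub_distrib, Finset.sum_const, Finset.card_univ, Fintype.card_fin, nsmul_eq_mul,
    Finset.sum_boole]
  rfl

/-- The folds have size proportional to `n` with probability tending to one. -/
lemma IsSampling.vanishing_foldArm_lt (hs : IsSampling μ P D U) (h : IsPopulation P e m₀) {p : ℕ → ℕ}
    (A : ∀ n, Procedure 𝓩 𝓤 n (p n)) (k : Fin 2) (b : Bool) {c₀ : ℝ}
    (hc₀ : 4 * c₀ ≤ armProb b (treatProb P)) :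
    Vanishing μ fun n => {ω | ¬ c₀ * n ≤
      ((foldArm ((A n).labels (U n ω) (sample D n ω)) (sample D n ω) b k).card : ℝ)} := by
  set q := armProb b (treatProb P) with hq
  have hq0 : 0 < q := armProb_pos h.treatProb_mem b
  refine vanishing_of_forall_le fun η hη => ?_
  set V := variance (armDev P b) P
  have hV : 0 ≤ V := variance_nonneg _ _
  set M := Real.sqrt ((V + 1) / η) with hM
  have hM0 : 0 < M := by positivity
  have hMη : V / M ^ 2 ≤ η := by
    rw [hM, Real.sq_sqrt (by positivity), div_div_eq_mul_div, div_le_iff₀ (by positivity)]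
    nlinarith
  -- For such n the arm has at least 3qn/4 units, q being its probability, and qn ≥ 4; a fold holds
  -- at least half of the arm less one half, hence at least qn/4 ≥ c₀n units.
  have hlarge : ∀ᶠ n : ℕ in atTop, 4 * M / q ≤ Real.sqrt n :=
    (Real.tendsto_sqrt_atTop.comp tendsto_natCast_atTop_atTop).eventually_ge_atTop _
  filter_upwards [hlarge, eventually_gt_atTop 0,
    tendsto_natCast_atTop_atTop.eventually_ge_atTop (4 / q)] with n h1 hn h2
  have hn' : (0 : ℝ) < n := by exact_mod_cast hn
  refine (measure_mono ?_).trans ((hs.measure_sqrt_le_abs_sum_le (measurable_armDev b)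
    (h.memLp_armDev b) (h.integral_armDev b) hM0 hn).trans (ENNReal.ofReal_le_ofReal hMη))
  intro ω hω
  by_contra hcon
  have hcon' : |∑ i : Fin n, armDev P b (D i ω)| < M * Real.sqrt n := not_le.1 hcon
  rw [sum_armDev, abs_lt] at hcon'
  refine hω ?_
  have h3 := card_foldArm ((A n).labels (U n ω) (sample D n ω)) (sample D n ω) b
  have h4 := abs_le.1 (abs_card_foldArm_sub_le (A n) (U n ω) (sample D n ω) b)
  have h5 : M * Real.sqrt n ≤ q * n / 4 := by
    rw [div_le_iff₀ hq0] at h1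
    calc M * Real.sqrt n = 4 * M * Real.sqrt n / 4 := by ring
      _ ≤ Real.sqrt n * q * Real.sqrt n / 4 := by gcongr
      _ = q * (Real.sqrt n * Real.sqrt n) / 4 := by ring
      _ = q * n / 4 := by rw [Real.mul_self_sqrt hn'.le]
  have h6 : 4 ≤ q * n := by rw [div_le_iff₀ hq0] at h2; linarith
  have h7 : 4 * c₀ * n ≤ q * n := by gcongr
  fin_cases k
  · change c₀ * n ≤ ((foldArm _ _ b 0).card : ℝ)
    linarith [hcon'.1, h4.1, h4.2]
  · change c₀ * n ≤ ((foldArm _ _ b 1).card : ℝ)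
    linarith [hcon'.1, h4.1, h4.2]

/-- The part of the influence function carried by the controls, times `1 - p`. -/
def ctlInfluence (P : Measure (PotentialUnit 𝓩)) (e m₀ : 𝓩 → ℝ) (u : PotentialUnit 𝓩) : ℝ :=
  (1 - ind (trt u)) * (oddsWeight P e u.1 * (y0 u - m₀ u.1))

/-- The part of the influence function carried by the treated, times `p`. -/
def trtInfluence (P : Measure (PotentialUnit 𝓩)) (m₀ : 𝓩 → ℝ) (u : PotentialUnit 𝓩) : ℝ :=
  ind (trt u) * (m₀ u.1 - estimand P)

lemma influence_eq (u : PotentialUnit 𝓩) : influence P e m₀ u =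
    ctlInfluence P e m₀ u / (1 - treatProb P) + trtInfluence P m₀ u / treatProb P := by
  unfold influence ctlInfluence trtInfluence
  rw [mul_assoc]

lemma IsPopulation.measurable_ctlInfluence (h : IsPopulation P e m₀) :
    Measurable (ctlInfluence P e m₀) := by
  have := h.measurable_oddsWeight
  have := h.measurable_m
  unfold ctlInfluence; fun_prop

lemma IsPopulation.measurable_trtInfluence (h : IsPopulation P e m₀) :
    Measurable (trtInfluence P m₀) := by
  have := h.measurable_m
  unfold trtInfluence; fun_prop

/-- The two parts of the influence function live on different arms, so each is dominated pointwise
by a multiple of the whole. -/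
lemma IsPopulation.memLp_ctlInfluence (h : IsPopulation P e m₀)
    (hinf : MemLp (influence P e m₀) 2 P) : MemLp (ctlInfluence P e m₀) 2 P := by
  have hp := h.treatProb_mem
  have hp1 : 0 < 1 - treatProb P := by linarith
  refine hinf.of_le_mul (c := 1 - treatProb P) h.measurable_ctlInfluence.aestronglyMeasurable
    (ae_of_all _ fun u => ?_)
  rw [influence_eq]
  cases hu : trt u
  · rw [show trtInfluence P m₀ u = 0 by simp [trtInfluence, hu, ind], zero_div, add_zero, norm_div,
      Real.norm_of_nonneg hp1.le, mul_div_cancel₀ _ hp1.ne']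
  · rw [show ctlInfluence P e m₀ u = 0 by simp [ctlInfluence, hu, ind], norm_zero]
    positivity

lemma IsPopulation.memLp_trtInfluence (h : IsPopulation P e m₀)
    (hinf : MemLp (influence P e m₀) 2 P) : MemLp (trtInfluence P m₀) 2 P := by
  have hp := h.treatProb_mem
  refine hinf.of_le_mul (c := treatProb P) h.measurable_trtInfluence.aestronglyMeasurable
    (ae_of_all _ fun u => ?_)
  rw [influence_eq]
  cases hu : trt u
  · rw [show trtInfluence P m₀ u = 0 by simp [trtInfluence, hu, ind], norm_zero]
    have := hp.1
    positivity
  · rw [show ctlInfluence P e m₀ u = 0 by simp [ctlInfluence, hu, ind], zero_div, zero_add, norm_div,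
      Real.norm_of_nonneg hp.1.le, mul_div_cancel₀ _ hp.1.ne']

lemma IsPopulation.integral_ctlInfluence (h : IsPopulation P e m₀)
    {M₂ : ℝ} (hM₂ : ∀ᵐ z ∂(covLaw P), oddsWeight P e z ≤ M₂)
    (hinf : MemLp (influence P e m₀) 2 P) : ∫ u, ctlInfluence P e m₀ u ∂P = 0 := by
  rw [h.integral_eq_arms ((h.memLp_ctlInfluence hinf).integrable (by norm_num))]
  have h0 : ∫ u, ctlInfluence P e m₀ u ∂(armLaw P false) = 0 := by
    rw [← h.integral_mul_resid_of_integrable hM₂]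
    refine integral_congr_ae ?_
    filter_upwards [ae_armLaw_trt P false] with u hu
    simp [ctlInfluence, hu, ind]
  have h1 : ∫ u, ctlInfluence P e m₀ u ∂(armLaw P true) = 0 := by
    refine integral_eq_zero_of_ae ?_
    filter_upwards [ae_armLaw_trt P true] with u hu
    simp [ctlInfluence, hu, ind]
  rw [h0, h1]; ring

lemma IsPopulation.integral_trtInfluence (h : IsPopulation P e m₀)
    (hinf : MemLp (influence P e m₀) 2 P) : ∫ u, trtInfluence P m₀ u ∂P = 0 := by
  have hpr := h.isProbabilityMeasure_armLaw true
  rw [h.integral_eq_arms ((h.memLp_trtInfluence hinf).integrable (by norm_num))]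
  have h0 : ∫ u, trtInfluence P m₀ u ∂(armLaw P false) = 0 := by
    refine integral_eq_zero_of_ae ?_
    filter_upwards [ae_armLaw_trt P false] with u hu
    simp [trtInfluence, hu, ind]
  have h1 : ∫ u, trtInfluence P m₀ u ∂(armLaw P true) = 0 := by
    have : ∫ u, (m₀ u.1 - estimand P) ∂(armLaw P true) = 0 := by
      rw [integral_sub (h.integrable_armLaw true h.integrable_m) (integrable_const _),
        ← h.estimand_eq]
      simp
    rw [← this]
    refine integral_congr_ae ?_
    filter_upwards [ae_armLaw_trt P true] with u hu
    simp [trtInfluence, hu, ind]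
  rw [h0, h1]; ring

lemma sum_ctlInfluence {n : ℕ} (d : Fin n → PotentialUnit 𝓩) :
    ∑ i, ctlInfluence P e m₀ (d i) =
      ∑ i ∈ arm (obsSample d) false, oddsWeight P e (d i).1 * (y0 (d i) - m₀ (d i).1) := by
  rw [arm, Finset.sum_filter]
  refine Finset.sum_congr rfl fun i _ => ?_
  have : (obsSample d i).2.1 = trt (d i) := rfl
  rw [this, ctlInfluence]
  cases trt (d i) <;> simp [ind]

lemma sum_trtInfluence {n : ℕ} (d : Fin n → PotentialUnit 𝓩) :
    ∑ i, trtInfluence P m₀ (d i) =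
      ∑ i ∈ arm (obsSample d) true, (m₀ (d i).1 - estimand P) := by
  rw [arm, Finset.sum_filter]
  refine Finset.sum_congr rfl fun i _ => ?_
  have : (obsSample d i).2.1 = trt (d i) := rfl
  rw [this, trtInfluence]
  cases trt (d i) <;> simp [ind]

/-- Averaging over two nearly equal folds. -/
lemma abs_combine_folds_le {s p x₀ x₁ y₀ y₁ a₀ a₁ b₀ b₁ θ₀ θ₁ θ κ M M' c₀ : ℝ} (hs : 0 < s)
    (hp : 0 < p ∧ p < 1) (hc₀ : 0 < c₀) (hx₀ : c₀ * s ^ 2 ≤ x₀) (hx₁ : c₀ * s ^ 2 ≤ x₁)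
    (hy₀ : c₀ * s ^ 2 ≤ y₀) (hy₁ : c₀ * s ^ 2 ≤ y₁) (hx : |x₀ - x₁| ≤ 1) (hy : |y₀ - y₁| ≤ 1)
    (h₀ : s * |θ₀ - θ - (a₀ / x₀ + b₀ / y₀)| ≤ κ) (h₁ : s * |θ₁ - θ - (a₁ / x₁ + b₁ / y₁)| ≤ κ)
    (ha : |a₀ + a₁| ≤ M * s) (hb : |b₀ + b₁| ≤ M * s) (hX : |x₀ + x₁ - s ^ 2 * (1 - p)| ≤ M * s)
    (hY : |y₀ + y₁ - s ^ 2 * p| ≤ M * s) (hb₀ : |b₀| ≤ M' * s ^ 2) (hb₁ : |b₁| ≤ M' * s ^ 2) :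
    |s * ((x₀ * θ₀ + x₁ * θ₁) / (x₀ + x₁) - θ) - s⁻¹ * ((a₀ + a₁) / (1 - p) + (b₀ + b₁) / p)| ≤
      κ + (M ^ 2 / (2 * c₀ * (1 - p)) + M ^ 2 / (2 * c₀ * p) + M' / c₀ ^ 2) / s := by
  have hq : 0 < 1 - p := by linarith [hp.2]
  have hp0 := hp.1
  have hs2 : 0 < c₀ * s ^ 2 := by positivity
  have hx₀0 : 0 < x₀ := hs2.trans_le hx₀
  have hx₁0 : 0 < x₁ := hs2.trans_le hx₁
  have hy₀0 : 0 < y₀ := hs2.trans_le hy₀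
  have hy₁0 : 0 < y₁ := hs2.trans_le hy₁
  have hM : 0 ≤ M := nonneg_of_mul_nonneg_left ((abs_nonneg _).trans ha) hs
  have hM' : 0 ≤ M' := nonneg_of_mul_nonneg_left ((abs_nonneg _).trans hb₀) (by positivity)
  set X := x₀ + x₁ with hXd
  set Y := y₀ + y₁ with hYd
  have hX0 : 0 < X := by positivity
  have hY0 : 0 < Y := by positivity
  have hXl : 2 * (c₀ * s ^ 2) ≤ X := by linarith
  have hYl : 2 * (c₀ * s ^ 2) ≤ Y := by linarith
  set E₀ := θ₀ - θ - (a₀ / x₀ + b₀ / y₀) with hE₀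
  set E₁ := θ₁ - θ - (a₁ / x₁ + b₁ / y₁) with hE₁
  -- Here s = √n. The pieces are the averaged fold errors, the replacement of the random arm sizes X
  -- and Y by n(1 − p) and np, and a mismatch: fold k enters with the control share x/X while its
  -- treated sum should carry the share y/Y. Both shares are within O(1/n) of 1/2.
  have hdec : s * ((x₀ * θ₀ + x₁ * θ₁) / X - θ) -
      s⁻¹ * ((a₀ + a₁) / (1 - p) + (b₀ + b₁) / p) =
      (x₀ / X * (s * E₀) + x₁ / X * (s * E₁)) +
      (a₀ + a₁) * (s ^ 2 * (1 - p) - X) / (X * s * (1 - p)) +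
      (b₀ + b₁) * (s ^ 2 * p - Y) / (Y * s * p) +
      (s * (b₀ * (x₀ / X - y₀ / Y) / y₀) + s * (b₁ * (x₁ / X - y₁ / Y) / y₁)) := by
    have e1 : θ₀ = E₀ + θ + (a₀ / x₀ + b₀ / y₀) := by rw [hE₀]; ring
    have e2 : θ₁ = E₁ + θ + (a₁ / x₁ + b₁ / y₁) := by rw [hE₁]; ring
    rw [e1, e2]
    have hX' : X ≠ 0 := hX0.ne'
    have hY' : Y ≠ 0 := hY0.ne'
    have e3 : x₁ = X - x₀ := by rw [hXd]; ring
    have hx1' : X - x₀ ≠ 0 := by rw [← e3]; exact hx₁0.ne'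
    clear_value E₀ E₁ X Y
    rw [e3]
    field_simp
    ring
  have t1 : |x₀ / X * (s * E₀) + x₁ / X * (s * E₁)| ≤ κ := by
    have hle : ∀ x E : ℝ, 0 < x → s * |E| ≤ κ → |x / X * (s * E)| ≤ x / X * κ := fun x E hx hE => by
      rw [abs_mul, abs_mul, abs_of_pos hs, abs_of_pos (by positivity : 0 < x / X)]
      gcongr
    calc _ ≤ x₀ / X * κ + x₁ / X * κ :=
          (abs_add_le _ _).trans (add_le_add (hle _ _ hx₀0 h₀) (hle _ _ hx₁0 h₁))
      _ = κ := by rw [← add_mul, ← add_div, ← hXd, div_self hX0.ne', one_mul]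
  have t2 : |(a₀ + a₁) * (s ^ 2 * (1 - p) - X) / (X * s * (1 - p))| ≤
      M ^ 2 / (2 * c₀ * (1 - p)) / s := by
    rw [abs_div, abs_mul, abs_of_pos (by positivity : 0 < X * s * (1 - p)), abs_sub_comm _ X]
    calc _ ≤ (M * s) * (M * s) / (2 * (c₀ * s ^ 2) * s * (1 - p)) := by gcongr
      _ = _ := by field_simp
  have t3 : |(b₀ + b₁) * (s ^ 2 * p - Y) / (Y * s * p)| ≤ M ^ 2 / (2 * c₀ * p) / s := by
    rw [abs_div, abs_mul, abs_of_pos (by positivity : 0 < Y * s * p), abs_sub_comm _ Y]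
    calc _ ≤ (M * s) * (M * s) / (2 * (c₀ * s ^ 2) * s * p) := by gcongr
      _ = _ := by field_simp
  have hhalf : ∀ x x' : ℝ, 2 * (c₀ * s ^ 2) ≤ x + x' → |x - x'| ≤ 1 →
      |x / (x + x') - 1 / 2| ≤ 1 / (4 * (c₀ * s ^ 2)) := fun x x' hl hd => by
    have hpos : 0 < x + x' := lt_of_lt_of_le (by positivity) hl
    have : x / (x + x') - 1 / 2 = (x - x') / (2 * (x + x')) := by field_simp; ring
    rw [this, abs_div, abs_of_pos (by positivity : 0 < 2 * (x + x'))]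
    exact div_le_div₀ zero_le_one hd (by positivity) (by linarith)
  have hdiff : ∀ x x' y y' : ℝ, 2 * (c₀ * s ^ 2) ≤ x + x' → |x - x'| ≤ 1 →
      2 * (c₀ * s ^ 2) ≤ y + y' → |y - y'| ≤ 1 →
      |x / (x + x') - y / (y + y')| ≤ 1 / (2 * (c₀ * s ^ 2)) := fun x x' y y' h1 h2 h3 h4 => by
    have k1 := hhalf x x' h1 h2
    have k2 := hhalf y y' h3 h4
    have : x / (x + x') - y / (y + y') = (x / (x + x') - 1 / 2) - (y / (y + y') - 1 / 2) := by ring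
    rw [this]
    refine (abs_sub _ _).trans ((add_le_add k1 k2).trans_eq ?_)
    field_simp
    norm_num
  have hterm : ∀ b D y : ℝ, |b| ≤ M' * s ^ 2 → |D| ≤ 1 / (2 * (c₀ * s ^ 2)) → c₀ * s ^ 2 ≤ y →
      |s * (b * D / y)| ≤ M' / c₀ ^ 2 / s / 2 := fun b D y h1 h2 h3 => by
    have hy : 0 < y := hs2.trans_le h3
    rw [abs_mul, abs_div, abs_mul, abs_of_pos hs, abs_of_pos hy]
    calc s * (|b| * |D| / y) ≤ s * (M' * s ^ 2 * (1 / (2 * (c₀ * s ^ 2))) / (c₀ * s ^ 2)) := by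
          gcongr
      _ = _ := by field_simp
  have hd0 := hdiff x₀ x₁ y₀ y₁ hXl hx hYl hy
  have hd1 := hdiff x₁ x₀ y₁ y₀ (by linarith) (by rwa [abs_sub_comm]) (by linarith)
    (by rwa [abs_sub_comm])
  rw [add_comm x₁ x₀, add_comm y₁ y₀] at hd1
  have t4 : |s * (b₀ * (x₀ / X - y₀ / Y) / y₀) + s * (b₁ * (x₁ / X - y₁ / Y) / y₁)| ≤
      M' / c₀ ^ 2 / s := by
    refine (abs_add_le _ _).trans ((add_le_add (hterm _ _ _ hb₀ hd0 hy₀)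
      (hterm _ _ _ hb₁ hd1 hy₁)).trans_eq (add_halves _))
  rw [hdec]
  calc _ ≤ |x₀ / X * (s * E₀) + x₁ / X * (s * E₁)| +
        |(a₀ + a₁) * (s ^ 2 * (1 - p) - X) / (X * s * (1 - p))| +
        |(b₀ + b₁) * (s ^ 2 * p - Y) / (Y * s * p)| +
        |s * (b₀ * (x₀ / X - y₀ / Y) / y₀) + s * (b₁ * (x₁ / X - y₁ / Y) / y₁)| :=
        (abs_add_le _ _).trans (add_le_add ((abs_add_le _ _).trans
          (add_le_add (abs_add_le _ _) le_rfl)) le_rfl)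
    _ ≤ κ + M ^ 2 / (2 * c₀ * (1 - p)) / s + M ^ 2 / (2 * c₀ * p) / s + M' / c₀ ^ 2 / s := by
        gcongr
    _ = _ := by ring

end Sums

/-! ### Asymptotic linearity of the estimator and its limit law. -/

section Linearization

variable {𝓩 𝓤 Ω : Type*} [MeasurableSpace 𝓩] [StandardBorelSpace 𝓩] [MeasurableSpace 𝓤]
  [MeasurableSpace Ω] {μ : Measure Ω} [IsProbabilityMeasure μ] {P : Measure (PotentialUnit 𝓩)}
  [IsProbabilityMeasure P] {e m₀ : 𝓩 → ℝ} {D : ℕ → Ω → PotentialUnit 𝓩} {U : ℕ → Ω → 𝓤}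
  {p : ℕ → ℕ} {φ : ∀ n, 𝓩 → Fin (p n) → ℝ} {A : ∀ n, Procedure 𝓩 𝓤 n (p n)}
  {M₁ M₂ M₃ : ℝ} {ξ : Fin 2 → ∀ n, Finset (Fin (p n)) → ℝ} {c₀ : ℝ} {c : ℝ≥0} {B : ℝ}

/-- The estimator is asymptotically linear with the efficient influence function. -/
lemma IsPopulation.vanishing_remainder (h : IsPopulation P e m₀) (hs : IsSampling μ P D U)
    (hφ : ∀ n, IsDictionary P (φ n) c B) (hc₀ : 0 < c₀)
    (hF : ∀ k, FoldConditions μ P e m₀ D U φ A k M₂ M₃ (ξ k) c₀)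
    (hM₂ : ∀ᵐ z ∂(covLaw P), oddsWeight P e z ≤ M₂) (hm : MemLp m₀ 2 (controlLaw P))
    (hresid : Integrable (fun u => (y0 u - m₀ u.1) ^ 2) P)
    (hM₁ : ∀ᵐ u ∂P, (P[fun u => (y0 u - m₀ u.1) ^ 2 | covAlg 𝓩]) u ≤ M₁) {θhat : ℕ → Ω → ℝ}
    (hθ : ∀ n, ∀ᵐ ω ∂μ, IsCrossBalancing (φ n) (A n) (U n ω) (sample D n ω) (θhat n ω))
    {ε : ℝ} (hε : 0 < ε) :
    Vanishing μ fun n => {ω | ε ≤ |Real.sqrt n * (θhat n ω - estimand P) -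
      (Real.sqrt n)⁻¹ * ∑ i : Fin n, influence P e m₀ (D i ω)|} := by
  have hp := h.treatProb_mem
  have hinf := h.memLp_influence hM₂ hresid hm
  refine vanishing_of_forall_le fun η hη => ?_
  have hη6 : 0 < η / 6 := by positivity
  set V : ℝ := variance (ctlInfluence P e m₀) P + variance (trtInfluence P m₀) P +
    variance (armDev P false) P + variance (armDev P true) P with hV
  have v1 := variance_nonneg (ctlInfluence P e m₀) P
  have v2 := variance_nonneg (trtInfluence P m₀) P
  have v3 := variance_nonneg (armDev P false) P
  have v4 := variance_nonneg (armDev P true) P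
  -- Six events share the probability η. The level M serves the four Chebyshev bounds at once, since
  -- V dominates each of the four variances.
  set M := Real.sqrt ((V + 1) / (η / 6)) with hM
  have hV0 : 0 ≤ V := by positivity
  have hM0 : 0 < M := by positivity
  have hMη : ∀ v, v ≤ V → ENNReal.ofReal (v / M ^ 2) ≤ ENNReal.ofReal (η / 6) := fun v hv => by
    refine ENNReal.ofReal_le_ofReal ?_
    rw [hM, Real.sq_sqrt (by positivity), div_div_eq_mul_div, div_le_iff₀ (by positivity)]
    nlinarith
  set I := ∫ u : PotentialUnit 𝓩, |m₀ u.1 - estimand P| ∂P with hI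
  have hI0 : 0 ≤ I := integral_nonneg fun _ => abs_nonneg _
  -- The treated sum of a single fold is needed only to order n, because it is multiplied by the
  -- O(1/n) mismatch of fold shares. Markov's inequality for Σ|m₀ − θ₀| over the whole sample is
  -- enough.
  set M' := (I + 1) / (η / 6) with hM'
  have hM'0 : 0 < M' := by positivity
  have hM'η : I / M' ≤ η / 6 := by
    rw [hM', div_div_eq_mul_div, div_le_iff₀ (by positivity)]
    nlinarith
  set K := M ^ 2 / (2 * c₀ * (1 - treatProb P)) + M ^ 2 / (2 * c₀ * treatProb P) + M' / c₀ ^ 2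
    with hK
  have hsmall : ∀ᶠ n : ℕ in atTop, K / Real.sqrt n < ε / 2 :=
    (tendsto_const_nhds.div_atTop (Real.tendsto_sqrt_atTop.comp
      tendsto_natCast_atTop_atTop)).eventually_lt_const (by positivity)
  have herr := fun k => (hF k).vanishing_fold_error h hs hφ hc₀ hM₂ hm hresid hM₁
    (show 0 < ε / 2 by positivity)
  have hvan := (((vanishing_of_ae (Eventually.of_forall hθ)).union (herr 0)).union (herr 1)).union
    ((((hF 0).size false).union ((hF 1).size false)).union
      (((hF 0).size true).union ((hF 1).size true)))
  filter_upwards [hvan.eventually_le hη6, hsmall, eventually_gt_atTop 0] with n hvn hKn hn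
  have hn' : (0 : ℝ) < n := by exact_mod_cast hn
  have hsn : 0 < Real.sqrt n := Real.sqrt_pos.2 hn'
  have hsn2 : Real.sqrt n ^ 2 = n := Real.sq_sqrt hn'.le
  have e1 := (hs.measure_sqrt_le_abs_sum_le h.measurable_ctlInfluence
    (h.memLp_ctlInfluence hinf) (h.integral_ctlInfluence hM₂ hinf) hM0 hn).trans
    (hMη _ (by linarith))
  have e2 := (hs.measure_sqrt_le_abs_sum_le h.measurable_trtInfluence
    (h.memLp_trtInfluence hinf) (h.integral_trtInfluence hinf) hM0 hn).trans (hMη _ (by linarith))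
  have e3 := (hs.measure_sqrt_le_abs_sum_le (measurable_armDev false)
    (h.memLp_armDev false) (h.integral_armDev false) hM0 hn).trans (hMη _ (by linarith))
  have e4 := (hs.measure_sqrt_le_abs_sum_le (measurable_armDev true)
    (h.memLp_armDev true) (h.integral_armDev true) hM0 hn).trans (hMη _ (by linarith))
  have e5 := (hs.measure_mul_le_sum_abs_le
    (f := fun u : PotentialUnit 𝓩 => m₀ u.1 - estimand P)
    ((h.measurable_m.comp measurable_fst).sub_const _)
    (h.integrable_m.sub (integrable_const _)) hM'0 hn).trans (ENNReal.ofReal_le_ofReal hM'η)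
  have htot : ENNReal.ofReal η = ENNReal.ofReal (η / 6) + (ENNReal.ofReal (η / 6) +
      (ENNReal.ofReal (η / 6) + (ENNReal.ofReal (η / 6) + (ENNReal.ofReal (η / 6) +
        ENNReal.ofReal (η / 6))))) := by
    have h6 : ENNReal.ofReal η = 6 * ENNReal.ofReal (η / 6) := by
      rw [show (6 : ℝ≥0∞) = ENNReal.ofReal 6 by simp, ← ENNReal.ofReal_mul (by norm_num),
        mul_div_cancel₀ _ (by norm_num)]
    rw [h6]; ring
  rw [htot]
  refine le_trans (measure_mono ?_) ((measure_union_le _ _).trans (add_le_add hvn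
    ((measure_union_le _ _).trans (add_le_add e1 ((measure_union_le _ _).trans (add_le_add e2
      ((measure_union_le _ _).trans (add_le_add e3
        ((measure_union_le _ _).trans (add_le_add e4 e5))))))))))
  intro ω hω
  by_contra hcon
  simp only [Set.mem_union, not_or, Set.mem_ofPred_eq, not_not, not_le, not_lt] at hcon
  obtain ⟨⟨⟨⟨⟨w, hw, hwθ⟩, hf0⟩, hf1⟩, ⟨hc0, hc1⟩, ⟨ht0, ht1⟩⟩, g1, g2, g3, g4, g5⟩ := hcon
  replace hf0 := hf0 w (hw 0)
  replace hf1 := hf1 w (hw 1)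
  have hobs : obsSample (fun i : Fin n => D i ω) = sample D n ω := rfl
  simp only [foldLinear, hobs, one_div_mul_eq_div] at hf0 hf1
  refine absurd (show ε ≤ _ from hω) (not_le.2 ?_)
  rw [sum_armDev] at g3 g4
  rw [sum_ctlInfluence, ← sum_foldArm ((A n).labels (U n ω) (sample D n ω))] at g1
  rw [sum_trtInfluence, ← sum_foldArm ((A n).labels (U n ω) (sample D n ω))] at g2
  rw [← card_foldArm ((A n).labels (U n ω) (sample D n ω))] at g3 g4
  have hsum : ∑ i : Fin n, influence P e m₀ (D i ω) =
      (∑ i ∈ arm (sample D n ω) false, oddsWeight P e (D i ω).1 * (y0 (D i ω) - m₀ (D i ω).1)) /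
        (1 - treatProb P) +
      (∑ i ∈ arm (sample D n ω) true, (m₀ (D i ω).1 - estimand P)) / treatProb P := by
    simp only [influence_eq, Finset.sum_add_distrib, ← Finset.sum_div]
    rw [sum_ctlInfluence, sum_trtInfluence]
    rfl
  have hout : ∑ i ∈ controls (sample D n ω), w i * (sample D n ω i).2.2 =
      ∑ i ∈ arm (sample D n ω) false, w i * y0 (D i ω) := by
    refine Finset.sum_congr rfl fun i hi => ?_
    have : trt (D i ω) = false := (Finset.mem_filter.1 hi).2
    simp [sample, observe, this, ind]
  have hcard : ((controls (sample D n ω)).card : ℝ) = (arm (sample D n ω) false).card := rfl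
  have hbk : ∀ k, |∑ i ∈ foldArm ((A n).labels (U n ω) (sample D n ω)) (sample D n ω) true k,
      (m₀ (D i ω).1 - estimand P)| ≤ M' * Real.sqrt n ^ 2 := fun k => by
    rw [hsn2]
    refine ((Finset.abs_sum_le_sum_abs _ _).trans ?_).trans g5.le
    exact Finset.sum_le_sum_of_subset_of_nonneg (Finset.subset_univ _) fun _ _ _ => abs_nonneg _
  rw [hwθ, hsum, hout, hcard, ← card_foldArm ((A n).labels (U n ω) (sample D n ω)),
    ← sum_foldArm ((A n).labels (U n ω) (sample D n ω)),
    ← sum_foldArm ((A n).labels (U n ω) (sample D n ω)),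
    ← sum_foldArm ((A n).labels (U n ω) (sample D n ω))]
  rw [← hsn2] at hc0 hc1 ht0 ht1
  have hpos : ∀ {x : ℝ}, c₀ * Real.sqrt n ^ 2 ≤ x → x ≠ 0 := fun hx =>
    (lt_of_lt_of_le (by positivity) hx).ne'
  have key := abs_combine_folds_le (p := treatProb P) hsn hp hc₀ hc0 hc1 ht0 ht1
    (abs_card_foldArm_sub_le (A n) (U n ω) (sample D n ω) false)
    (abs_card_foldArm_sub_le (A n) (U n ω) (sample D n ω) true)
    hf0 hf1
    g1.le g2.le (by rw [hsn2]; simpa [armProb] using g3.le)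
    (by rw [hsn2]; simpa [armProb] using g4.le) (hbk 0) (hbk 1)
  rw [mul_div_cancel₀ _ (hpos hc0), mul_div_cancel₀ _ (hpos hc1)] at key
  rw [one_div_mul_eq_div]
  exact key.trans_lt (by linarith)

/-- The prognostic score is square-integrable once it is approximated by the features. -/
lemma IsPopulation.memLp_of_approxError_ne_top (h : IsPopulation P e m₀) {q : ℕ}
    {ψ : 𝓩 → Fin q → ℝ} (hψ : IsDictionary P ψ c B) {S : Finset (Fin q)}
    (hS : approxError (controlLaw P) ψ S m₀ ≠ ∞) : MemLp m₀ 2 (controlLaw P) := by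
  obtain ⟨η, hη⟩ := iInf_lt_iff.1 (lt_top_iff_ne_top.2 hS)
  have hlin := hψ.memLp_linComb h (S := S) η
  have hmm := h.measurable_m
  have hmeas := hψ.meas
  have hsub : MemLp (fun z => m₀ z - linComb (ψ z) S η) 2 (controlLaw P) :=
    ⟨Measurable.aestronglyMeasurable (by fun_prop), hη⟩
  exact (hsub.add hlin).ae_eq (ae_of_all _ fun z => by simp)

/-- The central limit theorem for the influence function. -/
lemma IsPopulation.tendstoInDistribution_influence (h : IsPopulation P e m₀)
    (hs : IsSampling μ P D U) (hM₂ : ∀ᵐ z ∂(covLaw P), oddsWeight P e z ≤ M₂)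
    (hinf : MemLp (influence P e m₀) 2 P) :
    TendstoInDistribution (fun (n : ℕ) ω => (Real.sqrt n)⁻¹ *
      ∑ i : Fin n, influence P e m₀ (D i ω)) atTop (id : ℝ → ℝ) (fun _ => μ)
      (gaussianReal 0 (asympVar P e m₀).toNNReal) := by
  have hmeas := h.measurable_influence
  have hlaw : ∀ i, IdentDistrib (influence P e m₀) (influence P e m₀ ∘ D i) P μ := fun i =>
    ⟨hmeas.aemeasurable, (hmeas.comp (hs.meas i)).aemeasurable, by
      rw [← Measure.map_map hmeas (hs.meas i), hs.law]⟩
  have hvar : variance (influence P e m₀ ∘ D 0) μ = asympVar P e m₀ := (hlaw 0).variance_eq.symm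
  have hmean : ∫ ω, (influence P e m₀ ∘ D 0) ω ∂μ = 0 := by
    rw [← (hlaw 0).integral_eq]
    exact h.integral_influence hM₂ (hinf.integrable (by norm_num))
  have key := tendstoInDistribution_inv_sqrt_mul_sum_sub (P := μ)
    (X := fun i => influence P e m₀ ∘ D i) (Y := (id : ℝ → ℝ))
    (P' := gaussianReal 0 (asympVar P e m₀).toNNReal)
    (by rw [hvar]; exact HasLaw.id) ((hlaw 0).memLp_iff.1 hinf)
    (hs.indep.comp _ fun _ => hmeas) fun i => (hlaw i).symm.trans (hlaw 0)
  rw [hmean] at key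
  simpa only [mul_zero, sub_zero, Finset.sum_range, Function.comp_apply] using key

end Linearization

end CrossBalancing

end

theorem theorem4
    {𝓩 𝓤 Ω : Type*} [MeasurableSpace 𝓩] [StandardBorelSpace 𝓩] [MeasurableSpace 𝓤]
    [MeasurableSpace Ω] (μ : Measure Ω) [IsProbabilityMeasure μ]
    -- population: law of (Z, T, Y(0), Y(1)), propensity score and prognostic score
    (P : Measure (PotentialUnit 𝓩)) [IsProbabilityMeasure P] (e m₀ : 𝓩 → ℝ)
    (hunconf : Unconfounded P)
    (he : IsRegression P (fun u => ind (trt u)) e) (hoverlap : ∀ z, 0 < e z ∧ e z < 1)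
    (hm₀ : IsRegression P y0 m₀)
    -- i.i.d. sample, and random seeds independent of it
    (D : ℕ → Ω → PotentialUnit 𝓩) (hDmeas : ∀ i, Measurable (D i)) (hDindep : iIndepFun D μ)
    (hDlaw : ∀ i, μ.map (D i) = P)
    (U : ℕ → Ω → 𝓤) (hUmeas : ∀ n, Measurable (U n))
    (hUindep : ∀ n, IndepFun (U n) (fun ω (i : Fin n) => D i ω) μ)
    -- dictionaries of uniformly sub-Gaussian features
    (p : ℕ → ℕ) (φ : ∀ n, 𝓩 → Fin (p n) → ℝ) (hφmeas : ∀ n, Measurable (φ n))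
    (hφsub : ∃ (c : ℝ≥0) (B : ℝ), ∀ n j, |∫ z, φ n z j ∂(covLaw P)| ≤ B ∧
      HasSubgaussianMGF (fun z => φ n z j - ∫ z', φ n z' j ∂(covLaw P)) c (covLaw P))
    -- splitting, selection on the other fold, and the resulting estimator
    (A : ∀ n, Procedure 𝓩 𝓤 n (p n))
    (hintercept : ∀ k : Fin 2, ∀ᶠ n in atTop, ∀ᵐ ω ∂μ,
      ∃ η : (A n).selected k (U n ω) (sample D n ω) → ℝ,
        ∀ᵐ z ∂(covLaw P), linComb (φ n z) ((A n).selected k (U n ω) (sample D n ω)) η = 1)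
    (θhat : ℕ → Ω → ℝ) (hθmeas : ∀ n, Measurable (θhat n))
    (hθ : ∀ n, ∀ᵐ ω ∂μ, IsCrossBalancing (φ n) (A n) (U n ω) (sample D n ω) (θhat n ω))
    -- (i) approximation errors
    (hεw : ∀ k : Fin 2, IsLittleOP μ (fun n ω => approxError (controlLaw P) (φ n)
      ((A n).selected k (U n ω) (sample D n ω)) (oddsWeight P e)) (fun _ => 1))
    (hεm : ∀ k : Fin 2, IsLittleOP μ (fun n ω => approxError (controlLaw P) (φ n)
      ((A n).selected k (U n ω) (sample D n ω)) m₀) (fun _ => 1))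
    (hεprod : ∀ k : Fin 2, IsLittleOP μ (fun n ω =>
      approxError (controlLaw P) (φ n)
          ((A n).selected k (U n ω) (sample D n ω)) (oddsWeight P e) *
        approxError (controlLaw P) (φ n) ((A n).selected k (U n ω) (sample D n ω)) m₀)
      (fun n => 1 / Real.sqrt n))
    (M₁ M₂ M₃ : ℝ)
    (hresid : Integrable (fun u => (y0 u - m₀ u.1) ^ 2) P)
    (hM₁ : ∀ᵐ u ∂P, (P[fun u => (y0 u - m₀ u.1) ^ 2 | covAlg 𝓩]) u ≤ M₁)
    (hM₂ : ∀ᵐ z ∂(covLaw P), oddsWeight P e z ≤ M₂)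
    (hM₂' : ∀ k : Fin 2, ∀ᶠ n in atTop, ∀ᵐ ω ∂μ,
      ∃ η : (A n).selected k (U n ω) (sample D n ω) → ℝ,
        IsBestCoef (controlLaw P) (φ n) _ (oddsWeight P e) η ∧
        ∀ᵐ z ∂(covLaw P), |oddsWeight P e z - linComb (φ n z) _ η| ≤ M₂)
    (hM₃ : ∀ k : Fin 2, ∀ᶠ n in atTop, ∀ᵐ ω ∂μ,
      ∃ η : (A n).selected k (U n ω) (sample D n ω) → ℝ,
        IsBestCoef (controlLaw P) (φ n) _ m₀ η ∧ l1norm η ≤ M₃)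
    -- (ii) imbalance tolerance
    (hδ : ∀ k : Fin 2, IsLittleOP μ
      (fun n ω => ENNReal.ofReal ((A n).tolerance k (U n ω) (sample D n ω)))
      (fun n => 1 / Real.sqrt n))
    -- (iii) eigenvalues
    (ξ : Fin 2 → ∀ n, Finset (Fin (p n)) → ℝ) (hξpos : ∀ k n S, 0 < ξ k n S)
    (hξ : ∀ k : Fin 2, Tendsto (fun n => μ {ω | ¬ EigenCondition (φ n) (sample D n ω)
      ((A n).labels (U n ω) (sample D n ω)) k ((A n).selected k (U n ω) (sample D n ω))
      (ξ k n ((A n).selected k (U n ω) (sample D n ω)))}) atTop (𝓝 0))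
    (hξn : ∀ k : Fin 2, IsLittleOP μ (fun n ω => ENNReal.ofReal
      (Real.log ((A n).selected k (U n ω) (sample D n ω)).card /
        ξ k n ((A n).selected k (U n ω) (sample D n ω)))) (fun n => n))
    (hξm : ∀ k : Fin 2, IsLittleOP μ (fun n ω =>
      approxError (controlLaw P) (φ n) ((A n).selected k (U n ω) (sample D n ω)) m₀ *
        ENNReal.ofReal (Real.sqrt
          (Real.log ((A n).selected k (U n ω) (sample D n ω)).card /
            ξ k n ((A n).selected k (U n ω) (sample D n ω))))) (fun _ => 1)) :
    -- asymptotic normality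
    MemLp (influence P e m₀) 2 P ∧
    TendstoInDistribution (fun (n : ℕ) ω => Real.sqrt n * (θhat n ω - estimand P)) atTop
      (id : ℝ → ℝ) (fun _ => μ) (gaussianReal 0 (asympVar P e m₀).toNNReal) ∧
    -- the asymptotic variance is the semiparametric efficiency bound for the estimand, which is
    -- identified from the law of the observed data
    observedParam (P.map observe) = estimand P ∧
    IsEfficiencyBound (P.map observe) observedParam (asympVar P e m₀) := by
  have h : IsPopulation P e m₀ := ⟨hunconf, he, hoverlap, hm₀⟩
  have hs : IsSampling μ P D U := ⟨hDmeas, hDindep, hDlaw, hUmeas, hUindep⟩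
  obtain ⟨c, B, hcB⟩ := hφsub
  have hφ : ∀ n, IsDictionary P (φ n) c B := fun n =>
    ⟨hφmeas n, fun j => (hcB n j).1, fun j => (hcB n j).2⟩
  -- Square-integrability of m₀ is not assumed. Since ε(Ŝ; m₀) = o_P(1), for some n it is finite on
  -- at least one outcome, and m₀ then differs from a linear combination of square-integrable
  -- features by an L² function.
  have hm : MemLp m₀ 2 (controlLaw P) := by
    obtain ⟨n, hn⟩ := ((tendsto_order.1 (hεm 0 1 one_pos)).2 1 one_pos).exists
    obtain ⟨ω, hω⟩ : ∃ ω, approxError (controlLaw P) (φ n)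
        ((A n).selected 0 (U n ω) (sample D n ω)) m₀ ≤ ENNReal.ofReal (1 * 1) := by
      by_contra! hcon
      refine hn.ne ((congrArg μ (Set.eq_univ_of_forall fun ω => ?_)).trans measure_univ)
      exact hcon ω
    exact h.memLp_of_approxError_ne_top (hφ n) (ne_top_of_le_ne_top ENNReal.ofReal_ne_top hω)
  have hinf := h.memLp_influence hM₂ hresid hm
  have hp := h.treatProb_mem
  -- A quarter of the smaller arm probability: half for splitting into folds, the rest for random
  -- fluctuation and rounding.
  set c₀ := min (treatProb P) (1 - treatProb P) / 4 with hc₀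
  have hc₀0 : 0 < c₀ := div_pos (lt_min hp.1 (by linarith)) (by norm_num)
  have hc₀b : ∀ b, 4 * c₀ ≤ armProb b (treatProb P) := fun b => by
    have h1 := min_le_left (treatProb P) (1 - treatProb P)
    have h2 := min_le_right (treatProb P) (1 - treatProb P)
    rw [hc₀]
    cases b <;> simp only [armProb, Bool.false_eq_true, if_true, if_false] <;> linarith
  have hF : ∀ k, FoldConditions μ P e m₀ D U φ A k M₂ M₃ (ξ k) c₀ := fun k => {
    admissible := by
      filter_upwards [hintercept k, hM₂' k, hM₃ k] with n h1 h2 h3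
      filter_upwards [h1, h2, h3] with ω ⟨η₁, h1⟩ ⟨η₂, h2, h2'⟩ ⟨η₃, h3, h3'⟩
      exact ⟨⟨η₁, h1, η₂, h2, h2', η₃, h3, h3'⟩⟩
    weight := hεw k
    regr := hεm k
    prod := hεprod k
    tol := hδ k
    eigen_pos := hξpos k
    eigen := hξ k
    eigen_log := hξn k
    eigen_regr := hξm k
    size := fun b => hs.vanishing_foldArm_lt h A k b (hc₀b b) }
  refine ⟨hinf, ?_, h.observedParam_eq, h.isEfficiencyBound hM₂ hinf⟩
  -- Slutsky: the estimator differs from the normalised sum of influence functions by a term tending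
  -- to zero in probability.
  refine tendstoInDistribution_of_tendstoInMeasure_sub _ _
    (h.tendstoInDistribution_influence hs hM₂ hinf) ?_
    fun n => (((hθmeas n).sub_const _).const_mul _).aemeasurable
  rw [tendstoInMeasure_iff_norm]
  intro ε hε
  simpa [Real.norm_eq_abs, Vanishing] using
    h.vanishing_remainder hs hφ hc₀0 hF hM₂ hm hresid hM₁ hθ hε
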